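/- Let $k$ be a field and let $\mathrm{Ch}(k)$ be the category of unbounded chain complexes of $k$-vector spaces, with its usual symmetric monoidal structure (Koszul sign rule). An $\mathbb{S}$-module $M$ is a sequence of complexes $M(n)$, $n\ge 0$, with an action of the symmetric group $\mathbb{S}_n$ on $M(n)$ (equivalently, a functor from finite sets and bijections to $\mathrm{Ch}(k)$). Its Schur functor is $$S_M:\mathrm{Ch}(k)\to\mathrm{Ch}(k),\qquad S_M(V)=\bigoplus_{n\ge 0} M(n)\otimes_{\mathbb{S}_n} V^{\otimes n}.$$ The composition product $M\circ N$ is the $\mathbb{S}$-module given on a finite set $S$ by $$(M\circ N)(S)=\bigoplus_{n\ge0} M(n)\otimes_{\mathbb{S}_n}\Big(\bigoplus_{f:S\to\{1,\dots,n\}} N(f^{-1}(1))\otimes\cdots\otimes N(f^{-1}(n))\Big);$$ it is monoidal, its unit $I$ is $k$ in arity one and $0$ in all other arities, and $S_{M\circ N}\cong S_M S_N$, $S_I\cong\mathrm{id}$. Let $\mathcal P$ be a symmetric operad, i.e. a monoid for $\circ$, and let $\mathcal C$ be a symmetric cooperad, i.e. a comonoid for $\circ$. A $\mathcal P$-algebra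 is a complex $A$ with a unital and associative action $S_{\mathcal P}(A)\to A$; a conilpotent $\mathcal C$-coalgebra is a complex $A$ with a counital and coassociative coaction $A\to S_{\mathcal C}(A)$. Morphisms are the chain maps compatible with the (co)action. Then: 1. The category of $\mathcal P$-algebras and the category of conilpotent $\mathcal C$-coalgebras are locally presentable. 2. The forgetful functor from $\mathcal P$-algebras to $\mathrm{Ch}(k)$ is monadic, and the underlying functor of its monad is isomorphic to $S_{\mathcal P}$. The forgetful functor from conilpotent $\mathcal C$-coalgebras to $\mathrm{Ch}(k)$ is comonadic, and the underlying functor of its comonad is isomorphic to $S_{\mathcal C}$. 3. For every $\mathbb{S}$-module $M$, the functor $S_M$ preserves filtered colimits and is accessible. -/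

import Mathlib

universe v u

namespace OperadTheory

open CategoryTheory Limits

/-! ### The Koszul symmetry of graded vector spaces -/

noncomputable section Graded

open scoped MonoidalCategory
open GradedObject GradedObject.Monoidal

variable {K : Type u} [Field K]

/-- The Koszul symmetry `x ⊗ y ↦ (-1)^{|x| |y|} y ⊗ x` of graded vector spaces. -/
def gradedKoszul (X Y : GradedObject ℤ (ModuleCat.{u} K)) : tensorObj X Y ⟶ tensorObj Y X :=
  fun n => tensorObjDesc (fun i j hij => (i * j).negOnePow • ((β_ (X i) (Y j)).hom ≫
    ιTensorObj Y X j i n ((add_comm j i).trans hij)))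

variable (X Y Z : GradedObject ℤ (ModuleCat.{u} K))

lemma ι_gradedKoszul (i j n : ℤ) (h : i + j = n) :
    ιTensorObj X Y i j n h ≫ gradedKoszul X Y n =
      (i * j).negOnePow • ((β_ (X i) (Y j)).hom ≫
        ιTensorObj Y X j i n ((add_comm j i).trans h)) := by
  simp [gradedKoszul]

lemma units_smul_whiskerRight {C D : ModuleCat.{u} K} (f : C ⟶ D) (s : ℤˣ) (W : ModuleCat.{u} K) :
    (s • f) ▷ W = s • (f ▷ W) :=
  Functor.map_units_smul (R := ℤ) (MonoidalCategory.tensorRight W) s f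

lemma whiskerLeft_units_smul {C D : ModuleCat.{u} K} (f : C ⟶ D) (s : ℤˣ) (W : ModuleCat.{u} K) :
    W ◁ (s • f) = s • (W ◁ f) :=
  Functor.map_units_smul (R := ℤ) (MonoidalCategory.tensorLeft W) s f

lemma ι₃'_whiskerRight_gradedKoszul (i j l n : ℤ) (h : i + j + l = n) :
    ιTensorObj₃' X Y Z i j l n h ≫ whiskerRight (gradedKoszul X Y) Z n =
      (i * j).negOnePow • (((β_ (X i) (Y j)).hom ▷ Z l) ≫
        ιTensorObj₃' Y X Z j i l n (by rw [add_comm j i, h])) := by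
  rw [ιTensorObj₃'_eq _ _ _ _ _ _ _ _ _ rfl, Category.assoc, ι_tensorHom,
    ιTensorObj₃'_eq Y X Z j i l n _ _ (add_comm j i), GradedObject.categoryOfGradedObjects_id,
    MonoidalCategory.tensorHom_id, ← MonoidalCategory.comp_whiskerRight_assoc, ι_gradedKoszul,
    units_smul_whiskerRight, Linear.units_smul_comp, MonoidalCategory.comp_whiskerRight,
    Category.assoc]

lemma ι₃_whiskerLeft_gradedKoszul (i j l n : ℤ) (h : i + j + l = n) :
    ιTensorObj₃ X Y Z i j l n h ≫ whiskerLeft X (gradedKoszul Y Z) n =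
      (j * l).negOnePow • ((X i ◁ (β_ (Y j) (Z l)).hom) ≫
        ιTensorObj₃ X Z Y i l j n (by rw [add_right_comm, h])) := by
  rw [ιTensorObj₃_eq _ _ _ _ _ _ _ _ _ rfl, Category.assoc, ι_tensorHom,
    ιTensorObj₃_eq X Z Y i l j n _ _ (add_comm l j), GradedObject.categoryOfGradedObjects_id,
    MonoidalCategory.id_tensorHom, ← MonoidalCategory.whiskerLeft_comp_assoc, ι_gradedKoszul,
    whiskerLeft_units_smul, Linear.units_smul_comp, MonoidalCategory.whiskerLeft_comp,
    Category.assoc]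

lemma ι₃_gradedKoszul (i j l n : ℤ) (h : i + j + l = n) :
    ιTensorObj₃ X Y Z i j l n h ≫ gradedKoszul X (tensorObj Y Z) n =
      (i * (j + l)).negOnePow • ((β_ (X i) (Y j ⊗ Z l)).hom ≫
        ιTensorObj₃' Y Z X j l i n (by rw [add_comm, ← add_assoc, h])) := by
  rw [ιTensorObj₃_eq _ _ _ _ _ _ _ _ _ rfl, Category.assoc, ι_gradedKoszul,
    ιTensorObj₃'_eq Y Z X j l i n _ _ rfl, Linear.comp_units_smul,
    BraidedCategory.braiding_naturality_right_assoc]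

lemma ι₃'_gradedKoszul (i j l n : ℤ) (h : i + j + l = n) :
    ιTensorObj₃' X Y Z i j l n h ≫ gradedKoszul (tensorObj X Y) Z n =
      ((i + j) * l).negOnePow • ((β_ (X i ⊗ Y j) (Z l)).hom ≫
        ιTensorObj₃ Z X Y l i j n (by rw [add_assoc, add_comm, h])) := by
  rw [ιTensorObj₃'_eq _ _ _ _ _ _ _ _ _ rfl, Category.assoc, ι_gradedKoszul,
    ιTensorObj₃_eq Z X Y l i j n _ _ rfl, Linear.comp_units_smul,
    BraidedCategory.braiding_naturality_left_assoc]

lemma gradedKoszul_hexagon_forward :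
    (associator X Y Z).hom ≫ gradedKoszul X (tensorObj Y Z) ≫ (associator Y Z X).hom =
    whiskerRight (gradedKoszul X Y) Z ≫ (associator Y X Z).hom ≫
      whiskerLeft Y (gradedKoszul X Z) := by
  funext n
  apply tensorObj₃'_ext
  intro i j l h
  simp only [GradedObject.categoryOfGradedObjects_comp, ιTensorObj₃'_associator_hom_assoc,
    reassoc_of% ι₃_gradedKoszul, reassoc_of% ι₃'_whiskerRight_gradedKoszul, Linear.units_smul_comp,
    Linear.comp_units_smul, Category.assoc, ιTensorObj₃'_associator_hom,
    ι₃_whiskerLeft_gradedKoszul, smul_smul]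
  rw [mul_add, Int.negOnePow_add, BraidedCategory.hexagon_forward_assoc]

lemma gradedKoszul_hexagon_reverse :
    (associator X Y Z).inv ≫ gradedKoszul (tensorObj X Y) Z ≫ (associator Z X Y).inv =
    whiskerLeft X (gradedKoszul Y Z) ≫ (associator X Z Y).inv ≫
      whiskerRight (gradedKoszul X Z) Y := by
  funext n
  apply tensorObj₃_ext
  intro i j l h
  simp only [GradedObject.categoryOfGradedObjects_comp, ιTensorObj₃_associator_inv_assoc,
    reassoc_of% ι₃'_gradedKoszul, reassoc_of% ι₃_whiskerLeft_gradedKoszul, Linear.units_smul_comp,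
    Linear.comp_units_smul, Category.assoc, ιTensorObj₃_associator_inv,
    ι₃'_whiskerRight_gradedKoszul, smul_smul]
  rw [add_mul, Int.negOnePow_add, mul_comm (Int.negOnePow _),
    BraidedCategory.hexagon_reverse_assoc]

lemma gradedKoszul_symmetry : gradedKoszul X Y ≫ gradedKoszul Y X = 𝟙 (tensorObj X Y) := by
  funext n
  apply tensorObj_ext
  intro i j h
  simp only [GradedObject.categoryOfGradedObjects_comp, reassoc_of% ι_gradedKoszul,
    Linear.units_smul_comp, Category.assoc, ι_gradedKoszul, Linear.comp_units_smul, smul_smul,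
    SymmetricCategory.symmetry_assoc, mul_comm j i, Int.units_mul_self, one_smul]
  simp

variable {X Y Z}

lemma gradedKoszul_naturality {X' Y' : GradedObject ℤ (ModuleCat.{u} K)} (f : X ⟶ X')
    (g : Y ⟶ Y') :
    tensorHom f g ≫ gradedKoszul X' Y' = gradedKoszul X Y ≫ tensorHom g f := by
  funext n
  apply tensorObj_ext
  intro i j h
  simp only [GradedObject.categoryOfGradedObjects_comp, ι_tensorHom_assoc, ι_gradedKoszul,
    reassoc_of% ι_gradedKoszul, Linear.units_smul_comp, Linear.comp_units_smul, Category.assoc,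
    ι_tensorHom, BraidedCategory.braiding_naturality_assoc]

end Graded

/-! ### The symmetric monoidal category of chain complexes -/

noncomputable section Complexes

open HomologicalComplex
open scoped MonoidalCategory

/-- The signs for which the differential of a tensor product of chain complexes is
`d (x ⊗ y) = d x ⊗ y + (-1)^{|x|} x ⊗ d y`. -/
instance : ComplexShape.TensorSigns (ComplexShape.down ℤ) where
  ε' := MonoidHom.mk' Int.negOnePow Int.negOnePow_add
  rel_add p q r (hpq : q + 1 = p) := show q + r + 1 = p + r by lia
  add_rel p q r (hpq : q + 1 = p) := show r + q + 1 = r + p by lia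
  ε'_succ := by
    rintro _ q rfl
    change Int.negOnePow q = - Int.negOnePow (q + 1)
    rw [Int.negOnePow_succ, neg_neg]

/-- The category of unbounded chain complexes of vector spaces over a field. -/
abbrev Ch (K : Type u) [Field K] := ChainComplex (ModuleCat.{u} K) ℤ

variable {K : Type u} [Field K]

instance : HasColimitsOfSize.{0, 0} (Ch K) :=
  hasColimitsOfSizeShrink.{0, 0, u, u} _

lemma ι_tensor_d (X Y : Ch K) (i j n n' : ℤ) (h : i + j = n) (h' : n' + 1 = n) :
    ιTensorObj X Y i j n h ≫ (X ⊗ Y).d n n' =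
      (X.d i (i - 1) ▷ Y.X j) ≫ ιTensorObj X Y (i - 1) j n' (by lia) +
      i.negOnePow • ((X.X i ◁ Y.d j (j - 1)) ≫ ιTensorObj X Y i (j - 1) n' (by lia)) := by
  have h1 : (ComplexShape.down ℤ).Rel i (i - 1) := show i - 1 + 1 = i by lia
  have h2 : (ComplexShape.down ℤ).Rel j (j - 1) := show j - 1 + 1 = j by lia
  have e1 := mapBifunctor.d₁_eq X Y (MonoidalCategory.curriedTensor _) (ComplexShape.down ℤ) h1 j n'
    (show i - 1 + j = n' by lia)
  have e2 := mapBifunctor.d₂_eq X Y (MonoidalCategory.curriedTensor _) (ComplexShape.down ℤ) i h2 n'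
    (show i + (j - 1) = n' by lia)
  change ιTensorObj X Y i j n h ≫ (mapBifunctor.D₁ X Y (MonoidalCategory.curriedTensor _)
    (ComplexShape.down ℤ) n n' + mapBifunctor.D₂ X Y (MonoidalCategory.curriedTensor _)
    (ComplexShape.down ℤ) n n') = _
  rw [Preadditive.comp_add, mapBifunctor.ι_D₁, mapBifunctor.ι_D₂, e1, e2]
  refine congrArg₂ (· + ·) ?_ rfl
  exact one_smul _ _

/-- The components of the Koszul symmetry of chain complexes. -/
def koszulF (X Y : Ch K) (n : ℤ) : (X ⊗ Y).X n ⟶ (Y ⊗ X).X n := gradedKoszul X.X Y.X n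

lemma ι_koszulF (X Y : Ch K) (i j n : ℤ) (h : i + j = n) :
    ιTensorObj X Y i j n h ≫ koszulF X Y n =
      (i * j).negOnePow • ((β_ (X.X i) (Y.X j)).hom ≫
        ιTensorObj Y X j i n ((add_comm j i).trans h)) :=
  ι_gradedKoszul X.X Y.X i j n h

lemma koszulF_comm (X Y : Ch K) (n n' : ℤ) (h : n' + 1 = n) :
    koszulF X Y n ≫ (Y ⊗ X).d n n' = (X ⊗ Y).d n n' ≫ koszulF X Y n' := by
  refine mapBifunctor.hom_ext (F := MonoidalCategory.curriedTensor _) ?_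
  intro i j hij
  change i + j = n at hij
  change ιTensorObj X Y i j n hij ≫ _ = ιTensorObj X Y i j n hij ≫ _
  rw [← Category.assoc, ι_koszulF, Linear.units_smul_comp, Category.assoc, ι_tensor_d _ _ _ _ _ _ _ h,
    ← Category.assoc (ιTensorObj X Y i j n hij), ι_tensor_d _ _ _ _ _ _ _ h, Preadditive.add_comp,
    Linear.units_smul_comp, Category.assoc, Category.assoc, ι_koszulF, ι_koszulF,
    Linear.comp_units_smul, Linear.comp_units_smul, BraidedCategory.braiding_naturality_left_assoc,
    BraidedCategory.braiding_naturality_right_assoc, smul_smul, Preadditive.comp_add,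
    Linear.comp_units_smul, smul_add, smul_smul, add_comm, ← Int.negOnePow_add, ← Int.negOnePow_add]
  have e1 : (i * j + j).negOnePow = ((i - 1) * j).negOnePow :=
    (Int.negOnePow_eq_iff _ _).2 ⟨j, by ring⟩
  have e2 : i + i * (j - 1) = i * j := by ring
  rw [e1, e2]

/-- The Koszul symmetry `x ⊗ y ↦ (-1)^{|x| |y|} y ⊗ x` of chain complexes. -/
def koszul (X Y : Ch K) : X ⊗ Y ⟶ Y ⊗ X where
  f := koszulF X Y
  comm' n n' h := koszulF_comm X Y n n' h

lemma koszul_naturality_right (X : Ch K) {Y Z : Ch K} (f : Y ⟶ Z) :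
    (X ◁ f) ≫ koszul X Z = koszul X Y ≫ (f ▷ X) := by
  ext n : 1
  have h := congrFun (gradedKoszul_naturality (X := X.X) (X' := X.X) (Y := Y.X) (Y' := Z.X)
    (𝟙 X.X) (fun i => f.f i)) n
  exact h

lemma koszul_naturality_left {X Y : Ch K} (f : X ⟶ Y) (Z : Ch K) :
    (f ▷ Z) ≫ koszul Y Z = koszul X Z ≫ (Z ◁ f) := by
  ext n : 1
  have h := congrFun (gradedKoszul_naturality (X := X.X) (X' := Y.X) (Y := Z.X) (Y' := Z.X)
    (fun i => f.f i) (𝟙 Z.X)) n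
  exact h

instance : SymmetricCategory (Ch K) where
  braiding X Y :=
    { hom := koszul X Y
      inv := koszul Y X
      hom_inv_id := HomologicalComplex.hom_ext _ _ fun n =>
        congrFun (gradedKoszul_symmetry X.X Y.X) n
      inv_hom_id := HomologicalComplex.hom_ext _ _ fun n =>
        congrFun (gradedKoszul_symmetry Y.X X.X) n }
  braiding_naturality_right X _ _ f := koszul_naturality_right X f
  braiding_naturality_left f Z := koszul_naturality_left f Z
  hexagon_forward X Y Z := HomologicalComplex.hom_ext _ _ fun n =>
    congrFun (gradedKoszul_hexagon_forward X.X Y.X Z.X) n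
  hexagon_reverse X Y Z := HomologicalComplex.hom_ext _ _ fun n =>
    congrFun (gradedKoszul_hexagon_reverse X.X Y.X Z.X) n
  symmetry X Y := HomologicalComplex.hom_ext _ _ fun n =>
    congrFun (gradedKoszul_symmetry X.X Y.X) n

end Complexes
/-! ### Iterated tensor products -/

open MonoidalCategory

section Tensor
variable {E : Type u} [Category.{v} E] [MonoidalCategory E]

/-- The tensor product `X a₁ ⊗ (X a₂ ⊗ (⋯ ⊗ 𝟙))` of a family along a list of indices. -/
def tensorList {ι : Type} (X : ι → E) : List ι → E
  | [] => 𝟙_ E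
  | a :: l => X a ⊗ tensorList X l

/-- Functoriality of `tensorList` along a map of index types. -/
def tensorReindex {ι κ : Type} {X : ι → E} {Y : κ → E} (e : ι → κ) (f : ∀ i, X i ⟶ Y (e i)) :
    ∀ l : List ι, tensorList X l ⟶ tensorList Y (l.map e)
  | [] => 𝟙 (𝟙_ E)
  | a :: l => f a ⊗ₘ tensorReindex e f l

/-- Functoriality of `tensorList` in the family. -/
def tensorListMap {ι : Type} {X Y : ι → E} (f : ∀ i, X i ⟶ Y i) :
    ∀ l : List ι, tensorList X l ⟶ tensorList Y l
  | [] => 𝟙 (𝟙_ E)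
  | a :: l => f a ⊗ₘ tensorListMap f l

/-- A family of maps out of the unit gives a map from the unit to the tensor product. -/
def tensorListUnit {ι : Type} {X : ι → E} (f : ∀ i, 𝟙_ E ⟶ X i) :
    ∀ l : List ι, 𝟙_ E ⟶ tensorList X l
  | [] => 𝟙 (𝟙_ E)
  | a :: l => (λ_ (𝟙_ E)).inv ≫ (f a ⊗ₘ tensorListUnit f l)

/-- The canonical isomorphism from the tensor product of two lists to that of their
concatenation. -/
def tensorAppend {ι : Type} (X : ι → E) (l' : List ι) :
    ∀ l : List ι, tensorList X l ⊗ tensorList X l' ⟶ tensorList X (l ++ l')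
  | [] => (λ_ _).hom
  | a :: l => (α_ _ _ _).hom ≫ (X a ◁ tensorAppend X l' l)

/-- The canonical isomorphism from an iterated tensor product to the tensor product
along the concatenated list. -/
def tensorFlatten {ι : Type} {J : ι → Type} (X : (Σ i, J i) → E) (B : ∀ i, List (J i)) :
    ∀ l : List ι, tensorList (fun i => tensorList (fun j => X ⟨i, j⟩) (B i)) l ⟶
      tensorList X (l.flatMap fun i => (B i).map (Sigma.mk i))
  | [] => 𝟙 (𝟙_ E)
  | a :: l => (tensorReindex (Y := X) (Sigma.mk a) (fun _ => 𝟙 _) (B a) ⊗ₘ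
      tensorFlatten X B l) ≫ tensorAppend X _ _

lemma tensorListMap_id {ι : Type} (X : ι → E) (l : List ι) :
    tensorListMap (fun i => 𝟙 (X i)) l = 𝟙 _ := by
  induction l with
  | nil => rfl
  | cons a l ih => simp only [tensorListMap, ih]; exact id_tensorHom_id _ _

lemma tensorListMap_comp {ι : Type} {X Y Z : ι → E} (f : ∀ i, X i ⟶ Y i) (g : ∀ i, Y i ⟶ Z i)
    (l : List ι) :
    tensorListMap f l ≫ tensorListMap g l = tensorListMap (fun i => f i ≫ g i) l := by
  induction l with
  | nil => exact Category.id_comp _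
  | cons a l ih =>
    simp only [tensorListMap, ← ih]
    exact tensorHom_comp_tensorHom _ _ _ _

lemma tensorListMap_reindex {ι κ : Type} {X X' : ι → E} {Y Y' : κ → E} (e : ι → κ)
    (f : ∀ i, X i ⟶ Y (e i)) (f' : ∀ i, X' i ⟶ Y' (e i))
    (g : ∀ i, X i ⟶ X' i) (h : ∀ j, Y j ⟶ Y' j)
    (w : ∀ i, g i ≫ f' i = f i ≫ h (e i)) (l : List ι) :
    tensorListMap g l ≫ tensorReindex e f' l =
      tensorReindex e f l ≫ tensorListMap h (l.map e) := by
  induction l with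
  | nil => rfl
  | cons a l ih =>
    refine (tensorHom_comp_tensorHom _ _ _ _).trans ?_
    rw [ih, w]
    exact (tensorHom_comp_tensorHom _ _ _ _).symm

end Tensor

/-- A rearrangement of a list, written as a composite of elementary exchanges. -/
inductive Reordering {ι : Type} : List ι → List ι → Type
  | nil : Reordering [] []
  | cons (a : ι) {l l' : List ι} (r : Reordering l l') : Reordering (a :: l) (a :: l')
  | swap (a b : ι) (l : List ι) : Reordering (a :: b :: l) (b :: a :: l)
  | trans {l l' l'' : List ι} (r : Reordering l l') (r' : Reordering l' l'') : Reordering l l''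

section Symmetric
variable {E : Type u} [Category.{v} E] [MonoidalCategory E] [SymmetricCategory E]

/-- The symmetry isomorphism of tensor products attached to a rearrangement. If the list has no
repetitions, it depends on the two lists only. -/
def Reordering.hom {ι : Type} (X : ι → E) :
    ∀ {l l' : List ι}, Reordering l l' → (tensorList X l ⟶ tensorList X l')
  | _, _, .nil => 𝟙 _
  | _, _, .cons a r => X a ◁ r.hom X
  | _, _, .swap a b l =>
      (α_ (X a) (X b) (tensorList X l)).inv ≫ ((β_ (X a) (X b)).hom ▷ tensorList X l) ≫
        (α_ (X b) (X a) (tensorList X l)).hom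
  | _, _, .trans r r' => r.hom X ≫ r'.hom X

lemma Reordering.hom_naturality {ι : Type} {X Y : ι → E} (f : ∀ i, X i ⟶ Y i)
    {l l' : List ι} (r : Reordering l l') :
    tensorListMap f l ≫ r.hom Y = r.hom X ≫ tensorListMap f l' := by
  induction r with
  | nil => rfl
  | cons a r ih =>
    simp only [Reordering.hom, tensorListMap, tensorList]
    rw [← id_tensorHom, ← id_tensorHom, tensorHom_comp_tensorHom, tensorHom_comp_tensorHom, ih]
    simp
  | swap a b l =>
    simp only [Reordering.hom, tensorListMap, tensorList]
    rw [associator_inv_naturality_assoc, ← tensorHom_id, ← tensorHom_id, Category.assoc,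
      Category.assoc, ← associator_naturality, tensorHom_comp_tensorHom_assoc,
      tensorHom_comp_tensorHom_assoc, BraidedCategory.braiding_naturality]
    simp
  | trans r r' ih ih' =>
    simp only [Reordering.hom]
    rw [← Category.assoc, ih, Category.assoc, ih', Category.assoc]

/-- The canonical isomorphism `⨂ (A i ⊗ B i) ⟶ (⨂ A i) ⊗ (⨂ B i)`. -/
def tensorUnzip {ι : Type} (A B : ι → E) :
    ∀ l : List ι, tensorList (fun i => A i ⊗ B i) l ⟶ tensorList A l ⊗ tensorList B l
  | [] => (λ_ (𝟙_ E)).inv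
  | a :: l => ((A a ⊗ B a) ◁ tensorUnzip A B l) ≫
      tensorμ (A a) (B a) (tensorList A l) (tensorList B l)

end Symmetric

/-- An `𝕊`-module in `E`: a functor from the groupoid of finite sets and bijections to `E`.
Its component of arity `n` is the value at `Fin n`, with its action of `Equiv.Perm (Fin n)`. -/
structure SymMod (E : Type u) [Category.{v} E] where
  obj (S : Type) [Finite S] : E
  map {S T : Type} [Finite S] [Finite T] (e : S ≃ T) : obj S ⟶ obj T
  map_refl (S : Type) [Finite S] : map (Equiv.refl S) = 𝟙 (obj S)
  map_trans {S T U : Type} [Finite S] [Finite T] [Finite U] (e : S ≃ T) (e' : T ≃ U) :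
    map (e.trans e') = map e ≫ map e'

namespace SymMod

/-- A morphism of `𝕊`-modules: a natural transformation. -/
@[ext]
structure Hom {E : Type u} [Category.{v} E] (M N : SymMod E) where
  app (S : Type) [Finite S] : M.obj S ⟶ N.obj S
  naturality {S T : Type} [Finite S] [Finite T] (e : S ≃ T) :
    M.map e ≫ app T = app S ≫ N.map e

instance {E : Type u} [Category.{v} E] : Category (SymMod E) where
  Hom := Hom
  id M := { app := fun S => 𝟙 _, naturality := by intros; simp }
  comp f g :=
    { app := fun S => f.app S ≫ g.app S
      naturality := by
        intro S T _ _ e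
        rw [← Category.assoc, f.naturality, Category.assoc, g.naturality, Category.assoc] }
  id_comp f := Hom.ext (by funext S _; exact Category.id_comp _)
  comp_id f := Hom.ext (by funext S _; exact Category.comp_id _)
  assoc f g h := Hom.ext (by funext S _; exact Category.assoc _ _ _)

end SymMod


/-- A family of objects `X j 0, …, X j (k - 1)` of `E`, for every `k` and every label `j` in a set
`J k` on which the permutations of `Fin k` act, permuting the objects of the family. -/
structure SymFamily (E : Type u) [Category.{v} E] where
  J : ℕ → Type
  act {k : ℕ} (σ : Equiv.Perm (Fin k)) (j : J k) : J k
  X {k : ℕ} (j : J k) (i : Fin k) : E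
  perm {k : ℕ} (σ : Equiv.Perm (Fin k)) (j : J k) (i : Fin k) : X j i ⟶ X (act σ j) (σ i)

/-- The constant family at `V`. -/
abbrev SymFamily.const {E : Type u} [Category.{v} E] (V : E) : SymFamily E where
  J _ := Unit
  act _ j := j
  X _ _ := V
  perm _ _ _ := 𝟙 V

/-- The bijection between fibres `f⁻¹(a) ≃ g⁻¹(b)` obtained by restricting `e : S ≃ T`. -/
def fibreEquiv {S T A B : Type} {f : S → A} {g : T → B} (e : S ≃ T) {a : A} {b : B}
    (h : ∀ s, f s = a ↔ g (e s) = b) : {s // f s = a} ≃ {t // g t = b} :=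
  e.subtypeEquiv h

/-- The values of an `𝕊`-module `N` on the fibres of the maps `f : S → Fin k`. -/
abbrev SymFamily.fibres {E : Type u} [Category.{v} E] (N : SymMod E) (S : Type) [Finite S] :
    SymFamily E where
  J k := S → Fin k
  act σ f := fun s => σ (f s)
  X f i := N.obj {s // f s = i}
  perm σ f i := N.map (fibreEquiv (Equiv.refl S) (fun s => by simp))

noncomputable section Quot
variable {E : Type u} [Category.{v} E] [MonoidalCategory E] [SymmetricCategory E]

namespace SymMod

section Coinv

variable (M : SymMod E) (F : SymFamily E)

/-- `M(k) ⊗ (X j 0 ⊗ ⋯ ⊗ X j (k - 1))`. -/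
abbrev summand {k : ℕ} (j : F.J k) : E :=
  M.obj (Fin k) ⊗ tensorList (F.X j) (List.finRange k)

/-- The action of a permutation `σ` of `Fin k` on the summands of arity `k`: it acts on `M(k)` and
permutes the tensor factors (by the symmetry of `E`, hence with Koszul signs for complexes). -/
def summandPerm {k : ℕ} (j : F.J k) (σ : Equiv.Perm (Fin k))
    (r : Reordering ((List.finRange k).map σ) (List.finRange k)) :
    M.summand F j ⟶ M.summand F (F.act σ j) :=
  M.map σ ⊗ₘ (tensorReindex (Y := F.X (F.act σ j)) σ (F.perm σ j) (List.finRange k) ≫ r.hom _)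

/-- Compatibility of maps of summands with permutations. -/
lemma map_summandPerm {M M' : SymMod E} {F F' : SymFamily E} (φ : M ⟶ M') {k : ℕ}
    {j : F.J k} {j' : F'.J k} (σ : Equiv.Perm (Fin k))
    (r : Reordering ((List.finRange k).map σ) (List.finRange k))
    (f : ∀ i, F.X j i ⟶ F'.X j' i) (g : ∀ i, F.X (F.act σ j) i ⟶ F'.X (F'.act σ j') i)
    (w : ∀ i, f i ≫ F'.perm σ j' i = F.perm σ j i ≫ g (σ i)) :
    (φ.app (Fin k) ⊗ₘ tensorListMap f (List.finRange k)) ≫ M'.summandPerm F' j' σ r =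
      M.summandPerm F j σ r ≫ (φ.app (Fin k) ⊗ₘ tensorListMap g (List.finRange k)) := by
  simp only [summandPerm, tensorHom_comp_tensorHom, Category.assoc]
  rw [← Reordering.hom_naturality, ← Category.assoc (tensorReindex _ _ _),
    ← tensorListMap_reindex σ (F.perm σ j) (F'.perm σ j') f g w, Category.assoc,
    Hom.naturality]

variable [HasColimitsOfSize.{0, 0} E]

/-- The indices of the relations defining the coinvariants. -/
abbrev RelIdx : Type :=
  Σ (k : ℕ) (_ : F.J k) (σ : Equiv.Perm (Fin k)),
    Reordering ((List.finRange k).map σ) (List.finRange k)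

/-- `⨁ₖ M(k) ⊗_{𝕊ₖ} (⨁_{j ∈ J k} X j 0 ⊗ ⋯ ⊗ X j (k - 1))`: the coproduct of all the summands, with
each summand identified with its images under the permutations. -/
def coinv : E :=
  coequalizer
    (Sigma.desc (fun x : RelIdx F =>
      Sigma.ι (fun y : Σ k, F.J k => M.summand F y.2) ⟨x.1, x.2.1⟩))
    (Sigma.desc (fun x : RelIdx F => M.summandPerm F x.2.1 x.2.2.1 x.2.2.2 ≫
      Sigma.ι (fun y : Σ k, F.J k => M.summand F y.2) ⟨x.1, F.act x.2.2.1 x.2.1⟩))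

/-- The projection from the coproduct of the summands to the coinvariants. -/
def coinvProj : (∐ fun y : Σ k, F.J k => M.summand F y.2) ⟶ M.coinv F :=
  coequalizer.π _ _

/-- The canonical map of a summand into the coinvariants. -/
def inc {k : ℕ} (j : F.J k) : M.summand F j ⟶ M.coinv F :=
  Sigma.ι (fun y : Σ k, F.J k => M.summand F y.2) ⟨k, j⟩ ≫ M.coinvProj F

lemma inc_perm {k : ℕ} (j : F.J k) (σ : Equiv.Perm (Fin k))
    (r : Reordering ((List.finRange k).map σ) (List.finRange k)) :
    M.summandPerm F j σ r ≫ M.inc F (F.act σ j) = M.inc F j := by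
  have h := coequalizer.condition
    (Sigma.desc (fun x : RelIdx F =>
      Sigma.ι (fun y : Σ k, F.J k => M.summand F y.2) ⟨x.1, x.2.1⟩))
    (Sigma.desc (fun x : RelIdx F => M.summandPerm F x.2.1 x.2.2.1 x.2.2.2 ≫
      Sigma.ι (fun y : Σ k, F.J k => M.summand F y.2) ⟨x.1, F.act x.2.2.1 x.2.1⟩))
  have h' := congrArg (fun t => Sigma.ι (fun x : RelIdx F => M.summand F x.2.1)
    ⟨k, j, σ, r⟩ ≫ t) h
  simp only [Sigma.ι_desc_assoc, Category.assoc] at h'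
  exact h'.symm

variable {M F} in
/-- Compatibility of a family of maps out of the summands with the permutations. -/
def Compat {Z : E} (g : ∀ (k : ℕ) (j : F.J k), M.summand F j ⟶ Z) : Prop :=
  ∀ (k : ℕ) (j : F.J k) (σ : Equiv.Perm (Fin k))
    (r : Reordering ((List.finRange k).map σ) (List.finRange k)),
    M.summandPerm F j σ r ≫ g k (F.act σ j) = g k j

/-- A map out of the coinvariants is a compatible family of maps out of the summands. -/
def coinvDesc {Z : E} (g : ∀ (k : ℕ) (j : F.J k), M.summand F j ⟶ Z) (hg : Compat g) :
    M.coinv F ⟶ Z :=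
  coequalizer.desc (Sigma.desc fun y => g y.1 y.2) (by
    apply Sigma.hom_ext
    rintro ⟨k, j, σ, r⟩
    simp only [Sigma.ι_desc_assoc, Category.assoc, Sigma.ι_desc]
    exact (hg k j σ r).symm)

lemma inc_coinvDesc {Z : E} (g : ∀ (k : ℕ) (j : F.J k), M.summand F j ⟶ Z) (hg : Compat g)
    {k : ℕ} (j : F.J k) : M.inc F j ≫ M.coinvDesc F g hg = g k j := by
  have h : M.coinvProj F ≫ M.coinvDesc F g hg =
      Limits.Sigma.desc (fun y : Σ k, F.J k => g y.1 y.2) :=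
    coequalizer.π_desc _ _
  rw [inc, Category.assoc, h, Sigma.ι_desc]

variable {M F} in
lemma coinv_hom_ext {Z : E} {f g : M.coinv F ⟶ Z}
    (h : ∀ (k : ℕ) (j : F.J k), M.inc F j ≫ f = M.inc F j ≫ g) : f = g := by
  refine coequalizer.hom_ext (Sigma.hom_ext _ _ ?_)
  rintro ⟨k, j⟩
  have := h k j
  simp only [inc, Category.assoc] at this
  exact this

/-- Families of maps of summands give compatible maps into coinvariants. -/
lemma compat_map {M M' : SymMod E} {F F' : SymFamily E} (φ : M ⟶ M')
    (a : ∀ (k : ℕ), F.J k → F'.J k)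
    (f : ∀ (k : ℕ) (j : F.J k) (i : Fin k), F.X j i ⟶ F'.X (a k j) i)
    (g : ∀ (k : ℕ) (j : F.J k) (σ : Equiv.Perm (Fin k)) (i : Fin k),
      F.X (F.act σ j) i ⟶ F'.X (F'.act σ (a k j)) i)
    (hg : ∀ (k : ℕ) (j : F.J k) (σ : Equiv.Perm (Fin k)),
      (φ.app (Fin k) ⊗ₘ tensorListMap (g k j σ) (List.finRange k)) ≫ M'.inc F' _ =
      (φ.app (Fin k) ⊗ₘ tensorListMap (f k (F.act σ j)) (List.finRange k)) ≫ M'.inc F' _)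
    (w : ∀ (k : ℕ) (j : F.J k) (σ : Equiv.Perm (Fin k)) (i : Fin k),
      f k j i ≫ F'.perm σ (a k j) i = F.perm σ j i ≫ g k j σ (σ i)) :
    Compat (M := M) (F := F) (fun k j =>
      (φ.app (Fin k) ⊗ₘ tensorListMap (f k j) (List.finRange k)) ≫ M'.inc F' (a k j)) := by
  intro k j σ r
  have h := map_summandPerm (F := F) (F' := F') φ (j := j) (j' := a k j) σ r (f k j) (g k j σ)
    (w k j σ)
  have h' := M'.inc_perm F' (a k j) σ r
  refine (congrArg (_ ≫ ·) (hg k j σ).symm).trans ?_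
  refine ((reassoc_of% h) _).symm.trans (congrArg (_ ≫ ·) h')

end Coinv

variable [HasColimitsOfSize.{0, 0} E]

/-! ### The Schur functor -/

section Schur

variable (M : SymMod E)

lemma schurMap_compat {V W : E} (f : V ⟶ W) :
    Compat (M := M) (F := .const V) (fun k _ =>
      (𝟙 (M.obj (Fin k)) ⊗ₘ tensorListMap (fun _ => f) (List.finRange k)) ≫
        M.inc (.const W) ()) :=
  compat_map (F := .const V) (F' := .const W) (𝟙 M) (fun _ j => j) (fun _ _ _ => f)
    (fun _ _ _ _ => f) (fun _ _ _ => rfl)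
    (fun _ _ _ _ => (Category.comp_id f).trans (Category.id_comp f).symm)

/-- The action of the Schur functor on maps. -/
def schurMap {V W : E} (f : V ⟶ W) : M.coinv (.const V) ⟶ M.coinv (.const W) :=
  M.coinvDesc (.const V) _ (M.schurMap_compat f)

lemma inc_schurMap {V W : E} (f : V ⟶ W) (k : ℕ) :
    M.inc (.const V) (k := k) () ≫ M.schurMap f =
      (𝟙 (M.obj (Fin k)) ⊗ₘ tensorListMap (fun _ => f) (List.finRange k)) ≫
        M.inc (.const W) () :=
  M.inc_coinvDesc (.const V) _ (M.schurMap_compat f) ()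

/-- The Schur functor `V ↦ ⨁ₖ M(k) ⊗_{𝕊ₖ} V^{⊗ k}` of an `𝕊`-module. -/
def schur : E ⥤ E where
  obj V := M.coinv (.const V)
  map f := M.schurMap f
  map_id V := by
    apply coinv_hom_ext
    rintro k ⟨⟩
    refine (M.inc_schurMap _ k).trans ?_
    rw [tensorListMap_id, id_tensorHom_id]
    exact (Category.id_comp _).trans (Category.comp_id _).symm
  map_comp f g := by
    apply coinv_hom_ext
    rintro k ⟨⟩
    refine (M.inc_schurMap _ k).trans ?_
    refine Eq.trans ?_ ((reassoc_of% (M.inc_schurMap f k)) (M.schurMap g)).symm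
    refine Eq.trans ?_ (congrArg (_ ≫ ·) (M.inc_schurMap g k)).symm
    rw [tensorHom_comp_tensorHom_assoc, tensorListMap_comp, Category.comp_id]

lemma schurHom_compat {M M' : SymMod E} (φ : M ⟶ M') (V : E) :
    Compat (M := M) (F := .const V) (fun k _ =>
      (φ.app (Fin k) ⊗ₘ tensorListMap (fun _ => 𝟙 V) (List.finRange k)) ≫
        M'.inc (.const V) ()) :=
  compat_map (F := .const V) (F' := .const V) φ (fun _ j => j) (fun _ _ _ => 𝟙 V)
    (fun _ _ _ _ => 𝟙 V) (fun _ _ _ => rfl) (fun _ _ _ _ => rfl)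

/-- The Schur functor is functorial in the `𝕊`-module. -/
def schurHom {M M' : SymMod E} (φ : M ⟶ M') (V : E) : M.schur.obj V ⟶ M'.schur.obj V :=
  M.coinvDesc (.const V) _ (schurHom_compat φ V)

end Schur

/-! ### The composition product -/

section Comp

lemma compRelabel_compat (M N : SymMod E) {S T : Type} [Finite S] [Finite T] (e : S ≃ T) :
    Compat (M := M) (F := .fibres N S) (fun k f =>
      (𝟙 (M.obj (Fin k)) ⊗ₘ tensorListMap
        (fun i => N.map (fibreEquiv (f := f) (g := fun t => f (e.symm t)) e (a := i) (b := i)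
          (fun s => by simp))) (List.finRange k)) ≫ M.inc (.fibres N T) fun t => f (e.symm t)) :=
  compat_map (F := .fibres N S) (F' := .fibres N T) (𝟙 M) (fun _ f t => f (e.symm t))
    (fun k f i => N.map (fibreEquiv e (fun s => by simp)))
    (fun k f σ i => N.map (fibreEquiv e (fun s => by simp))) (fun _ _ _ => rfl)
    (fun k f σ i => by
      change N.map _ ≫ N.map _ = N.map _ ≫ N.map _
      rw [← N.map_trans, ← N.map_trans]
      rfl)

/-- Relabelling of the finite set in the composition product. -/
def compRelabel (M N : SymMod E) {S T : Type} [Finite S] [Finite T] (e : S ≃ T) :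
    M.coinv (.fibres N S) ⟶ M.coinv (.fibres N T) :=
  M.coinvDesc (.fibres N S) _ (M.compRelabel_compat N e)

lemma inc_compRelabel (M N : SymMod E) {S T : Type} [Finite S] [Finite T] (e : S ≃ T)
    {k : ℕ} (f : S → Fin k) :
    M.inc (.fibres N S) f ≫ M.compRelabel N e =
      (𝟙 (M.obj (Fin k)) ⊗ₘ tensorListMap
        (fun i => N.map (fibreEquiv (f := f) (g := fun t => f (e.symm t)) e (a := i) (b := i)
          (fun s => by simp))) (List.finRange k)) ≫ M.inc (.fibres N T) fun t => f (e.symm t) :=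
  M.inc_coinvDesc (.fibres N S) _ (M.compRelabel_compat N e) f

/-- The composition product `M ∘ N` of `𝕊`-modules:
`(M ∘ N)(S) = ⨁ₖ M(k) ⊗_{𝕊ₖ} ⨁_{f : S → Fin k} N(f⁻¹(0)) ⊗ ⋯ ⊗ N(f⁻¹(k - 1))`. -/
def comp (M N : SymMod E) : SymMod E where
  obj S _ := M.coinv (.fibres N S)
  map e := M.compRelabel N e
  map_refl S _ := by
    apply coinv_hom_ext
    intro k f
    refine (M.inc_compRelabel N _ f).trans ?_
    have : (fun i => N.map (fibreEquiv (f := f) (g := f) (Equiv.refl S) (a := i) (b := i)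
        (fun s => Iff.rfl))) = fun i => 𝟙 (N.obj {s // f s = i}) := funext fun i => N.map_refl _
    refine (congrArg (fun t => (𝟙 (M.obj (Fin k)) ⊗ₘ tensorListMap t (List.finRange k)) ≫
      M.inc (.fibres N S) f) this).trans ?_
    rw [tensorListMap_id, id_tensorHom_id]
    exact (Category.id_comp _).trans (Category.comp_id _).symm
  map_trans {S T U} _ _ _ e e' := by
    apply coinv_hom_ext
    intro k f
    refine (M.inc_compRelabel N _ f).trans ?_
    refine Eq.trans ?_ ((reassoc_of% (M.inc_compRelabel N e f)) (M.compRelabel N e')).symm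
    refine Eq.trans ?_ (congrArg (_ ≫ ·)
      (M.inc_compRelabel N e' (fun t => f (e.symm t)))).symm
    rw [tensorHom_comp_tensorHom_assoc, tensorListMap_comp, Category.comp_id]
    simp only [← N.map_trans]
    rfl

lemma compMap_compat {M N M' N' : SymMod E} (φ : M ⟶ M') (ψ : N ⟶ N') (S : Type) [Finite S] :
    Compat (M := M) (F := .fibres N S) (fun k f =>
      (φ.app (Fin k) ⊗ₘ tensorListMap (fun i => ψ.app {s // f s = i}) (List.finRange k)) ≫
        M'.inc (.fibres N' S) f) :=
  compat_map (F := .fibres N S) (F' := .fibres N' S) φ (fun _ f => f)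
    (fun _ f i => ψ.app {s // f s = i}) (fun _ f σ i => ψ.app {s // σ (f s) = i})
    (fun _ _ _ => rfl) (fun _ _ _ _ => (ψ.naturality _).symm)

/-- The composition product of two morphisms of `𝕊`-modules. -/
def compMap {M N M' N' : SymMod E} (φ : M ⟶ M') (ψ : N ⟶ N') : M.comp N ⟶ M'.comp N' where
  app S _ := M.coinvDesc (.fibres N S) _ (compMap_compat φ ψ S)
  naturality {S T} _ _ e := by
    apply coinv_hom_ext
    intro k f
    refine ((reassoc_of% (M.inc_compRelabel N e f)) _).trans ?_
    refine (congrArg (_ ≫ ·)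
      (M.inc_coinvDesc (.fibres N T) _ (compMap_compat φ ψ T) (fun t => f (e.symm t)))).trans ?_
    refine Eq.trans ?_ ((reassoc_of%
      (M.inc_coinvDesc (.fibres N S) _ (compMap_compat φ ψ S) f)) _).symm
    refine Eq.trans ?_ (congrArg (_ ≫ ·) (M'.inc_compRelabel N' e f)).symm
    rw [tensorHom_comp_tensorHom_assoc, tensorHom_comp_tensorHom_assoc, tensorListMap_comp,
      tensorListMap_comp, Category.id_comp, Category.comp_id]
    simp only [ψ.naturality]

end Comp


/-! ### The unit `𝕊`-module -/

/-- The unit `𝕊`-module `I`: the unit of `E` on one-element sets, the initial object on all other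
finite sets. -/
def unit (E : Type u) [Category.{v} E] [MonoidalCategory E] [HasColimitsOfSize.{0, 0} E] :
    SymMod E where
  obj S _ := ∐ fun _ : PLift (Nat.card S = 1) => 𝟙_ E
  map {S T} _ _ e := Sigma.desc fun h =>
    Sigma.ι (fun _ : PLift (Nat.card T = 1) => 𝟙_ E) ⟨(Nat.card_congr e).symm.trans h.down⟩
  map_refl S _ := by
    apply Sigma.hom_ext
    intro h
    rw [Sigma.ι_desc, Category.comp_id]
  map_trans {S T U} _ _ _ e e' := by
    apply Sigma.hom_ext
    intro h
    rw [Sigma.ι_desc, Sigma.ι_desc_assoc, Sigma.ι_desc]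

/-- The identification of the unit of `E` with `I(S)`, for a one-element set `S`. -/
def unitInc (S : Type) [Finite S] (h : Nat.card S = 1) : 𝟙_ E ⟶ (unit E).obj S :=
  Sigma.ι (fun _ : PLift (Nat.card S = 1) => 𝟙_ E) ⟨h⟩

/-- The canonical isomorphism `N(S) ⟶ (I ∘ N)(S)`. -/
def leftUnit (N : SymMod E) (S : Type) [Finite S] : N.obj S ⟶ ((unit E).comp N).obj S :=
  N.map (Equiv.subtypeUnivEquiv (p := fun _ => (0 : Fin 1) = 0) (fun _ => rfl)).symm ≫
    (ρ_ _).inv ≫ (λ_ _).inv ≫ (unitInc (Fin 1) (Nat.card_fin 1) ▷ _) ≫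
      (unit E).inc (.fibres N S) (k := 1) (fun _ => 0)

/-- The canonical isomorphism `M(S) ⟶ (M ∘ I)(S)`, written by means of an enumeration of `S`. -/
def rightUnit (M : SymMod E) (S : Type) [Finite S] {n : ℕ} (e : S ≃ Fin n) :
    M.obj S ⟶ (M.comp (unit E)).obj S :=
  M.map e ≫ (ρ_ _).inv ≫
    (M.obj (Fin n) ◁ tensorListUnit (X := (SymFamily.fibres (unit E) S).X e)
      (fun i => unitInc {s // e s = i} (by
        rw [Nat.card_eq_one_iff_unique]
        exact ⟨⟨fun a b => Subtype.ext (e.injective (a.2.trans b.2.symm))⟩,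
          ⟨⟨e.symm i, e.apply_symm_apply i⟩⟩⟩)) (List.finRange n)) ≫
      M.inc (.fibres (unit E) S) e

/-- The canonical isomorphism `V ⟶ I(V)` to the Schur functor of the unit `𝕊`-module. -/
def schurUnit (V : E) : V ⟶ (unit E).schur.obj V :=
  (ρ_ _).inv ≫ (λ_ _).inv ≫ (unitInc (Fin 1) (Nat.card_fin 1) ▷ _) ≫
    (unit E).inc (.const V) (k := 1) ()

/-! ### The two bracketings of a triple composite -/

/-- The shape of a summand of a twofold composite: `k` blocks of sizes `m 0, …, m (k - 1)`, together
with an enumeration `e` by `Fin l` of all the entries of the blocks, and a rearrangement of the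
lexicographic ordering of the entries into the ordering given by this enumeration. -/
structure Blocks where
  k : ℕ
  m : Fin k → ℕ
  l : ℕ
  e : (Σ i, Fin (m i)) ≃ Fin l
  r : Reordering
    (((List.finRange k).flatMap fun i => (List.finRange (m i)).map (Sigma.mk i)).map e)
    (List.finRange l)

/-- The block to which an entry belongs. -/
def Blocks.block (b : Blocks) (c : Fin b.l) : Fin b.k := (b.e.symm c).1

/-- The entries of the `i`-th block. -/
def Blocks.blockEquiv (b : Blocks) (i : Fin b.k) : Fin (b.m i) ≃ {c // b.block c = i} where
  toFun j := ⟨b.e ⟨i, j⟩, by simp [Blocks.block]⟩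
  invFun c := Fin.cast (congrArg b.m c.2) (b.e.symm c.1).2
  left_inv j := by
    have h : b.e.symm (b.e ⟨i, j⟩) = ⟨i, j⟩ := b.e.symm_apply_apply _
    apply Fin.ext
    change ((b.e.symm (b.e ⟨i, j⟩)).2 : ℕ) = j
    rw [h]
  right_inv := by
    rintro ⟨c, rfl⟩
    apply Subtype.ext
    exact b.e.apply_symm_apply c

/-- The map that gathers the factors `M(k)` and `N(m i)` into a summand of `(M ∘ N)(l)`:
`M(k) ⊗ ⨂ᵢ (N(m i) ⊗ ⨂ⱼ Y i j) ⟶ (M ∘ N)(l) ⊗ ⨂_c W c`, where `Y i j` corresponds to `W c` if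
`c` is the number of the entry `j` of the block `i`. -/
def regroup (M N : SymMod E) (b : Blocks) (Y : (Σ i, Fin (b.m i)) → E) (W : Fin b.l → E)
    (w : ∀ x, Y x ⟶ W (b.e x)) :
    M.obj (Fin b.k) ⊗ tensorList (fun i => N.obj (Fin (b.m i)) ⊗
      tensorList (fun j => Y ⟨i, j⟩) (List.finRange (b.m i))) (List.finRange b.k) ⟶
    (M.comp N).obj (Fin b.l) ⊗ tensorList W (List.finRange b.l) :=
  (M.obj (Fin b.k) ◁ tensorUnzip _ _ _) ≫ (α_ _ _ _).inv ≫
    (((M.obj (Fin b.k) ◁ tensorListMap (Y := (SymFamily.fibres N (Fin b.l)).X b.block)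
        (fun i => N.map (b.blockEquiv i)) _) ≫
      M.inc (.fibres N (Fin b.l)) b.block) ⊗ₘ
    (tensorFlatten Y _ _ ≫ tensorReindex b.e w _ ≫ b.r.hom W))

/-- The index of a summand of a triple composition product, evaluated at `S`. -/
structure CompIdx (S : Type) extends Blocks where
  f : S → Fin k
  g : ∀ i, {s // f s = i} → Fin (m i)

/-- The map `S → Fin l` sending an element to the number of the entry to which it belongs. -/
def CompIdx.total {S : Type} (x : CompIdx S) (s : S) : Fin x.l := x.e ⟨x.f s, x.g (x.f s) ⟨s, rfl⟩⟩

lemma CompIdx.total_eq_iff {S : Type} (x : CompIdx S) (y : Σ i, Fin (x.m i)) (s : S) :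
    x.total s = x.e y ↔ ∃ h : x.f s = y.1, x.g y.1 ⟨s, h⟩ = y.2 := by
  obtain ⟨i, j⟩ := y
  rw [CompIdx.total, x.e.apply_eq_iff_eq]
  constructor
  · intro h
    obtain ⟨h1, h2⟩ := Sigma.mk.inj_iff.1 h
    subst h1
    exact ⟨rfl, eq_of_heq h2⟩
  · rintro ⟨h, h'⟩
    dsimp only at h h'
    subst h
    rw [h']

section Triple

variable (M N P : SymMod E) {S : Type} [Finite S]

/-- The summand `M(k) ⊗ ⨂ᵢ (N(m i) ⊗ ⨂ⱼ P((g i)⁻¹(j)))`. -/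
abbrev compSummand (x : CompIdx S) : E :=
  M.obj (Fin x.k) ⊗ tensorList (fun i => N.summand (.fibres P {s // x.f s = i}) (x.g i))
    (List.finRange x.k)

/-- The inclusion of a summand into `(M ∘ (N ∘ P))(S)`. -/
def compIncRight (x : CompIdx S) :
    compSummand M N P x ⟶ (M.comp (N.comp P)).obj S :=
  (M.obj (Fin x.k) ◁ tensorListMap (Y := (SymFamily.fibres (N.comp P) S).X x.f)
    (fun i => N.inc (.fibres P {s // x.f s = i}) (x.g i)) _) ≫
    M.inc (.fibres (N.comp P) S) x.f

/-- The elements of `S` belonging to a given entry. -/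
def CompIdx.entryEquiv (x : CompIdx S) (y : Σ i, Fin (x.m i)) :
    {t : {s // x.f s = y.1} // x.g y.1 t = y.2} ≃ {s // x.total s = x.e y} where
  toFun t := ⟨t.1.1, (x.total_eq_iff y _).2 ⟨t.1.2, t.2⟩⟩
  invFun s := ⟨⟨s.1, ((x.total_eq_iff y _).1 s.2).1⟩, ((x.total_eq_iff y _).1 s.2).2⟩
  left_inv _ := rfl
  right_inv _ := rfl

/-- The inclusion of a summand into `((M ∘ N) ∘ P)(S)`. -/
def compIncLeft (x : CompIdx S) :
    compSummand M N P x ⟶ ((M.comp N).comp P).obj S :=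
  regroup M N x.toBlocks
    (fun y => P.obj {t : {s // x.f s = y.1} // x.g y.1 t = y.2})
    (fun c => P.obj {s // x.total s = c}) (fun y => P.map (x.entryEquiv y)) ≫
    (M.comp N).inc (.fibres P S) x.total

variable (S) in
/-- The triple composition product: `(M ∘ (N ∘ P))(S)` and `((M ∘ N) ∘ P)(S)`, glued along their
common summands. If the tensor product preserves colimits, then both canonical maps to it are
isomorphisms, and together they form the associativity isomorphism of the composition product. -/
def tripleComp : E :=
  pushout (Sigma.desc fun x : CompIdx S => compIncRight M N P x)
    (Sigma.desc fun x : CompIdx S => compIncLeft M N P x)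

variable (S) in
/-- The canonical map `(M ∘ (N ∘ P))(S) ⟶ (M ∘ N ∘ P)(S)`. -/
def tripleRight : (M.comp (N.comp P)).obj S ⟶ tripleComp M N P S := pushout.inl _ _

variable (S) in
/-- The canonical map `((M ∘ N) ∘ P)(S) ⟶ (M ∘ N ∘ P)(S)`. -/
def tripleLeft : ((M.comp N).comp P).obj S ⟶ tripleComp M N P S := pushout.inr _ _

variable (V : E)

/-- The summand `M(k) ⊗ ⨂ᵢ (N(m i) ⊗ V^{⊗ (m i)})`. -/
abbrev schurSummand (b : Blocks) : E :=
  M.obj (Fin b.k) ⊗ tensorList (fun i => N.summand (.const V) (k := b.m i) ())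
    (List.finRange b.k)

/-- The inclusion of a summand into `M(N(V))`. -/
def schurIncRight (b : Blocks) :
    schurSummand M N V b ⟶ M.schur.obj (N.schur.obj V) :=
  (M.obj (Fin b.k) ◁ tensorListMap (Y := (SymFamily.const (N.schur.obj V)).X (k := b.k) ())
    (fun i => N.inc (.const V) (k := b.m i) ()) _) ≫ M.inc (.const (N.schur.obj V)) ()

/-- The inclusion of a summand into `(M ∘ N)(V)`. -/
def schurIncLeft (b : Blocks) : schurSummand M N V b ⟶ (M.comp N).schur.obj V :=
  regroup M N b (fun _ => V) (fun _ => V) (fun _ => 𝟙 V) ≫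
    (M.comp N).inc (.const V) (k := b.l) ()

/-- `M(N(V))` and `(M ∘ N)(V)`, glued along their common summands. If the tensor product preserves
colimits, then both canonical maps to it are isomorphisms, and together they form the canonical
isomorphism `M(N(V)) ≅ (M ∘ N)(V)`. -/
def doubleSchur : E :=
  pushout (Sigma.desc fun b : Blocks => schurIncRight M N V b)
    (Sigma.desc fun b : Blocks => schurIncLeft M N V b)

/-- The canonical map from `M(N(V))`. -/
def doubleRight : M.schur.obj (N.schur.obj V) ⟶ doubleSchur M N V := pushout.inl _ _

/-- The canonical map from `(M ∘ N)(V)`. -/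
def doubleLeft : (M.comp N).schur.obj V ⟶ doubleSchur M N V := pushout.inr _ _

end Triple

end SymMod

open SymMod

variable (E : Type u) [Category.{v} E] [MonoidalCategory E] [SymmetricCategory E]
  [HasColimitsOfSize.{0, 0} E]

/-- A symmetric operad in `E`: a monoid for the composition product of `𝕊`-modules. -/
structure Operad where
  toSymMod : SymMod E
  /-- the composition `P ∘ P ⟶ P` -/
  mul : toSymMod.comp toSymMod ⟶ toSymMod
  /-- the unit `I ⟶ P` -/
  one : SymMod.unit E ⟶ toSymMod
  one_mul (S : Type) [Finite S] :
    leftUnit toSymMod S ≫ (compMap one (𝟙 toSymMod)).app S ≫ mul.app S = 𝟙 _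
  mul_one (S : Type) [Finite S] {n : ℕ} (e : S ≃ Fin n) :
    rightUnit toSymMod S e ≫ (compMap (𝟙 toSymMod) one).app S ≫ mul.app S = 𝟙 _
  mul_assoc (S : Type) [Finite S] (x : CompIdx S) :
    compIncRight toSymMod toSymMod toSymMod x ≫ (compMap (𝟙 toSymMod) mul).app S ≫ mul.app S =
      compIncLeft toSymMod toSymMod toSymMod x ≫ (compMap mul (𝟙 toSymMod)).app S ≫ mul.app S

/-- A symmetric cooperad in `E`: a comonoid for the composition product of `𝕊`-modules. -/
structure Cooperad where
  toSymMod : SymMod E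
  /-- the decomposition `C ⟶ C ∘ C` -/
  comul : toSymMod ⟶ toSymMod.comp toSymMod
  /-- the counit `C ⟶ I` -/
  counit : toSymMod ⟶ SymMod.unit E
  counit_comul (S : Type) [Finite S] :
    comul.app S ≫ (compMap counit (𝟙 toSymMod)).app S = leftUnit toSymMod S
  comul_counit (S : Type) [Finite S] {n : ℕ} (e : S ≃ Fin n) :
    comul.app S ≫ (compMap (𝟙 toSymMod) counit).app S = rightUnit toSymMod S e
  comul_assoc (S : Type) [Finite S] :
    comul.app S ≫ (compMap (𝟙 toSymMod) comul).app S ≫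
        tripleRight toSymMod toSymMod toSymMod S =
      comul.app S ≫ (compMap comul (𝟙 toSymMod)).app S ≫
        tripleLeft toSymMod toSymMod toSymMod S

variable {E}

namespace Operad

variable (P : Operad E)

/-- An algebra over an operad: an object `A` with a unital and associative action
`P(A) = ⨁ₙ P(n) ⊗_{𝕊ₙ} A^{⊗ n} ⟶ A`. -/
structure Alg where
  carrier : E
  act : P.toSymMod.schur.obj carrier ⟶ carrier
  one_act : schurUnit carrier ≫ schurHom P.one carrier ≫ act = 𝟙 carrier
  act_act (b : Blocks) :
    schurIncRight P.toSymMod P.toSymMod carrier b ≫ P.toSymMod.schur.map act ≫ act =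
      schurIncLeft P.toSymMod P.toSymMod carrier b ≫ schurHom P.mul carrier ≫ act

namespace Alg

variable {P}

/-- A morphism of algebras over an operad. -/
@[ext]
structure Hom (A B : P.Alg) where
  hom : A.carrier ⟶ B.carrier
  act_hom : A.act ≫ hom = P.toSymMod.schur.map hom ≫ B.act

instance : Category P.Alg where
  Hom A B := Hom A B
  id A := { hom := 𝟙 _, act_hom := by simp }
  comp f g :=
    { hom := f.hom ≫ g.hom
      act_hom := by
        rw [← Category.assoc, f.act_hom, Category.assoc, g.act_hom, Functor.map_comp,
          Category.assoc] }
  id_comp f := Hom.ext (Category.id_comp _)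
  comp_id f := Hom.ext (Category.comp_id _)
  assoc f g h := Hom.ext (Category.assoc _ _ _)

end Alg

/-- The forgetful functor from algebras over an operad. -/
def forget : P.Alg ⥤ E where
  obj A := A.carrier
  map f := f.hom

end Operad

namespace Cooperad

variable (C : Cooperad E)

/-- A conilpotent coalgebra over a cooperad: an object `A` with a counital and coassociative coaction
`A ⟶ C(A) = ⨁ₙ C(n) ⊗_{𝕊ₙ} A^{⊗ n}`. Conilpotence is expressed by the direct sum. -/
structure Coalg where
  carrier : E
  coact : carrier ⟶ C.toSymMod.schur.obj carrier
  coact_counit : coact ≫ schurHom C.counit carrier = schurUnit carrier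
  coact_coact :
    coact ≫ C.toSymMod.schur.map coact ≫ doubleRight C.toSymMod C.toSymMod carrier =
      coact ≫ schurHom C.comul carrier ≫ doubleLeft C.toSymMod C.toSymMod carrier

namespace Coalg

variable {C}

/-- A morphism of coalgebras over a cooperad. -/
@[ext]
structure Hom (A B : C.Coalg) where
  hom : A.carrier ⟶ B.carrier
  coact_hom : A.coact ≫ C.toSymMod.schur.map hom = hom ≫ B.coact

instance : Category C.Coalg where
  Hom A B := Hom A B
  id A := { hom := 𝟙 _, coact_hom := by simp }
  comp f g :=
    { hom := f.hom ≫ g.hom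
      coact_hom := by
        rw [Functor.map_comp, ← Category.assoc, f.coact_hom, Category.assoc, g.coact_hom,
          Category.assoc] }
  id_comp f := Hom.ext (Category.id_comp _)
  comp_id f := Hom.ext (Category.comp_id _)
  assoc f g h := Hom.ext (Category.assoc _ _ _)

end Coalg

/-- The forgetful functor from conilpotent coalgebras over a cooperad. -/
def forget : C.Coalg ⥤ E where
  obj A := A.carrier
  map f := f.hom

end Cooperad

end Quot
end OperadTheory

/-!
The Schur functor of an operad is a monad, the Schur functor of a cooperad is a comonad, and all the
assertions follow from properties of Schur functors alone.

*Coherence.* The composition product and the Schur functors are built from iterated tensor products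
along lists of indices, with symmetries given by explicit rearrangements (`Reordering`). The point
that makes them manageable is `Reordering.hom_eq`: if a list has no repetitions, then the symmetry
isomorphism attached to a rearrangement depends only on the two lists. A map from an object to an
iterated tensor product is recorded as a `Pres`, and a map between two such objects is `Canonical`
if it is compatible with a rearrangement of the factors. Structure maps of symmetric monoidal
categories are canonical, composites and tensor products of canonical maps are canonical, and two
canonical maps with the same source and target are equal if the target is isomorphic to its iterated
tensor product and the factors are distinct (`Canonical.eq`). The equalities between long composites
of symmetries are proved this way. It also allows one to replace the standard finite sets by
arbitrary finite sets with an enumeration.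

*The comparison map.* Both `(M ∘ N)(V)` and `M(N(V))` are covered by the objects
`M(k) ⊗ (N(m₁) ⊗ V^{⊗ m₁}) ⊗ ⋯ ⊗ (N(mₖ) ⊗ V^{⊗ mₖ})`, up to canonical isomorphism. This gives a
map `psi : (M ∘ N)(V) ⟶ M(N(V))`, natural in `M`, `N` and `V` (`SymMod.psi_naturality`) and
compatible with units (`SymMod.leftUnit_psi`, `SymMod.rightUnit_psi`) and with the two bracketings
of a triple composite (`SymMod.exists_tripleComp_desc`). It is an isomorphism. For the inverse, one
has to define maps out of `M(k) ⊗ N(V) ⊗ ⋯ ⊗ N(V)`, where each factor `N(V)` is a quotient of a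
coproduct; since the tensor product preserves colimits in each variable, a tensor product of objects
presented by generators and relations is presented by the tensor products of the generators
(`Presents.tensorList`).

*(Co)monadicity.* Through `psi`, an operad `P` yields a monad whose underlying functor is the Schur
functor, and a cooperad `C` yields a comonad. The algebras over `P` and the conilpotent coalgebras
over `C` are the algebras over the monad and the coalgebras over the comonad; for coalgebras one
uses that the object in which the two sides of the coassociativity axiom are compared is the
pushout of `M(N(V))` and `(M ∘ N)(V)` along their common summands, and that `psi` retracts it onto
`M(N(V))`.

*Accessibility.* Tensor powers preserve sifted colimits, because sifted colimits commute with the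
diagonal; hence so do Schur functors (`SymMod.preservesColimitsOfShape_schur`). In particular they
preserve filtered colimits and reflexive coequalizers.

*Local presentability.* Let `T` be an accessible monad on a locally presentable category that
preserves reflexive coequalizers. The category of its algebras has reflexive coequalizers, hence all
colimits by the adjoint triangle theorem applied to constant diagrams, and the free algebras on a
strong generator are a strong generator (`isCardinalLocallyPresentable_algebra`). For an accessible
comonad `G`, colimits of coalgebras are created by the forgetful functor, and the coalgebras with
`κ`-presentable underlying object, for uncountable `κ`, form a strong generator
(`isCardinalLocallyPresentable_coalgebra`). The point is that a map `α` from a `κ`-presentable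
object to a coalgebra `A` factors through such a coalgebra (`exists_factorization`): write `A` as a
`κ`-filtered colimit of `κ`-presentable objects `D j`, choose successively `j 0 ⟶ j 1 ⟶ ⋯` such that
the structure map of `A` lifts to maps `D (j n) ⟶ G (D (j (n + 1)))` satisfying the axioms of a
coalgebra up to transition maps, and take the colimit of the sequence.

Finally, the category of complexes of vector spaces is locally `κ`-presentable for all `κ`, with
generators that corepresent the functors `X ↦ X i`, and its tensor product preserves colimits in
each variable, because it is a coproduct of tensor products of vector spaces in each degree.
-/

universe w

namespace OperadTheory

open CategoryTheory Limits MonoidalCategory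

/-! ### Coherence of rearrangements -/

section SwapFront

variable {E : Type u} [Category.{v} E] [MonoidalCategory E] [SymmetricCategory E]

/-- The exchange of the first two factors of a tensor product. -/
def swapFront (A B D : E) : A ⊗ (B ⊗ D) ⟶ B ⊗ (A ⊗ D) :=
  (α_ A B D).inv ≫ ((β_ A B).hom ▷ D) ≫ (α_ B A D).hom

lemma swapFront_swapFront (A B D : E) : swapFront A B D ≫ swapFront B A D = 𝟙 _ := by
  simp only [swapFront, Category.assoc, Iso.hom_inv_id_assoc]
  rw [← comp_whiskerRight_assoc, SymmetricCategory.symmetry, id_whiskerRight, Category.id_comp,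
    Iso.inv_hom_id]

lemma swapFront_naturality (A B : E) {D D' : E} (f : D ⟶ D') :
    A ◁ B ◁ f ≫ swapFront A B D' = swapFront A B D ≫ B ◁ A ◁ f := by
  simp only [swapFront, Category.assoc]
  rw [associator_inv_naturality_right_assoc, whisker_exchange_assoc, associator_naturality_right]

lemma swapFront_naturality_assoc (A B : E) {D D' Z : E} (f : D ⟶ D') (g : B ⊗ A ⊗ D' ⟶ Z) :
    A ◁ B ◁ f ≫ swapFront A B D' ≫ g = swapFront A B D ≫ B ◁ A ◁ f ≫ g := by
  rw [← Category.assoc, swapFront_naturality, Category.assoc]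

/-- The braid relation for exchanges of adjacent factors. -/
lemma swapFront_braid (A B C D : E) :
    A ◁ swapFront B C D ≫ swapFront A C (B ⊗ D) ≫ C ◁ swapFront A B D =
      swapFront A B (C ⊗ D) ≫ B ◁ swapFront A C D ≫ swapFront B C (A ⊗ D) := by
  have h := congrArg (fun t => 𝟙 (A ⊗ B ⊗ C ⊗ D) ⊗≫ (t ▷ D) ⊗≫ 𝟙 (C ⊗ B ⊗ A ⊗ D))
    (BraidedCategory.yang_baxter' A B C)
  refine Eq.trans ?_ (h.symm.trans ?_)
  all_goals
    simp only [swapFront]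
    monoidal

end SwapFront

namespace Reordering

variable {ι : Type}

/-- The trivial rearrangement. -/
def refl : ∀ l : List ι, Reordering l l
  | [] => nil
  | a :: l => cons a (refl l)

/-- The inverse of a rearrangement. -/
def symm : ∀ {l l' : List ι}, Reordering l l' → Reordering l' l
  | _, _, nil => nil
  | _, _, cons a r => cons a r.symm
  | _, _, swap a b l => swap b a l
  | _, _, trans r r' => trans r'.symm r.symm

/-- A rearrangement of the beginning of a list. -/
def appendRight (m : List ι) : ∀ {l l' : List ι}, Reordering l l' → Reordering (l ++ m) (l' ++ m)
  | _, _, nil => refl m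
  | _, _, cons a r => cons a (appendRight m r)
  | _, _, swap a b l => swap a b (l ++ m)
  | _, _, trans r r' => trans (appendRight m r) (appendRight m r')

/-- A rearrangement of the end of a list. -/
def appendLeft {l l' : List ι} (r : Reordering l l') :
    ∀ m : List ι, Reordering (m ++ l) (m ++ l')
  | [] => r
  | a :: m => cons a (appendLeft r m)

lemma perm {l l' : List ι} (r : Reordering l l') : l.Perm l' := by
  induction r with
  | nil => exact .nil
  | cons a r ih => exact ih.cons a
  | swap a b l => exact List.Perm.swap b a l
  | trans r r' ih ih' => exact ih.trans ih'

lemma nonempty_of_perm {l l' : List ι} (h : l.Perm l') : Nonempty (Reordering l l') := by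
  induction h with
  | nil => exact ⟨nil⟩
  | cons a h ih => exact ⟨cons a ih.some⟩
  | swap a b l => exact ⟨swap b a l⟩
  | trans h h' ih ih' => exact ⟨trans ih.some ih'.some⟩

/-- A rearrangement chosen for two lists that are permutations of each other. -/
noncomputable def ofPerm {l l' : List ι} (h : l.Perm l') : Reordering l l' :=
  (nonempty_of_perm h).some

variable {E : Type u} [Category.{v} E] [MonoidalCategory E] [SymmetricCategory E] (X : ι → E)

@[simp]
lemma refl_hom (l : List ι) : (refl l).hom X = 𝟙 _ := by
  induction l with
  | nil => rfl
  | cons a l ih => simp only [refl, hom, ih]; exact whiskerLeft_id _ _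

lemma hom_symm {l l' : List ι} (r : Reordering l l') : r.hom X ≫ r.symm.hom X = 𝟙 _ := by
  induction r with
  | nil => exact Category.id_comp _
  | cons a r ih =>
    exact (MonoidalCategory.whiskerLeft_comp _ _ _).symm.trans
      ((congrArg (X a ◁ ·) ih).trans (whiskerLeft_id _ _))
  | swap a b l => exact swapFront_swapFront _ _ _
  | trans r r' ih ih' =>
    simp only [symm, hom, Category.assoc]
    rw [← Category.assoc (r'.hom X), ih', Category.id_comp, ih]

lemma symm_symm {l l' : List ι} (r : Reordering l l') : r.symm.symm = r := by
  induction r with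
  | nil => rfl
  | cons a r ih => simp only [symm, ih]
  | swap a b l => rfl
  | trans r r' ih ih' => simp only [symm, ih, ih']

lemma symm_hom {l l' : List ι} (r : Reordering l l') : r.symm.hom X ≫ r.hom X = 𝟙 _ := by
  have := hom_symm X r.symm
  rwa [symm_symm] at this

/-- The rearrangement of tensor factors, as an isomorphism. -/
@[simps]
def iso {l l' : List ι} (r : Reordering l l') : tensorList X l ≅ tensorList X l' where
  hom := r.hom X
  inv := r.symm.hom X
  hom_inv_id := hom_symm X r
  inv_hom_id := symm_hom X r

instance {l l' : List ι} (r : Reordering l l') : IsIso (r.hom X) := (r.iso X).isIso_hom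

end Reordering

/-- An element of `Extract a l l₀` is an occurrence of `a` in `l` whose removal leaves `l₀`. -/
inductive Extract {ι : Type} (a : ι) : List ι → List ι → Type
  | head (l : List ι) : Extract a (a :: l) l
  | tail (b : ι) {l l₀ : List ι} (x : Extract a l l₀) : Extract a (b :: l) (b :: l₀)

namespace Extract

variable {ι : Type} {a : ι}

lemma mem {l l₀ : List ι} (x : Extract a l l₀) : a ∈ l := by
  induction x with
  | head l => exact List.mem_cons_self
  | tail b x ih => exact List.mem_cons_of_mem _ ih

lemma perm {l l₀ : List ι} (x : Extract a l l₀) : l.Perm (a :: l₀) := by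
  induction x with
  | head l => exact .refl _
  | tail b x ih => exact (ih.cons b).trans (List.Perm.swap a b _)

lemma unique {l l₀ l₁ : List ι} (h : l.Nodup) (x : Extract a l l₀) (y : Extract a l l₁) :
    (⟨l₀, x⟩ : Σ m, Extract a l m) = ⟨l₁, y⟩ := by
  induction x generalizing l₁ with
  | head l =>
    cases y with
    | head => rfl
    | tail _ y => exact absurd y.mem (List.nodup_cons.1 h).1
  | tail b x ih =>
    cases y with
    | head => exact absurd x.mem (List.nodup_cons.1 h).1
    | tail _ y =>
      have := ih (List.nodup_cons.1 h).2 y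
      obtain ⟨h1, h2⟩ := Sigma.mk.inj_iff.1 this
      subst h1
      rw [eq_of_heq h2]

variable {E : Type u} [Category.{v} E] [MonoidalCategory E] [SymmetricCategory E] (X : ι → E)

/-- The isomorphism that moves an extracted factor to the front. -/
def hom : ∀ {l l₀ : List ι}, Extract a l l₀ → (tensorList X l ⟶ X a ⊗ tensorList X l₀)
  | _, _, head _ => 𝟙 _
  | _, _, tail b (l₀ := l₀) x => (X b ◁ x.hom) ≫ swapFront (X b) (X a) (tensorList X l₀)

/-- A rearrangement restricts to a rearrangement of the other entries, for every entry of a list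
without repetitions. -/
lemma exists_reordering {l l' : List ι} (r : Reordering l l') {l₀' : List ι} (h : l.Nodup)
    (x' : Extract a l' l₀') : ∃ (l₀ : List ι) (x : Extract a l l₀) (r₀ : Reordering l₀ l₀'),
      r.hom X ≫ x'.hom X = x.hom X ≫ (X a ◁ r₀.hom X) := by
  induction r generalizing l₀' with
  | nil => nomatch x'
  | @cons b l l' r ih =>
    cases x' with
    | head => exact ⟨_, head _, r, (Category.comp_id _).trans (Category.id_comp _).symm⟩
    | @tail _ _ l₀' x' =>
      obtain ⟨l₀, x, r₀, e⟩ := ih (List.nodup_cons.1 h).2 x'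
      refine ⟨_, x.tail b, r₀.cons b, ?_⟩
      simp only [hom, Reordering.hom, tensorList, Category.assoc]
      rw [← MonoidalCategory.whiskerLeft_comp_assoc, e, MonoidalCategory.whiskerLeft_comp_assoc,
        swapFront_naturality]
  | swap b c l =>
    cases x' with
    | head =>
      refine ⟨_, .tail b (.head l), Reordering.refl _, ?_⟩
      simp only [hom, Reordering.hom, Reordering.refl_hom, swapFront, tensorList]
      simp
    | tail _ x' =>
      cases x' with
      | head =>
        refine ⟨_, .head _, Reordering.refl _, ?_⟩
        have := swapFront_swapFront (X a) (X c) (tensorList X l)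
        simp only [hom, Reordering.hom, Reordering.refl_hom, tensorList,
          MonoidalCategory.whiskerLeft_id, Category.comp_id, Category.id_comp]
        exact this
      | tail _ x' =>
        refine ⟨_, (x'.tail c).tail b, .swap b c _, ?_⟩
        simp only [hom, tensorList, MonoidalCategory.whiskerLeft_comp, Category.assoc]
        refine Eq.trans ?_ (congrArg (X b ◁ X c ◁ hom X x' ≫ ·)
          (swapFront_braid (X b) (X c) (X a) _)).symm
        exact (swapFront_naturality_assoc (X b) (X c) (x'.hom X) _).symm
  | @trans l l' l'' r r' ih ih' =>
    obtain ⟨l₁, x₁, r₁, e₁⟩ := ih' (r.perm.nodup_iff.1 h) x'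
    obtain ⟨l₀, x₀, r₀, e₀⟩ := ih h x₁
    refine ⟨l₀, x₀, r₀.trans r₁, ?_⟩
    simp only [Reordering.hom, Category.assoc]
    rw [e₁, reassoc_of% e₀, MonoidalCategory.whiskerLeft_comp]

end Extract

lemma Reordering.hom_eq_id_of_nil {ι : Type} {E : Type u} [Category.{v} E] [MonoidalCategory E]
    [SymmetricCategory E] (X : ι → E) {l l' : List ι} (r : Reordering l l') (h : l = [])
    (h' : l' = []) : r.hom X = eqToHom (by rw [h, h']) := by
  induction r with
  | nil => rfl
  | cons | swap => cases h
  | trans r r' ih ih' =>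
    have hl := r'.perm
    rw [h', List.perm_nil] at hl
    rw [Reordering.hom, ih h hl, ih' hl h', eqToHom_trans]

/-- Coherence: if a list has no repetitions, then the symmetry isomorphism attached to a
rearrangement depends only on the two lists. -/
theorem Reordering.hom_eq {ι : Type} {E : Type u} [Category.{v} E] [MonoidalCategory E]
    [SymmetricCategory E] (X : ι → E) {l l' : List ι} (h : l.Nodup) (r r' : Reordering l l') :
    r.hom X = r'.hom X := by
  induction l' generalizing l with
  | nil =>
    have hl := r.perm.eq_nil
    rw [r.hom_eq_id_of_nil X hl rfl, r'.hom_eq_id_of_nil X hl rfl]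
  | cons a l' ih =>
    obtain ⟨l₀, x, r₀, e⟩ := Extract.exists_reordering X r h (.head l')
    obtain ⟨l₁, y, r₁, e'⟩ := Extract.exists_reordering X r' h (.head l')
    obtain ⟨h1, h2⟩ := Sigma.mk.inj_iff.1 (Extract.unique h x y)
    subst h1
    obtain rfl := eq_of_heq h2
    rw [ih (List.nodup_cons.1 (x.perm.nodup_iff.1 h)).2 r₀ r₁, ← e'] at e
    exact (Category.comp_id _).symm.trans (e.trans (Category.comp_id _))

/-! ### Canonical isomorphisms between iterated tensor products -/

section Append

variable {ι : Type} {E : Type u} [Category.{v} E] [MonoidalCategory E] (X : ι → E)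

instance (l' l : List ι) : IsIso (tensorAppend X l' l) := by
  induction l with
  | nil => exact (λ_ (tensorList X l')).isIso_hom
  | cons a l ih =>
    have : IsIso (X a ◁ tensorAppend X l' l) := inferInstance
    exact IsIso.comp_isIso' (α_ (X a) (tensorList X l) (tensorList X l')).isIso_hom this

end Append

namespace Reordering

variable {ι : Type}

/-- The identification of `(l ++ l') ++ l''` with `l ++ (l' ++ l'')`. -/
def assoc (l' l'' : List ι) : ∀ l : List ι, Reordering ((l ++ l') ++ l'') (l ++ (l' ++ l''))
  | [] => refl _
  | a :: l => cons a (assoc l' l'' l)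

/-- The identification of `l ++ []` with `l`. -/
def appendNil : ∀ l : List ι, Reordering (l ++ []) l
  | [] => nil
  | a :: l => cons a (appendNil l)

/-- The rearrangement that moves the first entry of a list behind the next ones. -/
def move (a : ι) (l : List ι) : ∀ l' : List ι, Reordering (a :: (l' ++ l)) (l' ++ a :: l)
  | [] => refl _
  | b :: l' => trans (swap a b (l' ++ l)) (cons b (move a l l'))

/-- The exchange of the two parts of a list. -/
def comm (l' : List ι) : ∀ l : List ι, Reordering (l ++ l') (l' ++ l)
  | [] => (appendNil l').symm
  | a :: l => trans (cons a (comm l' l)) (move a l l')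

variable {E : Type u} [Category.{v} E] [MonoidalCategory E] [SymmetricCategory E] (X : ι → E)

/- In the inductive proofs below, `tensorList X (a :: l)` is `X a ⊗ tensorList X l` by definition;
the inductive step is stated for arbitrary objects in place of the iterated tensor products. -/

lemma appendRight_hom (m : List ι) {l l' : List ι} (r : Reordering l l') :
    (r.hom X ▷ tensorList X m) ≫ tensorAppend X m l' =
      tensorAppend X m l ≫ (appendRight m r).hom X := by
  induction r with
  | nil =>
    refine (congrArg (· ≫ _) (id_whiskerRight _ _)).trans ((Category.id_comp _).trans ?_)
    exact ((congrArg (_ ≫ ·) (refl_hom X m)).trans (Category.comp_id _)).symm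
  | cons a r ih =>
    have step : ∀ {A L L' M N N' : E} (f : L ⟶ L') (g : L ⊗ M ⟶ N) (g' : L' ⊗ M ⟶ N')
        (h : N ⟶ N') (_ : f ▷ M ≫ g' = g ≫ h),
        (A ◁ f) ▷ M ≫ ((α_ _ _ _).hom ≫ A ◁ g') = ((α_ _ _ _).hom ≫ A ◁ g) ≫ A ◁ h := by
      intro A L L' M N N' f g g' h e
      rw [associator_naturality_middle_assoc, ← MonoidalCategory.whiskerLeft_comp, e]
      simp
    exact step _ _ _ _ ih
  | swap a b l =>
    have step : ∀ {A B L M N : E} (g : L ⊗ M ⟶ N),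
        (swapFront A B L ▷ M) ≫ ((α_ _ _ _).hom ≫ B ◁ ((α_ _ _ _).hom ≫ A ◁ g)) =
          ((α_ _ _ _).hom ≫ A ◁ ((α_ _ _ _).hom ≫ B ◁ g)) ≫ swapFront A B N := by
      intro A B L M N g
      simp only [MonoidalCategory.whiskerLeft_comp, Category.assoc]
      rw [swapFront_naturality]
      simp only [← Category.assoc]
      congr 1
      simp only [swapFront, comp_whiskerRight, Category.assoc]
      monoidal
    exact step _
  | trans r r' ih ih' =>
    simp only [hom, appendRight, comp_whiskerRight, Category.assoc]
    rw [ih', reassoc_of% ih]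

lemma appendLeft_hom {l l' : List ι} (r : Reordering l l') (m : List ι) :
    (tensorList X m ◁ r.hom X) ≫ tensorAppend X l' m =
      tensorAppend X l m ≫ (appendLeft r m).hom X := by
  induction m with
  | nil => exact leftUnitor_naturality _
  | cons a m ih =>
    have step : ∀ {A L L' M N N' : E} (f : L ⟶ L') (g : M ⊗ L ⟶ N) (g' : M ⊗ L' ⟶ N')
        (h : N ⟶ N') (_ : M ◁ f ≫ g' = g ≫ h),
        (A ⊗ M) ◁ f ≫ ((α_ _ _ _).hom ≫ A ◁ g') = ((α_ _ _ _).hom ≫ A ◁ g) ≫ A ◁ h := by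
      intro A L L' M N N' f g g' h e
      rw [associator_naturality_right_assoc, ← MonoidalCategory.whiskerLeft_comp, e]
      simp
    exact step _ _ _ _ ih

lemma assoc_hom (l' l'' l : List ι) :
    (tensorAppend X l' l ▷ tensorList X l'') ≫ tensorAppend X l'' (l ++ l') ≫
        (assoc l' l'' l).hom X =
      (α_ _ _ _).hom ≫ (tensorList X l ◁ tensorAppend X l'' l') ≫ tensorAppend X (l' ++ l'') l := by
  induction l with
  | nil =>
    have step : ∀ {L M N : E} (g : L ⊗ M ⟶ N) (t : N ⟶ N) (_ : t = 𝟙 _),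
        (λ_ L).hom ▷ M ≫ g ≫ t = (α_ _ _ _).hom ≫ (𝟙_ E) ◁ g ≫ (λ_ N).hom := by
      rintro L M N g _ rfl
      simp
    exact step _ _ (refl_hom X _)
  | cons a l ih =>
    have step : ∀ {A L L' M N N' P P' : E} (f : L ⊗ L' ⟶ N) (g : N ⊗ M ⟶ P) (h : P ⟶ P')
        (f' : L' ⊗ M ⟶ N') (g' : L ⊗ N' ⟶ P')
        (_ : f ▷ M ≫ g ≫ h = (α_ _ _ _).hom ≫ L ◁ f' ≫ g'),
        ((α_ _ _ _).hom ≫ A ◁ f) ▷ M ≫ ((α_ _ _ _).hom ≫ A ◁ g) ≫ A ◁ h =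
          (α_ _ _ _).hom ≫ (A ⊗ L) ◁ f' ≫ ((α_ _ _ _).hom ≫ A ◁ g') := by
      intro A L L' M N N' P P' f g h f' g' e
      have e' := congrArg (fun t => (α_ A L L').hom ▷ M ≫ (α_ _ _ _).hom ≫ A ◁ t) e
      simp only [MonoidalCategory.whiskerLeft_comp] at e'
      simp only [comp_whiskerRight, Category.assoc, associator_naturality_middle_assoc, e',
        associator_naturality_right_assoc, pentagon_assoc]
    exact step _ _ _ _ _ ih

lemma appendNil_hom (l : List ι) : tensorAppend X [] l ≫ (appendNil l).hom X = (ρ_ _).hom := by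
  induction l with
  | nil => exact (Category.comp_id _).trans unitors_equal
  | cons a l ih =>
    have step : ∀ {A L N P : E} (f : L ⊗ 𝟙_ E ⟶ N) (g : N ⟶ L)
        (_ : f ≫ g = (ρ_ _).hom), ((α_ A L (𝟙_ E)).hom ≫ A ◁ f) ≫ A ◁ g = (ρ_ _).hom := by
      intro A L N P f g e
      rw [Category.assoc, ← MonoidalCategory.whiskerLeft_comp, e, rightUnitor_tensor_hom]
    exact step (P := 𝟙_ E) _ _ ih

lemma move_hom (a : ι) (l l' : List ι) :
    (X a ◁ tensorAppend X l l') ≫ (move a l l').hom X =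
      swapFront (X a) (tensorList X l') (tensorList X l) ≫ tensorAppend X (a :: l) l' := by
  induction l' with
  | nil =>
    have step : ∀ {A L : E} (t : A ⊗ L ⟶ A ⊗ L) (_ : t = 𝟙 _),
        A ◁ (λ_ L).hom ≫ t = swapFront A (𝟙_ E) L ≫ (λ_ _).hom := by
      rintro A L _ rfl
      simp only [swapFront, braiding_tensorUnit_right]
      monoidal
    exact step _ (refl_hom X _)
  | cons b l' ih =>
    have step : ∀ {A B L M N P : E} (f : L ⊗ M ⟶ N) (g : A ⊗ N ⟶ P) (h : L ⊗ (A ⊗ M) ⟶ P)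
        (_ : A ◁ f ≫ g = swapFront _ _ _ ≫ h),
        A ◁ ((α_ B L M).hom ≫ B ◁ f) ≫ (swapFront A B N ≫ B ◁ g) =
          swapFront A (B ⊗ L) M ≫ ((α_ _ _ _).hom ≫ B ◁ h) := by
      intro A B L M N P f g h e
      rw [MonoidalCategory.whiskerLeft_comp, Category.assoc, swapFront_naturality_assoc,
        ← MonoidalCategory.whiskerLeft_comp, e]
      simp only [swapFront, BraidedCategory.braiding_tensor_right_hom, comp_whiskerRight,
        MonoidalCategory.whiskerLeft_comp, Category.assoc]
      monoidal
    exact step _ _ _ ih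

lemma comm_hom (l' l : List ι) :
    tensorAppend X l' l ≫ (comm l' l).hom X = (β_ _ _).hom ≫ tensorAppend X l l' := by
  induction l with
  | nil =>
    have h := appendNil_hom X l'
    rw [← cancel_mono ((appendNil l').hom X), Category.assoc, Category.assoc, h]
    have step : ∀ {L : E} (t : L ⟶ L) (_ : t = 𝟙 _),
        (λ_ L).hom ≫ t = (β_ _ _).hom ≫ (ρ_ L).hom := by
      rintro L _ rfl
      simp
    exact step _ (symm_hom X (appendNil l'))
  | cons a l ih =>
    have step : ∀ {A L M N N' P : E} (f : L ⊗ M ⟶ N) (g : N ⟶ N') (f' : M ⊗ L ⟶ N')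
        (_ : f ≫ g = (β_ _ _).hom ≫ f') (h : A ⊗ N' ⟶ P) (k : M ⊗ (A ⊗ L) ⟶ P)
        (_ : A ◁ f' ≫ h = swapFront _ _ _ ≫ k),
        ((α_ A L M).hom ≫ A ◁ f) ≫ (A ◁ g ≫ h) = (β_ _ _).hom ≫ k := by
      intro A L M N N' P f g f' e h k e'
      rw [Category.assoc, ← MonoidalCategory.whiskerLeft_comp_assoc, e,
        MonoidalCategory.whiskerLeft_comp_assoc, e']
      simp only [swapFront, BraidedCategory.braiding_tensor_left_hom, Category.assoc]
    exact step _ _ _ ih _ _ (move_hom X a l l')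

end Reordering

/-- A map from an object to the tensor product of the factors `X i`, along a list of indices. -/
structure Pres {ι : Type} {E : Type u} [Category.{v} E] [MonoidalCategory E] (X : ι → E)
    (Z : E) where
  l : List ι
  hom : Z ⟶ tensorList X l

namespace Pres

variable {ι : Type} {E : Type u} [Category.{v} E] [MonoidalCategory E] {X : ι → E}

variable (X) in
/-- The unit object, as the tensor product of an empty list. -/
def unit : Pres X (𝟙_ E) := ⟨[], 𝟙 _⟩

/-- A map to a single factor. -/
def single (i : ι) {Z : E} (f : Z ⟶ X i) : Pres X Z := ⟨[i], f ≫ (ρ_ _).inv⟩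

/-- The tensor product of two maps to iterated tensor products. -/
def tensor {Z W : E} (p : Pres X Z) (q : Pres X W) : Pres X (Z ⊗ W) :=
  ⟨p.l ++ q.l, (p.hom ⊗ₘ q.hom) ≫ tensorAppend X q.l p.l⟩

/-- The tensor product of a family of maps to iterated tensor products. -/
def list {α : Type} {Z : α → E} (p : ∀ a, Pres X (Z a)) :
    ∀ l : List α, Pres X (tensorList Z l)
  | [] => unit X
  | a :: l => tensor (p a) (list p l)

@[simp] lemma unit_l : (unit X).l = [] := rfl

@[simp] lemma single_l (i : ι) {Z : E} (f : Z ⟶ X i) : (single i f).l = [i] := rfl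

@[simp] lemma tensor_l {Z W : E} (p : Pres X Z) (q : Pres X W) : (p.tensor q).l = p.l ++ q.l := rfl

@[simp] lemma list_l {α : Type} {Z : α → E} (p : ∀ a, Pres X (Z a)) (l : List α) :
    (list p l).l = l.flatMap fun a => (p a).l := by
  induction l with
  | nil => rfl
  | cons a l ih => simp [list, ih]

instance : IsIso (unit X).hom := inferInstanceAs (IsIso (𝟙 (𝟙_ E)))

instance (i : ι) {Z : E} (f : Z ⟶ X i) [IsIso f] : IsIso (single i f).hom :=
  inferInstanceAs (IsIso (f ≫ (ρ_ _).inv))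

instance {Z W : E} (p : Pres X Z) (q : Pres X W) [IsIso p.hom] [IsIso q.hom] :
    IsIso (p.tensor q).hom :=
  inferInstanceAs (IsIso ((p.hom ⊗ₘ q.hom) ≫ tensorAppend X q.l p.l))

instance {α : Type} {Z : α → E} (p : ∀ a, Pres X (Z a)) [∀ a, IsIso (p a).hom] (l : List α) :
    IsIso (list p l).hom := by
  induction l with
  | nil => exact inferInstanceAs (IsIso (unit X).hom)
  | cons a l ih => exact inferInstanceAs (IsIso ((p a).tensor (list p l)).hom)

end Pres

variable {ι : Type} {E : Type u} [Category.{v} E] [MonoidalCategory E] [SymmetricCategory E]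
  {X : ι → E}

/-- A morphism is canonical, with respect to maps from its source and its target to iterated tensor
products, if it is compatible with a rearrangement of the factors. Since the maps need not be
isomorphisms, this notion covers the composites of symmetry isomorphisms with tensor products of
arbitrary morphisms. -/
def Canonical {Z W : E} (p : Pres X Z) (q : Pres X W) (f : Z ⟶ W) : Prop :=
  ∃ r : Reordering p.l q.l, f ≫ q.hom = p.hom ≫ r.hom X

namespace Canonical

/-- There is at most one canonical morphism to a tensor product in which no factor is repeated. -/
lemma eq {Z W : E} {p : Pres X Z} {q : Pres X W} {f g : Z ⟶ W} (hf : Canonical p q f)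
    (hg : Canonical p q g) [IsIso q.hom] (h : q.l.Nodup) : f = g := by
  obtain ⟨r, hr⟩ := hf
  obtain ⟨s, hs⟩ := hg
  rw [← cancel_mono q.hom, hr, hs, Reordering.hom_eq X (r.perm.nodup_iff.2 h) r s]

lemma id {Z : E} (p : Pres X Z) : Canonical p p (𝟙 Z) :=
  ⟨.refl _, by simp⟩

lemma comp {Z W V : E} {p : Pres X Z} {q : Pres X W} {s : Pres X V} {f : Z ⟶ W} {g : W ⟶ V}
    (hf : Canonical p q f) (hg : Canonical q s g) : Canonical p s (f ≫ g) := by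
  obtain ⟨r, hr⟩ := hf
  obtain ⟨t, ht⟩ := hg
  exact ⟨r.trans t, by rw [Category.assoc, ht, reassoc_of% hr]; rfl⟩

lemma inv {Z W : E} {p : Pres X Z} {q : Pres X W} {f : Z ⟶ W} [IsIso f]
    (hf : Canonical p q f) : Canonical q p (CategoryTheory.inv f) := by
  obtain ⟨r, hr⟩ := hf
  refine ⟨r.symm, ?_⟩
  rw [IsIso.inv_comp_eq, ← cancel_mono (r.hom X)]
  simp only [Category.assoc, Reordering.symm_hom, Category.comp_id, reassoc_of% hr, ← hr]

lemma iso_inv {Z W : E} {p : Pres X Z} {q : Pres X W} {f : Z ≅ W}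
    (hf : Canonical p q f.hom) : Canonical q p f.inv := by
  have := hf.inv
  rwa [IsIso.Iso.inv_hom] at this

lemma single {i : ι} {Z W : E} {e : Z ⟶ X i} {e' : W ⟶ X i} {f : Z ⟶ W} (h : f ≫ e' = e) :
    Canonical (.single i e) (.single i e') f :=
  ⟨.refl _, (Category.assoc _ _ _).symm.trans
    ((congrArg (· ≫ _) h).trans ((Category.comp_id _).symm.trans
      (congrArg (_ ≫ ·) (Reordering.refl_hom X [i]).symm)))⟩

lemma tensor {Z W Z' W' : E} {p : Pres X Z} {q : Pres X W} {p' : Pres X Z'} {q' : Pres X W'}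
    {f : Z ⟶ W} {f' : Z' ⟶ W'} (hf : Canonical p q f) (hf' : Canonical p' q' f') :
    Canonical (p.tensor p') (q.tensor q') (f ⊗ₘ f') := by
  obtain ⟨r, hr⟩ := hf
  obtain ⟨r', hr'⟩ := hf'
  refine ⟨(r.appendRight _).trans (r'.appendLeft _), ?_⟩
  have h1 := Reordering.appendRight_hom X p'.l r
  have h2 := Reordering.appendLeft_hom X r' q.l
  change (f ⊗ₘ f') ≫ (q.hom ⊗ₘ q'.hom) ≫ tensorAppend X q'.l q.l =
    ((p.hom ⊗ₘ p'.hom) ≫ tensorAppend X p'.l p.l) ≫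
      (r.appendRight _).hom X ≫ (r'.appendLeft _).hom X
  rw [tensorHom_comp_tensorHom_assoc, hr, hr', Category.assoc, ← reassoc_of% h1, ← h2,
    ← tensorHom_comp_tensorHom_assoc, tensorHom_def (r.hom X), Category.assoc]

lemma whiskerLeft {Z Z' W' : E} (p : Pres X Z) {p' : Pres X Z'} {q' : Pres X W'}
    {f' : Z' ⟶ W'} (hf' : Canonical p' q' f') :
    Canonical (p.tensor p') (p.tensor q') (Z ◁ f') := by
  rw [← id_tensorHom]
  exact (id p).tensor hf'

lemma whiskerRight {Z W Z' : E} {p : Pres X Z} {q : Pres X W} (p' : Pres X Z')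
    {f : Z ⟶ W} (hf : Canonical p q f) :
    Canonical (p.tensor p') (q.tensor p') (f ▷ Z') := by
  rw [← tensorHom_id]
  exact hf.tensor (id p')

lemma associator {Z Z' Z'' : E} (p : Pres X Z) (p' : Pres X Z') (p'' : Pres X Z'') :
    Canonical ((p.tensor p').tensor p'') (p.tensor (p'.tensor p'')) (α_ Z Z' Z'').hom := by
  refine ⟨.assoc _ _ _, ?_⟩
  have step : ∀ {L L' L'' N N' P P' : E} (f : Z ⟶ L) (f' : Z' ⟶ L') (f'' : Z'' ⟶ L'')
      (a : L' ⊗ L'' ⟶ N') (b : L ⊗ N' ⟶ P) (a' : L ⊗ L' ⟶ N) (b' : N ⊗ L'' ⟶ P') (r : P' ⟶ P)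
      (_ : a' ▷ L'' ≫ b' ≫ r = (α_ _ _ _).hom ≫ L ◁ a ≫ b),
      (α_ _ _ _).hom ≫ ((f ⊗ₘ ((f' ⊗ₘ f'') ≫ a)) ≫ b) =
        ((((f ⊗ₘ f') ≫ a') ⊗ₘ f'') ≫ b') ≫ r := by
    intro L L' L'' N N' P P' f f' f'' a b a' b' r e
    have e' := congrArg (fun t => ((f ⊗ₘ f') ⊗ₘ f'') ≫ t) e
    rw [associator_naturality_assoc] at e'
    simp only [MonoidalCategory.tensorHom_def, comp_whiskerRight,
      MonoidalCategory.whiskerLeft_comp, Category.assoc, whisker_exchange_assoc] at e' ⊢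
    simp only [← whisker_exchange_assoc] at e' ⊢
    rw [e']
  exact step _ _ _ _ _ _ _ _ (Reordering.assoc_hom X p'.l p''.l p.l)

lemma associator_inv {Z Z' Z'' : E} (p : Pres X Z) (p' : Pres X Z') (p'' : Pres X Z'') :
    Canonical (p.tensor (p'.tensor p'')) ((p.tensor p').tensor p'') (α_ Z Z' Z'').inv :=
  (associator p p' p'').iso_inv

lemma leftUnitor {Z : E} (p : Pres X Z) : Canonical ((Pres.unit X).tensor p) p (λ_ Z).hom := by
  refine ⟨.refl _, ?_⟩
  have step : ∀ {L : E} (f : Z ⟶ L) (r : L ⟶ L) (_ : r = 𝟙 _),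
      (λ_ Z).hom ≫ f = ((𝟙 (𝟙_ E) ⊗ₘ f) ≫ (λ_ _).hom) ≫ r := by
    rintro L f _ rfl
    simp
  exact step _ _ (Reordering.refl_hom X _)

lemma rightUnitor {Z : E} (p : Pres X Z) : Canonical (p.tensor (Pres.unit X)) p (ρ_ Z).hom := by
  refine ⟨.appendNil _, ?_⟩
  have step : ∀ {L N : E} (f : Z ⟶ L) (a : L ⊗ 𝟙_ E ⟶ N) (r : N ⟶ L) (_ : a ≫ r = (ρ_ _).hom),
      (ρ_ Z).hom ≫ f = ((f ⊗ₘ 𝟙 (𝟙_ E)) ≫ a) ≫ r := by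
    rintro L N f a r e
    rw [Category.assoc, e]
    simp
  exact step _ _ _ (Reordering.appendNil_hom X _)

lemma braiding {Z Z' : E} (p : Pres X Z) (p' : Pres X Z') :
    Canonical (p.tensor p') (p'.tensor p) (β_ Z Z').hom := by
  refine ⟨.comm _ _, ?_⟩
  have step : ∀ {L L' N N' : E} (f : Z ⟶ L) (f' : Z' ⟶ L') (a : L ⊗ L' ⟶ N) (r : N ⟶ N')
      (a' : L' ⊗ L ⟶ N') (_ : a ≫ r = (β_ _ _).hom ≫ a'),
      (β_ Z Z').hom ≫ ((f' ⊗ₘ f) ≫ a') = ((f ⊗ₘ f') ≫ a) ≫ r := by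
    intro L L' N N' f f' a r a' e
    rw [Category.assoc, e, BraidedCategory.braiding_naturality_assoc]
  exact step _ _ _ _ _ (Reordering.comm_hom X _ _)

lemma tensorμ {A B C D : E} (p : Pres X A) (q : Pres X B) (p' : Pres X C) (q' : Pres X D) :
    Canonical ((p.tensor q).tensor (p'.tensor q')) ((p.tensor p').tensor (q.tensor q'))
      (tensorμ A B C D) := by
  refine (associator _ _ _).comp ((whiskerLeft _ (associator_inv _ _ _)).comp
    ((whiskerLeft _ (whiskerRight _ (braiding _ _))).comp
      ((whiskerLeft _ (associator _ _ _)).comp (associator_inv _ _ _))))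

section List

variable {α β : Type}

lemma tensorReindex {Z : α → E} {W : β → E} {p : ∀ a, Pres X (Z a)} {q : ∀ b, Pres X (W b)}
    (e : α → β) {f : ∀ a, Z a ⟶ W (e a)} (h : ∀ a, Canonical (p a) (q (e a)) (f a))
    (l : List α) : Canonical (.list p l) (.list q (l.map e)) (tensorReindex e f l) := by
  induction l with
  | nil => exact id _
  | cons a l ih => exact (h a).tensor ih

lemma tensorListMap {Z W : α → E} {p : ∀ a, Pres X (Z a)} {q : ∀ b, Pres X (W b)}
    {f : ∀ a, Z a ⟶ W a} (h : ∀ a, Canonical (p a) (q a) (f a))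
    (l : List α) : Canonical (.list p l) (.list q l) (tensorListMap f l) := by
  induction l with
  | nil => exact id _
  | cons a l ih => exact (h a).tensor ih

lemma reordering {Z : α → E} (p : ∀ a, Pres X (Z a)) {l l' : List α} (r : Reordering l l') :
    Canonical (.list p l) (.list p l') (r.hom Z) := by
  induction r with
  | nil => exact id _
  | cons a r ih => exact whiskerLeft _ ih
  | swap a b l =>
    exact (associator_inv _ _ _).comp ((whiskerRight _ (braiding _ _)).comp (associator _ _ _))
  | trans r r' ih ih' => exact ih.comp ih'

lemma tensorAppend {Z : α → E} (p : ∀ a, Pres X (Z a)) (l' l : List α) :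
    Canonical ((Pres.list p l).tensor (.list p l')) (.list p (l ++ l')) (tensorAppend Z l' l) := by
  induction l with
  | nil => exact leftUnitor _
  | cons a l ih => exact (associator _ _ _).comp (whiskerLeft _ ih)

lemma tensorUnzip {Z W : α → E} (p : ∀ a, Pres X (Z a)) (q : ∀ a, Pres X (W a)) (l : List α) :
    Canonical (.list (fun a => (p a).tensor (q a)) l) ((Pres.list p l).tensor (.list q l))
      (tensorUnzip Z W l) := by
  induction l with
  | nil => exact (leftUnitor _).iso_inv
  | cons a l ih => exact (whiskerLeft _ ih).comp (tensorμ _ _ _ _)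

lemma tensorFlatten {J : α → Type} {Z : (Σ a, J a) → E} (p : ∀ x, Pres X (Z x))
    (B : ∀ a, List (J a)) (l : List α) :
    Canonical (.list (fun a => .list (fun j => p ⟨a, j⟩) (B a)) l)
      (.list p (l.flatMap fun a => (B a).map (Sigma.mk a))) (tensorFlatten Z B l) := by
  induction l with
  | nil => exact id _
  | cons a l ih =>
    exact (tensor (tensorReindex (Sigma.mk a) (fun j => id _) (B a)) ih).comp
      (tensorAppend p _ _)

end List

end Canonical

section IsIso

variable {α β : Type} {E : Type u} [Category.{v} E] [MonoidalCategory E]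

lemma isIso_tensorReindex {Z : α → E} {W : β → E} (e : α → β) (f : ∀ a, Z a ⟶ W (e a))
    [∀ a, IsIso (f a)] (l : List α) : IsIso (tensorReindex e f l) := by
  induction l with
  | nil => exact inferInstanceAs (IsIso (𝟙 (𝟙_ E)))
  | cons a l ih => exact inferInstanceAs (IsIso (f a ⊗ₘ tensorReindex e f l))

instance isIso_tensorFlatten {J : α → Type} (Z : (Σ a, J a) → E) (B : ∀ a, List (J a))
    (l : List α) : IsIso (tensorFlatten Z B l) := by
  induction l with
  | nil => exact inferInstanceAs (IsIso (𝟙 (𝟙_ E)))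
  | cons a l ih =>
    have := isIso_tensorReindex (W := Z) (Sigma.mk a) (fun j => 𝟙 (Z ⟨a, j⟩)) (B a)
    exact inferInstanceAs (IsIso ((tensorReindex (Y := Z) (Sigma.mk a) (fun j => 𝟙 (Z ⟨a, j⟩)) (B a)
      ⊗ₘ tensorFlatten Z B l) ≫ tensorAppend Z _ _))

variable [SymmetricCategory E]

instance isIso_tensorUnzip (Z W : α → E) (l : List α) : IsIso (tensorUnzip Z W l) := by
  induction l with
  | nil => exact inferInstanceAs (IsIso (λ_ (𝟙_ E)).inv)
  | cons a l ih =>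
    have : IsIso (tensorμ (Z a) (W a) (tensorList Z l) (tensorList W l)) :=
      ⟨tensorδ _ _ _ _, tensorμ_tensorδ _ _ _ _, tensorδ_tensorμ _ _ _ _⟩
    exact inferInstanceAs (IsIso (((Z a ⊗ W a) ◁ tensorUnzip Z W l) ≫
      tensorμ (Z a) (W a) (tensorList Z l) (tensorList W l)))

end IsIso

/-! ### Enumerations of finite sets -/

/-- A list in which every element of a type occurs exactly once. -/
structure IsEnum {T : Type} (l : List T) : Prop where
  nodup : l.Nodup
  mem (t : T) : t ∈ l

namespace IsEnum

variable {T T' : Type}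

lemma finRange (n : ℕ) : IsEnum (List.finRange n) := ⟨List.nodup_finRange n, List.mem_finRange⟩

lemma perm {l l' : List T} (hl : IsEnum l) (hl' : IsEnum l') : l.Perm l' :=
  (List.perm_ext_iff_of_nodup hl.nodup hl'.nodup).2 fun t =>
    ⟨fun _ => hl'.mem t, fun _ => hl.mem t⟩

lemma map {l : List T} (hl : IsEnum l) (e : T ≃ T') : IsEnum (l.map e) :=
  ⟨hl.nodup.map e.injective, fun t => List.mem_map.2 ⟨e.symm t, hl.mem _, e.apply_symm_apply t⟩⟩

lemma sigma {J : T → Type} {l : List T} (hl : IsEnum l) {B : ∀ t, List (J t)}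
    (hB : ∀ t, IsEnum (B t)) : IsEnum (l.flatMap fun t => (B t).map (Sigma.mk t)) where
  nodup := by
    rw [List.nodup_flatMap]
    refine ⟨fun t _ => (hB t).nodup.map sigma_mk_injective, ?_⟩
    refine hl.nodup.imp ?_
    intro t t' h x hx hx'
    obtain ⟨j, -, rfl⟩ := List.mem_map.1 hx
    obtain ⟨j', -, h'⟩ := List.mem_map.1 hx'
    exact h (congrArg Sigma.fst h').symm
  mem := by
    rintro ⟨t, j⟩
    exact List.mem_flatMap.2 ⟨t, hl.mem t, List.mem_map.2 ⟨j, (hB t).mem j, rfl⟩⟩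

lemma exists_isEnum (T : Type) [Finite T] : ∃ l : List T, IsEnum l := by
  have := Fintype.ofFinite T
  exact ⟨Finset.univ.toList, Finset.nodup_toList _, fun t => by simp⟩

end IsEnum

/-- An enumeration of a finite type. -/
noncomputable def enum (T : Type) [Finite T] : List T := (IsEnum.exists_isEnum T).choose

lemma isEnum_enum (T : Type) [Finite T] : IsEnum (enum T) := (IsEnum.exists_isEnum T).choose_spec

lemma Pres.list_single_l {E : Type u} [Category.{v} E] [MonoidalCategory E] {T ι : Type}
    {A : ι → E} {Z : T → E} (i : T → ι) (f : ∀ t, Z t ⟶ A (i t))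
    (l : List T) : (Pres.list (fun t => Pres.single (i t) (f t)) l).l = l.map i := by
  simp only [Pres.list_l, Pres.single_l]
  exact List.map_eq_flatMap.symm

section TensorEquiv

variable {E : Type u} [Category.{v} E] [MonoidalCategory E] [SymmetricCategory E] {T T' T'' : Type}

/-- The map between tensor products over finite sets, attached to a bijection `e` and maps
`Z t ⟶ X (e t)`. The tensor products are formed along enumerations of the two sets. -/
noncomputable def tensorEquiv (e : T ≃ T') {Z : T → E} {X : T' → E} (z : ∀ t, Z t ⟶ X (e t))
    {l : List T} {l' : List T'} (hl : IsEnum l) (hl' : IsEnum l') :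
    tensorList Z l ⟶ tensorList X l' :=
  tensorReindex e z l ≫ (Reordering.ofPerm ((hl.map e).perm hl')).hom X

lemma Canonical.tensorEquiv {ι : Type} {A : ι → E} {Z : T → E} {X : T' → E}
    {p : ∀ t, Pres A (Z t)} {q : ∀ t, Pres A (X t)} {e : T ≃ T'} {z : ∀ t, Z t ⟶ X (e t)}
    (h : ∀ t, Canonical (p t) (q (e t)) (z t)) {l : List T} {l' : List T'} (hl : IsEnum l)
    (hl' : IsEnum l') : Canonical (.list p l) (.list q l') (tensorEquiv e z hl hl') :=
  (tensorReindex e h l).comp (reordering q _)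

/-- The factors of a tensor product, each forming a single factor. -/
abbrev Pres.singles (X : T → E) (l : List T) : Pres X (tensorList X l) :=
  .list (fun t => .single t (𝟙 (X t))) l

lemma Canonical.tensorEquiv_singles (e : T ≃ T') {Z : T → E} {X : T' → E} (z : ∀ t, Z t ⟶ X (e t))
    {l : List T} {l' : List T'} (hl : IsEnum l) (hl' : IsEnum l') :
    Canonical (.list (fun t => .single (e t) (z t)) l) (.singles X l')
      (OperadTheory.tensorEquiv e z hl hl') :=
  .tensorEquiv (q := fun t => .single t (𝟙 (X t))) (fun _ => .single (Category.comp_id _)) hl hl'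

lemma eq_tensorEquiv {e : T ≃ T'} {Z : T → E} {X : T' → E} {z : ∀ t, Z t ⟶ X (e t)}
    {l : List T} {l' : List T'} (hl : IsEnum l) (hl' : IsEnum l')
    {f : tensorList Z l ⟶ tensorList X l'}
    (h : Canonical (.list (fun t => .single (e t) (z t)) l) (.singles X l') f) :
    f = tensorEquiv e z hl hl' := by
  refine h.eq (Canonical.tensorEquiv_singles e z hl hl') ?_
  rw [Pres.list_single_l, List.map_id']
  exact hl'.nodup

lemma tensorEquiv_comp (e : T ≃ T') (e' : T' ≃ T'') {Z : T → E} {X : T' → E} {Y : T'' → E}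
    (z : ∀ t, Z t ⟶ X (e t)) (x : ∀ t, X t ⟶ Y (e' t)) {l : List T} {l' : List T'} {l'' : List T''}
    (hl : IsEnum l) (hl' : IsEnum l') (hl'' : IsEnum l'') :
    tensorEquiv e z hl hl' ≫ tensorEquiv e' x hl' hl'' =
      tensorEquiv (X := Y) (e.trans e') (fun t => z t ≫ x (e t)) hl hl'' :=
  eq_tensorEquiv hl hl'' ((Canonical.tensorEquiv
    (q := fun t => .single (e' t) (x t)) (fun _ => .single rfl) hl hl').comp
      (.tensorEquiv_singles e' x hl' hl''))

lemma tensorListMap_eq_tensorEquiv {Z X : T → E} (z : ∀ t, Z t ⟶ X t) {l : List T}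
    (hl : IsEnum l) : tensorListMap z l = tensorEquiv (X := X) (Equiv.refl T) z hl hl :=
  eq_tensorEquiv hl hl (Canonical.tensorListMap (fun _ => .single (Category.comp_id _)) l)

lemma reindex_reordering_eq_tensorEquiv (e : T ≃ T') {Z : T → E} {X : T' → E}
    (z : ∀ t, Z t ⟶ X (e t)) {l : List T} {l' : List T'} (hl : IsEnum l) (hl' : IsEnum l')
    (r : Reordering (l.map e) l') :
    tensorReindex e z l ≫ r.hom X = tensorEquiv e z hl hl' :=
  eq_tensorEquiv hl hl' ((Canonical.tensorReindex e (fun _ => .single (Category.comp_id _)) l).comp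
    (.reordering _ r))

lemma tensorEquiv_comp_listMap (e : T ≃ T') {Z : T → E} {X Y : T' → E} (z : ∀ t, Z t ⟶ X (e t))
    (x : ∀ t, X t ⟶ Y t) {l : List T} {l' : List T'} (hl : IsEnum l) (hl' : IsEnum l') :
    tensorEquiv e z hl hl' ≫ tensorListMap x l' =
      tensorEquiv e (fun t => z t ≫ x (e t)) hl hl' :=
  (congrArg (_ ≫ ·) (tensorListMap_eq_tensorEquiv x hl')).trans
    (tensorEquiv_comp e (Equiv.refl T') z x hl hl' hl')

lemma tensorListMap_comp_equiv (e : T ≃ T') {Z Z' : T → E} {X : T' → E} (y : ∀ t, Z t ⟶ Z' t)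
    (z : ∀ t, Z' t ⟶ X (e t)) {l : List T} {l' : List T'} (hl : IsEnum l) (hl' : IsEnum l') :
    tensorListMap y l ≫ tensorEquiv e z hl hl' =
      tensorEquiv e (fun t => y t ≫ z t) hl hl' :=
  (congrArg (· ≫ _) (tensorListMap_eq_tensorEquiv y hl)).trans
    (tensorEquiv_comp (Equiv.refl T) e y z hl hl hl')

lemma tensorEquiv_refl (X : T → E) {l : List T} (hl : IsEnum l) :
    tensorEquiv (X := X) (Equiv.refl T) (fun t => 𝟙 (X t)) hl hl = 𝟙 _ :=
  (eq_tensorEquiv hl hl (.id _)).symm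

lemma isIso_tensorEquiv (e : T ≃ T') {Z : T → E} {X : T' → E} (z : ∀ t, Z t ⟶ X (e t))
    [∀ t, IsIso (z t)] {l : List T} {l' : List T'} (hl : IsEnum l) (hl' : IsEnum l') :
    IsIso (tensorEquiv e z hl hl') := by
  have := isIso_tensorReindex e z l
  exact inferInstanceAs (IsIso (tensorReindex e z l ≫ _))

end TensorEquiv

noncomputable section

namespace SymMod

variable {E : Type u} [Category.{v} E] [MonoidalCategory E] [SymmetricCategory E]
  [HasColimitsOfSize.{0, 0} E]

/-! ### Maps out of coinvariants -/

section Descent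

variable {E' : Type u'} [Category.{v'} E'] (L : E ⥤ E') [PreservesColimitsOfSize.{0, 0} L]
  {M : SymMod E} {F : SymFamily E}

lemma map_coinv_hom_ext {Z : E'} {f g : L.obj (M.coinv F) ⟶ Z}
    (h : ∀ (k : ℕ) (j : F.J k), L.map (M.inc F j) ≫ f = L.map (M.inc F j) ≫ g) : f = g := by
  have : Epi (L.map (M.coinvProj F)) := by
    have : Epi (M.coinvProj F) := inferInstanceAs (Epi (coequalizer.π _ _))
    infer_instance
  rw [← cancel_epi (L.map (M.coinvProj F))]
  refine Cofan.IsColimit.hom_ext (isColimitCofanMkObjOfIsColimit L _ _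
    (coproductIsCoproduct fun y : Σ k, F.J k => M.summand F y.2)) _ _ ?_
  rintro ⟨k, j⟩
  have := h k j
  simp only [inc, Functor.map_comp, Category.assoc] at this
  exact this

/-- A functor that preserves colimits takes the coinvariants to an object whose maps are the
compatible families of maps out of the images of the summands. -/
lemma exists_map_coinv_desc {Z : E'} (g : ∀ (k : ℕ) (j : F.J k), L.obj (M.summand F j) ⟶ Z)
    (hg : ∀ (k : ℕ) (j : F.J k) (σ : Equiv.Perm (Fin k))
      (r : Reordering ((List.finRange k).map σ) (List.finRange k)),
      L.map (M.summandPerm F j σ r) ≫ g k (F.act σ j) = g k j) :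
    ∃ d : L.obj (M.coinv F) ⟶ Z, ∀ (k : ℕ) (j : F.J k), L.map (M.inc F j) ≫ d = g k j := by
  let hc := isColimitCofanMkObjOfIsColimit L _ _
    (coproductIsCoproduct fun y : Σ k, F.J k => M.summand F y.2)
  let hr := isColimitCofanMkObjOfIsColimit L _ _
    (coproductIsCoproduct fun x : RelIdx F => M.summand F x.2.1)
  let d₀ : L.obj (∐ fun y : Σ k, F.J k => M.summand F y.2) ⟶ Z :=
    Cofan.IsColimit.desc hc fun y => g y.1 y.2
  have hd₀ : ∀ y : Σ k, F.J k, L.map (Sigma.ι (fun y : Σ k, F.J k => M.summand F y.2) y) ≫ d₀ =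
      g y.1 y.2 := fun y => Cofan.IsColimit.fac hc _ y
  let d := Cofork.IsColimit.desc' (isColimitOfHasCoequalizerOfPreservesColimit L
    (Sigma.desc (fun x : RelIdx F =>
      Sigma.ι (fun y : Σ k, F.J k => M.summand F y.2) ⟨x.1, x.2.1⟩))
    (Sigma.desc (fun x : RelIdx F => M.summandPerm F x.2.1 x.2.2.1 x.2.2.2 ≫
      Sigma.ι (fun y : Σ k, F.J k => M.summand F y.2) ⟨x.1, F.act x.2.2.1 x.2.1⟩))) d₀ (by
    refine Cofan.IsColimit.hom_ext hr _ _ ?_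
    rintro ⟨k, j, σ, r⟩
    change L.map (Sigma.ι (fun x : RelIdx F => M.summand F x.2.1) _) ≫ _ =
      L.map (Sigma.ι (fun x : RelIdx F => M.summand F x.2.1) _) ≫ _
    rw [← Functor.map_comp_assoc, ← Functor.map_comp_assoc, Sigma.ι_desc, Sigma.ι_desc,
      Functor.map_comp_assoc, hd₀, hd₀]
    exact (hg k j σ r).symm)
  refine ⟨d.1, fun k j => ?_⟩
  have step : ∀ d' : L.obj (M.coinv F) ⟶ Z, L.map (M.coinvProj F) ≫ d' = d₀ →
      L.map (M.inc F j) ≫ d' = g k j := by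
    intro d' hd'
    rw [inc, Functor.map_comp_assoc, hd', hd₀]
  exact step d.1 d.2

end Descent

/-! ### Inclusions indexed by finite sets -/

section Inclusion

variable (M : SymMod E) (F : SymFamily E) {T T' : Type} [Finite T] [Finite T']

/-- The inclusion of a summand `M(T) ⊗ ⨂ₜ Z t` into the coinvariants, for a finite set `T`, an
enumeration `e` of `T`, and maps `Z t ⟶ X j (e t)`. -/
def incEquiv {n : ℕ} (e : T ≃ Fin n) (j : F.J n) {Z : T → E} (z : ∀ t, Z t ⟶ F.X j (e t))
    {l : List T} (hl : IsEnum l) : M.obj T ⊗ tensorList Z l ⟶ M.coinv F :=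
  (M.map e ⊗ₘ tensorEquiv e z hl (.finRange n)) ≫ M.inc F j

lemma incEquiv_perm {n : ℕ} (e : T ≃ Fin n) (j : F.J n) {Z : T → E} (z : ∀ t, Z t ⟶ F.X j (e t))
    {l : List T} (hl : IsEnum l) (σ : Equiv.Perm (Fin n)) :
    M.incEquiv F (e.trans σ) (F.act σ j) (fun t => z t ≫ F.perm σ j (e t)) hl =
      M.incEquiv F e j z hl := by
  simp only [incEquiv]
  rw [← M.inc_perm F j σ (.ofPerm (((IsEnum.finRange n).map σ).perm (.finRange n)))]
  rw [summandPerm, reindex_reordering_eq_tensorEquiv σ (F.perm σ j) (.finRange n) (.finRange n),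
    tensorHom_comp_tensorHom_assoc, M.map_trans, tensorEquiv_comp]

lemma map_incEquiv {n : ℕ} (b : T ≃ T') (e : T' ≃ Fin n) (j : F.J n) {Z : T → E} {Z' : T' → E}
    (f : ∀ t, Z t ⟶ Z' (b t)) (z : ∀ t, Z' t ⟶ F.X j (e t)) {l : List T} {l' : List T'}
    (hl : IsEnum l) (hl' : IsEnum l') :
    (M.map b ⊗ₘ tensorEquiv b f hl hl') ≫ M.incEquiv F e j z hl' =
      M.incEquiv F (b.trans e) j (fun t => f t ≫ z (b t)) hl := by
  unfold incEquiv
  rw [tensorHom_comp_tensorHom_assoc, M.map_trans, tensorEquiv_comp]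

lemma incEquiv_refl {n : ℕ} (j : F.J n) :
    M.incEquiv F (Equiv.refl (Fin n)) j (fun i => 𝟙 (F.X j i)) (.finRange n) = M.inc F j := by
  unfold incEquiv
  rw [tensorEquiv_refl, M.map_refl, id_tensorHom_id, Category.id_comp]

variable (N : SymMod E) (V : E)

/-- The inclusion `M(T) ⊗ ⨂ₜ V ⟶ M(V)`, for a finite set `T`. -/
def incSchur {l : List T} (hl : IsEnum l) :
    M.obj T ⊗ tensorList (fun _ => V) l ⟶ M.schur.obj V :=
  M.incEquiv (.const V) (Finite.equivFin T) () (fun _ => 𝟙 V) hl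

lemma listMap_incEquiv {n : ℕ} (e : T ≃ Fin n) (j : F.J n) {Z Z' : T → E} (f : ∀ t, Z t ⟶ Z' t)
    (z : ∀ t, Z' t ⟶ F.X j (e t)) {l : List T} (hl : IsEnum l) :
    (M.obj T ◁ tensorListMap f l) ≫ M.incEquiv F e j z hl =
      M.incEquiv F e j (fun t => f t ≫ z t) hl := by
  unfold incEquiv
  rw [← id_tensorHom, tensorHom_comp_tensorHom_assoc, tensorListMap_comp_equiv, Category.id_comp]

variable {V} in
lemma incEquiv_const {n : ℕ} (e : T ≃ Fin n) {Z : T → E} (z : ∀ t, Z t ⟶ V) {l : List T}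
    (hl : IsEnum l) :
    M.incEquiv (.const V) e () z hl = (M.obj T ◁ tensorListMap z l) ≫ M.incSchur V hl := by
  obtain rfl : n = Nat.card T := by rw [Nat.card_congr e, Nat.card_fin]
  obtain ⟨σ, rfl⟩ : ∃ σ, e = (Finite.equivFin T).trans σ :=
    ⟨(Finite.equivFin T).symm.trans e, by ext; simp⟩
  have h := M.incEquiv_perm (.const V) (Finite.equivFin T) () z hl σ
  have h' := M.listMap_incEquiv (.const V) (Finite.equivFin T) () z (fun _ => 𝟙 V) hl
  simp only [Category.comp_id] at h h'
  exact h.trans h'.symm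

lemma incSchur_fin (k : ℕ) : M.incSchur V (.finRange k) = M.inc (.const V) (k := k) () := by
  have h := M.incEquiv_const (V := V) (Equiv.refl (Fin k)) (fun _ => 𝟙 V) (.finRange k)
  rw [tensorListMap_id, MonoidalCategory.whiskerLeft_id, Category.id_comp] at h
  exact h.symm.trans (M.incEquiv_refl (.const V) ())

lemma map_incSchur (b : T ≃ T') {Z : T → E} (z : ∀ t, Z t ⟶ V) {l : List T} {l' : List T'}
    (hl : IsEnum l) (hl' : IsEnum l') :
    (M.map b ⊗ₘ tensorEquiv (X := fun _ => V) b z hl hl') ≫ M.incSchur V hl' =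
      (M.obj T ◁ tensorListMap z l) ≫ M.incSchur V hl := by
  have h := M.map_incEquiv (.const V) b (Finite.equivFin T') () z (fun _ => 𝟙 V) hl hl'
  simp only [Category.comp_id] at h
  exact h.trans (M.incEquiv_const _ z hl)

lemma incSchur_map {V W : E} (f : V ⟶ W) {l : List T} (hl : IsEnum l) :
    M.incSchur V hl ≫ M.schur.map f =
      (M.obj T ◁ tensorListMap (fun _ => f) l) ≫ M.incSchur W hl := by
  rw [← incEquiv_const _ (Finite.equivFin T), incSchur]
  unfold incEquiv
  refine (Category.assoc _ _ _).trans ((congrArg (_ ≫ ·) (M.inc_schurMap f _)).trans ?_)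
  rw [tensorHom_comp_tensorHom_assoc, Category.comp_id]
  have h := tensorEquiv_comp_listMap (X := fun _ => V) (Finite.equivFin T) (fun _ => 𝟙 V)
    (fun _ => f) hl (.finRange _)
  simp only [Category.id_comp] at h
  exact congrArg (fun t => (M.map (Finite.equivFin T) ⊗ₘ t) ≫ M.inc (.const W) ()) h

lemma incSchur_schurHom {M M' : SymMod E} (φ : M ⟶ M') {l : List T} (hl : IsEnum l) :
    M.incSchur V hl ≫ schurHom φ V = (φ.app T ▷ _) ≫ M'.incSchur V hl := by
  unfold incSchur incEquiv
  refine (Category.assoc _ _ _).trans ((congrArg (_ ≫ ·)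
    (M.inc_coinvDesc (.const V) _ (schurHom_compat φ V) ())).trans ?_)
  rw [tensorListMap_id, tensorHom_comp_tensorHom_assoc, Category.comp_id, φ.naturality]
  refine Eq.trans ?_ (Category.assoc _ _ _)
  rw [← tensorHom_id, tensorHom_comp_tensorHom, Category.id_comp]

variable {S S' : Type} [Finite S] [Finite S']

/-- The inclusion `M(T) ⊗ ⨂ₜ N(f⁻¹(t)) ⟶ (M ∘ N)(S)`, for a map `f : S → T` of finite sets. -/
def incComp (f : S → T) {l : List T} (hl : IsEnum l) :
    M.obj T ⊗ tensorList (fun t => N.obj {s // f s = t}) l ⟶ (M.comp N).obj S :=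
  M.incEquiv (.fibres N S) (Finite.equivFin T) (fun s => Finite.equivFin T (f s))
    (fun _ => N.map (fibreEquiv (Equiv.refl S) (fun s => by simp))) hl

lemma incComp_eq (f : S → T) {n : ℕ} (e : T ≃ Fin n) {l : List T} (hl : IsEnum l) :
    M.incComp N f hl = M.incEquiv (.fibres N S) e (fun s => e (f s))
      (fun _ => N.map (fibreEquiv (Equiv.refl S) (fun s => by simp))) hl := by
  obtain rfl : n = Nat.card T := by rw [Nat.card_congr e, Nat.card_fin]
  obtain ⟨σ, rfl⟩ : ∃ σ, e = (Finite.equivFin T).trans σ :=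
    ⟨(Finite.equivFin T).symm.trans e, by ext; simp⟩
  rw [incComp, ← incEquiv_perm _ _ _ _ _ _ σ]
  congr 1
  funext t
  exact (N.map_trans _ _).symm

lemma incComp_fin {k : ℕ} (f : S → Fin k) :
    M.incComp N f (.finRange k) = M.inc (.fibres N S) f := by
  rw [M.incComp_eq N f (Equiv.refl (Fin k)), ← incEquiv_refl]
  congr 1
  funext t
  exact N.map_refl _

lemma map_incComp (b : T ≃ T') (a : S ≃ S') {f : S → T} {f' : S' → T'}
    (β : ∀ t, {s // f s = t} ≃ {s // f' s = b t}) (h : ∀ t s, (β t s).1 = a s.1)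
    {l : List T} {l' : List T'} (hl : IsEnum l) (hl' : IsEnum l') :
    (M.map b ⊗ₘ tensorEquiv (X := fun t => N.obj {s // f' s = t}) b (fun t => N.map (β t)) hl hl') ≫
      M.incComp N f' hl' = M.incComp N f hl ≫ (M.comp N).map a := by
  obtain rfl : f' = fun s => b (f (a.symm s)) := by
    funext s
    have h1 := (β (f (a.symm s)) ⟨a.symm s, rfl⟩).2
    rw [h] at h1
    simpa using h1
  rw [M.incComp_eq N f (b.trans (Finite.equivFin T'))]
  refine (M.map_incEquiv (.fibres N S') b (Finite.equivFin T') _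
    (Z' := fun t => N.obj {s // b (f (a.symm s)) = t}) (fun t => N.map (β t)) _ hl hl').trans ?_
  unfold incEquiv
  refine Eq.trans ?_ (Category.assoc _ _ _).symm
  refine Eq.trans ?_ (congrArg (_ ≫ ·) (M.inc_compRelabel N a _)).symm
  rw [tensorHom_comp_tensorHom_assoc, Category.comp_id]
  refine Eq.trans ?_ (congrArg (fun t => (_ ⊗ₘ t) ≫ _) (tensorEquiv_comp_listMap _ _ _ hl _).symm)
  refine congrArg (fun t => (_ ⊗ₘ tensorEquiv (X := (SymFamily.fibres N S').X _) _ t _ _) ≫ _) ?_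
  funext t
  refine (N.map_trans _ _).symm.trans (Eq.trans ?_ (N.map_trans _ _))
  congr 1
  ext s
  exact h t s

lemma incComp_compMap {M M' N N' : SymMod E} (φ : M ⟶ M') (φ' : N ⟶ N') (f : S → T) {l : List T}
    (hl : IsEnum l) :
    M.incComp N f hl ≫ (compMap φ φ').app S =
      (φ.app T ⊗ₘ tensorListMap (fun t => φ'.app {s // f s = t}) l) ≫ M'.incComp N' f hl := by
  unfold incComp incEquiv
  refine (Category.assoc _ _ _).trans ((congrArg (_ ≫ ·)
    (M.inc_coinvDesc (.fibres N S) _ (compMap_compat φ φ' S) _)).trans ?_)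
  rw [tensorHom_comp_tensorHom_assoc]
  refine Eq.trans ?_ (Category.assoc _ _ _)
  rw [tensorHom_comp_tensorHom, φ.naturality, tensorListMap_comp_equiv]
  refine congrArg (fun t => (_ ⊗ₘ t) ≫ _) ?_
  refine (tensorEquiv_comp_listMap (X := (SymFamily.fibres N S).X _) _ _ _ hl _).trans ?_
  refine congrArg (fun t => tensorEquiv (X := (SymFamily.fibres N' S).X _) _ t _ _) ?_
  funext t
  exact φ'.naturality _

end Inclusion

end SymMod

/-! ### Collecting the factors of a twofold tensor product -/

section Collect

variable {E : Type u} [Category.{v} E] [MonoidalCategory E] [SymmetricCategory E]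
  {T T' S : Type} {J : T → Type} {J' : T' → Type}

/-- The canonical isomorphism `M₀ ⊗ ⨂ₜ (A t ⊗ ⨂ⱼ Y t j) ⟶ (M₀ ⊗ ⨂ₜ A t) ⊗ ⨂ₜⱼ Y t j`. -/
def assemble (M₀ : E) (A : T → E) (Y : (Σ t, J t) → E) (B : ∀ t, List (J t)) (l : List T) :
    M₀ ⊗ tensorList (fun t => A t ⊗ tensorList (fun j => Y ⟨t, j⟩) (B t)) l ⟶
      (M₀ ⊗ tensorList A l) ⊗ tensorList Y (l.flatMap fun t => (B t).map (Sigma.mk t)) :=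
  (M₀ ◁ tensorUnzip _ _ l) ≫ (α_ _ _ _).inv ≫ (_ ◁ tensorFlatten Y B l)

/-- The canonical map `M₀ ⊗ ⨂ₜ (A t ⊗ ⨂ⱼ Y t j) ⟶ (M₀ ⊗ ⨂ₜ A t) ⊗ ⨂ₛ W s`, for a bijection `w` from
the pairs `(t, j)` to the elements `s` of a set and maps `Y t j ⟶ W (w (t, j))`. -/
def collect (M₀ : E) (A : T → E) (Y : (Σ t, J t) → E) (W : S → E) (w : (Σ t, J t) ≃ S)
    (y : ∀ x, Y x ⟶ W (w x)) {B : ∀ t, List (J t)} (hB : ∀ t, IsEnum (B t)) {l : List T}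
    (hl : IsEnum l) {m : List S} (hm : IsEnum m) :
    M₀ ⊗ tensorList (fun t => A t ⊗ tensorList (fun j => Y ⟨t, j⟩) (B t)) l ⟶
      (M₀ ⊗ tensorList A l) ⊗ tensorList W m :=
  assemble M₀ A Y B l ≫ (_ ◁ tensorEquiv w y (hl.sigma hB) hm)

instance (M₀ : E) (A : T → E) (Y : (Σ t, J t) → E) (B : ∀ t, List (J t)) (l : List T) :
    IsIso (assemble M₀ A Y B l) := by
  unfold assemble
  infer_instance

instance isIso_collect (M₀ : E) (A : T → E) (Y : (Σ t, J t) → E) (W : S → E) (w : (Σ t, J t) ≃ S)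
    (y : ∀ x, Y x ⟶ W (w x)) [∀ x, IsIso (y x)] {B : ∀ t, List (J t)} (hB : ∀ t, IsEnum (B t))
    {l : List T} (hl : IsEnum l) {m : List S} (hm : IsEnum m) :
    IsIso (collect M₀ A Y W w y hB hl hm) := by
  have := isIso_tensorEquiv w y (hl.sigma hB) hm
  unfold collect
  infer_instance

lemma Canonical.assemble {ι : Type} {X : ι → E} {M₀ : E} (p₀ : Pres X M₀) {A : T → E}
    (pA : ∀ t, Pres X (A t)) {Y : (Σ t, J t) → E} (pY : ∀ x, Pres X (Y x)) (B : ∀ t, List (J t))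
    (l : List T) :
    Canonical (p₀.tensor (.list (fun t => (pA t).tensor (.list (fun j => pY ⟨t, j⟩) (B t))) l))
      ((p₀.tensor (.list pA l)).tensor (.list pY _)) (assemble M₀ A Y B l) :=
  (whiskerLeft _ (tensorUnzip pA (fun t => .list (fun j => pY ⟨t, j⟩) (B t)) l)).comp
    ((associator_inv _ _ _).comp (whiskerLeft _ (tensorFlatten pY B l)))

lemma Canonical.collect {ι : Type} {X : ι → E} {M₀ : E} (p₀ : Pres X M₀) {A : T → E}
    (pA : ∀ t, Pres X (A t)) {Y : (Σ t, J t) → E} (pY : ∀ x, Pres X (Y x)) {W : S → E}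
    (pW : ∀ s, Pres X (W s)) {w : (Σ t, J t) ≃ S} {y : ∀ x, Y x ⟶ W (w x)}
    (h : ∀ x, Canonical (pY x) (pW (w x)) (y x))
    {B : ∀ t, List (J t)} (hB : ∀ t, IsEnum (B t)) {l : List T}
    (hl : IsEnum l) {m : List S} (hm : IsEnum m) :
    Canonical (p₀.tensor (.list (fun t => (pA t).tensor (.list (fun j => pY ⟨t, j⟩) (B t))) l))
      ((p₀.tensor (.list pA l)).tensor (.list pW m)) (collect M₀ A Y W w y hB hl hm) :=
  (assemble p₀ pA pY B l).comp (whiskerLeft _ (tensorEquiv h _ _))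

/-- The family consisting of an object `M₀`, the objects `A t` and the objects `W s`. -/
def gather (M₀ : E) (A : T → E) (W : S → E) : Option (T ⊕ S) → E
  | none => M₀
  | some (.inl t) => A t
  | some (.inr s) => W s

/-- The factors of `(M₀ ⊗ ⨂ₜ A t) ⊗ ⨂ₛ W s`. -/
abbrev gatherPres (M₀ : E) (A : T → E) (W : S → E) (l : List T) (m : List S) :
    Pres (gather M₀ A W) ((M₀ ⊗ tensorList A l) ⊗ tensorList W m) :=
  ((Pres.single (X := gather M₀ A W) none (𝟙 M₀)).tensor
    (.list (fun t => .single (X := gather M₀ A W) (some (.inl t)) (𝟙 (A t))) l)).tensor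
    (.list (fun s => .single (X := gather M₀ A W) (some (.inr s)) (𝟙 (W s))) m)

lemma Canonical.eq_of_gather {M₀ : E} {A : T → E} {W : S → E} {l : List T} {m : List S} {Z : E}
    {p : Pres (gather M₀ A W) Z} {f g : Z ⟶ (M₀ ⊗ tensorList A l) ⊗ tensorList W m}
    (hf : Canonical p (gatherPres M₀ A W l m) f) (hg : Canonical p (gatherPres M₀ A W l m) g)
    (hl : IsEnum l) (hm : IsEnum m) : f = g := by
  have h0 : IsIso (Pres.single (X := gather M₀ A W) none (𝟙 M₀)).hom :=
    inferInstanceAs (IsIso (𝟙 M₀ ≫ (ρ_ M₀).inv))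
  have h1 : ∀ t, IsIso (Pres.single (X := gather M₀ A W) (some (.inl t)) (𝟙 (A t))).hom :=
    fun t => inferInstanceAs (IsIso (𝟙 (A t) ≫ (ρ_ (A t)).inv))
  have h2 : ∀ s, IsIso (Pres.single (X := gather M₀ A W) (some (.inr s)) (𝟙 (W s))).hom :=
    fun s => inferInstanceAs (IsIso (𝟙 (W s) ≫ (ρ_ (W s)).inv))
  refine hf.eq hg ?_
  have key : (gatherPres M₀ A W l m).l =
      ([none] ++ l.map fun t => some (Sum.inl t)) ++ m.map fun s => some (Sum.inr s) :=
    congrArg₂ (· ++ ·) (congrArg ([none] ++ ·) (Pres.list_single_l _ _ l))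
      (Pres.list_single_l _ _ m)
  rw [key]
  refine List.Nodup.append (List.Nodup.append (List.nodup_singleton _) (hl.nodup.map ?_) ?_)
    (hm.nodup.map ?_) ?_
  · exact (Option.some_injective _).comp Sum.inl_injective
  · simp
  · exact (Option.some_injective _).comp Sum.inr_injective
  · intro x hx hx'
    simp only [List.mem_append, List.mem_map, List.mem_singleton] at hx hx'
    obtain ⟨s, -, rfl⟩ := hx'
    rcases hx with hx | ⟨t, -, ht⟩
    · cases hx
    · cases ht

/-- Naturality of `collect`. -/
lemma tensor_collect {M₀ M₀' : E} (m₀ : M₀ ⟶ M₀') {A : T → E} {A' : T' → E} (b : T ≃ T')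
    (α : ∀ t, A t ⟶ A' (b t)) {Y : (Σ t, J t) → E} {Y' : (Σ t, J' t) → E}
    (β : ∀ t, J t ≃ J' (b t)) (y : ∀ t j, Y ⟨t, j⟩ ⟶ Y' ⟨b t, β t j⟩) {W : S → E}
    (w : (Σ t, J' t) ≃ S) (y' : ∀ x, Y' x ⟶ W (w x))
    {B : ∀ t, List (J t)} (hB : ∀ t, IsEnum (B t)) {B' : ∀ t, List (J' t)}
    (hB' : ∀ t, IsEnum (B' t)) {l : List T} (hl : IsEnum l) {l' : List T'} (hl' : IsEnum l')
    {m : List S} (hm : IsEnum m) :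
    (m₀ ⊗ₘ tensorEquiv (X := fun t => A' t ⊗ tensorList (fun j => Y' ⟨t, j⟩) (B' t)) b
        (fun t => α t ⊗ₘ tensorEquiv (X := fun j => Y' ⟨b t, j⟩) (β t) (y t) (hB t) (hB' (b t)))
        hl hl') ≫ collect M₀' A' Y' W w y' hB' hl' hm =
      collect M₀ A Y W ((Equiv.sigmaCongr b β).trans w) (fun x => y x.1 x.2 ≫ y' _) hB hl hm ≫
        ((m₀ ⊗ₘ tensorEquiv b α hl hl') ▷ _) := by
  let X := gather M₀' A' W
  let p₀ : Pres X M₀ := .single none m₀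
  let p₀' : Pres X M₀' := .single none (𝟙 M₀')
  let pA : ∀ t, Pres X (A t) := fun t => .single (some (Sum.inl (b t))) (α t)
  let pA' : ∀ t, Pres X (A' t) := fun t => .single (some (Sum.inl t)) (𝟙 (A' t))
  let pY : ∀ x, Pres X (Y x) := fun x =>
    .single (some (Sum.inr (w ⟨b x.1, β x.1 x.2⟩))) (y x.1 x.2 ≫ y' _)
  let pY' : ∀ x, Pres X (Y' x) := fun x => .single (some (Sum.inr (w x))) (y' x)
  let pW : ∀ s, Pres X (W s) := fun s => .single (some (Sum.inr s)) (𝟙 (W s))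
  have e₀ : Canonical p₀ p₀' m₀ := .single (Category.comp_id _)
  have eA : ∀ t, Canonical (pA t) (pA' (b t)) (α t) := fun t => .single (Category.comp_id _)
  refine Canonical.eq_of_gather (p := p₀.tensor (.list (fun t => (pA t).tensor
    (.list (fun j => pY ⟨t, j⟩) (B t))) l)) ?_ ?_ hl' hm
  · refine Canonical.comp (q := p₀'.tensor (.list (fun t => (pA' t).tensor
      (.list (fun j => pY' ⟨t, j⟩) (B' t))) l')) ?_ ?_
    · refine e₀.tensor (.tensorEquiv (q := fun t => (pA' t).tensor
        (.list (fun j => pY' ⟨t, j⟩) (B' t))) (fun t => (eA t).tensor ?_) hl hl')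
      exact .tensorEquiv (p := fun j => pY ⟨t, j⟩) (q := fun j => pY' ⟨b t, j⟩) (e := β t)
        (z := y t) (fun j => .single rfl) _ _
    · exact .collect p₀' pA' pY' pW (fun x => .single (Category.comp_id _)) hB' hl' hm
  · refine Canonical.comp (q := (p₀.tensor (.list pA l)).tensor (.list pW m)) ?_ ?_
    · exact .collect p₀ pA pY pW (fun x => .single (Category.comp_id _)) hB hl hm
    · exact .whiskerRight _ (e₀.tensor (.tensorEquiv eA hl hl'))

/-- Naturality of `collect` with respect to the factors. -/
lemma tensor_collect_of_map {M₀ M₀' : E} (m₀ : M₀ ⟶ M₀') {A A' : T → E}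
    (α : ∀ t, A t ⟶ A' t) {Y Y' : (Σ t, J t) → E} (y : ∀ x, Y x ⟶ Y' x) {W : S → E}
    (w : (Σ t, J t) ≃ S) (y' : ∀ x, Y' x ⟶ W (w x))
    {B : ∀ t, List (J t)} (hB : ∀ t, IsEnum (B t)) {l : List T} (hl : IsEnum l)
    {m : List S} (hm : IsEnum m) :
    (m₀ ⊗ₘ tensorListMap (fun t => α t ⊗ₘ tensorListMap (fun j => y ⟨t, j⟩) (B t)) l) ≫
        collect M₀' A' Y' W w y' hB hl hm =
      collect M₀ A Y W w (fun x => y x ≫ y' x) hB hl hm ≫ ((m₀ ⊗ₘ tensorListMap α l) ▷ _) := by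
  let X := gather M₀' A' W
  let p₀ : Pres X M₀ := .single none m₀
  let p₀' : Pres X M₀' := .single none (𝟙 M₀')
  let pA : ∀ t, Pres X (A t) := fun t => .single (some (Sum.inl t)) (α t)
  let pA' : ∀ t, Pres X (A' t) := fun t => .single (some (Sum.inl t)) (𝟙 (A' t))
  let pY : ∀ x, Pres X (Y x) := fun x => .single (some (Sum.inr (w x))) (y x ≫ y' x)
  let pY' : ∀ x, Pres X (Y' x) := fun x => .single (some (Sum.inr (w x))) (y' x)
  let pW : ∀ s, Pres X (W s) := fun s => .single (some (Sum.inr s)) (𝟙 (W s))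
  have e₀ : Canonical p₀ p₀' m₀ := .single (Category.comp_id _)
  have eA : ∀ t, Canonical (pA t) (pA' t) (α t) := fun t => .single (Category.comp_id _)
  refine Canonical.eq_of_gather (p := p₀.tensor (.list (fun t => (pA t).tensor
    (.list (fun j => pY ⟨t, j⟩) (B t))) l)) ?_ ?_ hl hm
  · exact (e₀.tensor (.tensorListMap (q := fun t => (pA' t).tensor
      (.list (fun j => pY' ⟨t, j⟩) (B t))) (fun t => (eA t).tensor
        (.tensorListMap (p := fun j => pY ⟨t, j⟩) (q := fun j => pY' ⟨t, j⟩)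
          (f := fun j => y ⟨t, j⟩) (fun j => .single rfl) (B t))) l)).comp
      (.collect p₀' pA' pY' pW (fun x => .single (Category.comp_id _)) hB hl hm)
  · exact (Canonical.collect p₀ pA pY pW (fun x => .single (Category.comp_id _)) hB hl hm).comp
      (.whiskerRight _ (e₀.tensor (.tensorListMap eA l)))

lemma collect_comp (M₀ : E) (A : T → E) {S' : Type} (Y : (Σ t, J t) → E) {W : S → E} {W' : S' → E}
    (w : (Σ t, J t) ≃ S) (y : ∀ x, Y x ⟶ W (w x)) (a : S ≃ S') (z : ∀ s, W s ⟶ W' (a s))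
    {B : ∀ t, List (J t)} (hB : ∀ t, IsEnum (B t)) {l : List T} (hl : IsEnum l)
    {m : List S} (hm : IsEnum m) {m' : List S'} (hm' : IsEnum m') :
    collect M₀ A Y W w y hB hl hm ≫ (_ ◁ tensorEquiv a z hm hm') =
      collect M₀ A Y W' (w.trans a) (fun x => y x ≫ z (w x)) hB hl hm' := by
  unfold collect
  rw [Category.assoc, ← MonoidalCategory.whiskerLeft_comp, tensorEquiv_comp]

/-- Collecting the factors of a threefold tensor product in two different orders. -/
lemma collect_collect (M₀ : E) (A : T → E) {S₁ : Type} {H : (Σ t, J t) → Type} {F : T → Type}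
    {L : S₁ → Type} (Z : (Σ t, J t) → E) (Z' : S₁ → E) (V : E)
    (w₁ : (Σ t, J t) ≃ S₁) (z : ∀ x, Z x ⟶ Z' (w₁ x)) (η : ∀ x, H x ≃ L (w₁ x))
    (w : ∀ t, (Σ j, H ⟨t, j⟩) ≃ F t) (w₀ : (Σ t, F t) ≃ S) (w₂ : (Σ c, L c) ≃ S)
    (hw : ∀ t j h, w₀ ⟨t, w t ⟨j, h⟩⟩ = w₂ ⟨w₁ ⟨t, j⟩, η ⟨t, j⟩ h⟩)
    {B : ∀ t, List (J t)} (hB : ∀ t, IsEnum (B t)) {D : ∀ x, List (H x)} (hD : ∀ x, IsEnum (D x))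
    {F' : ∀ t, List (F t)} (hF : ∀ t, IsEnum (F' t)) {L' : ∀ c, List (L c)}
    (hL : ∀ c, IsEnum (L' c)) {l : List T} (hl : IsEnum l) {m₁ : List S₁} (hm₁ : IsEnum m₁)
    {m : List S} (hm : IsEnum m) :
    (M₀ ◁ tensorListMap (fun t => collect (A t) (fun j => Z ⟨t, j⟩) (fun _ => V) (fun _ => V)
        (w t) (fun _ => 𝟙 V) (fun j => hD ⟨t, j⟩) (hB t) (hF t)) l) ≫
      collect M₀ (fun t => A t ⊗ tensorList (fun j => Z ⟨t, j⟩) (B t)) (fun _ => V) (fun _ => V)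
        w₀ (fun _ => 𝟙 V) hF hl hm ≫ (collect M₀ A Z Z' w₁ z hB hl hm₁ ▷ _) =
    collect M₀ A (fun x => Z x ⊗ tensorList (fun _ => V) (D x))
        (fun c => Z' c ⊗ tensorList (fun _ => V) (L' c)) w₁
        (fun x => z x ⊗ₘ tensorEquiv (X := fun _ => V) (η x) (fun _ => 𝟙 V) (hD x) (hL _))
        hB hl hm₁ ≫
      collect (M₀ ⊗ tensorList A l) Z' (fun _ => V) (fun _ => V) w₂ (fun _ => 𝟙 V) hL hm₁ hm := by
  let X : Option (T ⊕ (S₁ ⊕ S)) → E := fun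
    | none => M₀
    | some (.inl t) => A t
    | some (.inr (.inl c)) => Z' c
    | some (.inr (.inr _)) => V
  let p₀ : Pres X M₀ := .single none (𝟙 M₀)
  let pA : ∀ t, Pres X (A t) := fun t => .single (some (Sum.inl t)) (𝟙 (A t))
  let pZ : ∀ x, Pres X (Z x) := fun x => .single (some (Sum.inr (Sum.inl (w₁ x)))) (z x)
  let pZ' : ∀ c, Pres X (Z' c) := fun c => .single (some (Sum.inr (Sum.inl c))) (𝟙 (Z' c))
  let pV : S → Pres X V := fun s => .single (some (Sum.inr (Sum.inr s))) (𝟙 V)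
  let pW : ∀ t, F t → Pres X V := fun t j => pV (w₀ ⟨t, j⟩)
  let pH : ∀ x, H x → Pres X V := fun x h => pV (w₂ ⟨w₁ x, η x h⟩)
  let pL : ∀ c, L c → Pres X V := fun c h => pV (w₂ ⟨c, h⟩)
  let q : Pres X (((M₀ ⊗ tensorList A l) ⊗ tensorList Z' m₁) ⊗ tensorList (fun _ => V) m) :=
    ((p₀.tensor (.list pA l)).tensor (.list pZ' m₁)).tensor (.list pV m)
  have h₀ : IsIso p₀.hom := inferInstanceAs (IsIso (𝟙 M₀ ≫ (ρ_ M₀).inv))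
  have hA : ∀ t, IsIso (pA t).hom := fun t => inferInstanceAs (IsIso (𝟙 (A t) ≫ (ρ_ (A t)).inv))
  have hZ' : ∀ c, IsIso (pZ' c).hom := fun c => inferInstanceAs (IsIso (𝟙 (Z' c) ≫ (ρ_ (Z' c)).inv))
  have hV : ∀ s, IsIso (pV s).hom := fun s => inferInstanceAs (IsIso (𝟙 V ≫ (ρ_ V).inv))
  have hq : IsIso q.hom := inferInstanceAs (IsIso (Pres.tensor _ _).hom)
  have hnd : q.l.Nodup := by
    have key : q.l = ([none] ++ l.map (fun t => some (Sum.inl t)) ++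
        m₁.map fun c => some (Sum.inr (Sum.inl c))) ++ m.map fun s => some (Sum.inr (Sum.inr s)) :=
      congrArg₂ (· ++ ·) (congrArg₂ (· ++ ·) (congrArg ([none] ++ ·) (Pres.list_single_l _ _ l))
        (Pres.list_single_l _ _ m₁)) (Pres.list_single_l _ _ m)
    rw [key]
    refine List.Nodup.append (List.Nodup.append (List.Nodup.append (List.nodup_singleton _)
      (hl.nodup.map ?_) ?_) (hm₁.nodup.map ?_) ?_) (hm.nodup.map ?_) ?_
    · exact (Option.some_injective _).comp Sum.inl_injective
    · simp
    · exact (Option.some_injective _).comp (Sum.inr_injective.comp Sum.inl_injective)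
    · intro x hx hx'
      simp only [List.mem_append, List.mem_map, List.mem_singleton] at hx hx'
      obtain ⟨s, -, rfl⟩ := hx'
      simp at hx
    · exact (Option.some_injective _).comp (Sum.inr_injective.comp Sum.inr_injective)
    · intro x hx hx'
      simp only [List.mem_append, List.mem_map, List.mem_singleton] at hx hx'
      obtain ⟨s, -, rfl⟩ := hx'
      simp at hx
  refine Canonical.eq (p := p₀.tensor (.list (fun t => (pA t).tensor (.list (fun j =>
    (pZ ⟨t, j⟩).tensor (.list (pH ⟨t, j⟩) (D ⟨t, j⟩))) (B t))) l)) (q := q) ?_ ?_ hnd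
  · refine (Canonical.whiskerLeft p₀ (.tensorListMap (q := fun t => ((pA t).tensor
      (.list (fun j => pZ ⟨t, j⟩) (B t))).tensor (.list (pW t) (F' t))) (fun t => ?_) l)).comp
      ((Canonical.collect (Y := fun x => V) p₀ (fun t => (pA t).tensor
        (.list (fun j => pZ ⟨t, j⟩) (B t))) (fun x => pW x.1 x.2) pV (fun x => .id _) hF hl hm).comp
        (.whiskerRight _ (.collect p₀ pA pZ pZ' (fun x => .single (Category.comp_id _)) hB hl hm₁)))
    refine .collect (J := fun j => H ⟨t, j⟩) (Y := fun _ => V) (pA t)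
      (fun j => pZ ⟨t, j⟩) (fun x => pH ⟨t, x.1⟩ x.2) (pW t) ?_ _ _ _
    rintro ⟨j, h⟩
    change Canonical (pV (w₂ _)) (pV (w₀ _)) _
    rw [hw]
    exact .id _
  · refine (Canonical.collect p₀ pA (fun x => (pZ x).tensor (.list (pH x) (D x)))
      (fun c => (pZ' c).tensor (.list (pL c) (L' c))) ?_ hB hl hm₁).comp
      (.collect (p₀.tensor (.list pA l)) pZ' (fun x => pL x.1 x.2) pV (fun x => .id _) hL hm₁ hm)
    intro x
    exact .tensor (.single (Category.comp_id _))
      (.tensorEquiv (p := pH x) (q := pL (w₁ x)) (fun h => .id _) _ _)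

end Collect

/-! ### Comparison of `(M ∘ N)(V)` with `M(N(V))` -/

namespace SymMod

variable {E : Type u} [Category.{v} E] [MonoidalCategory E] [SymmetricCategory E]
  [HasColimitsOfSize.{0, 0} E] (M N : SymMod E) (V : E)
  {T T' S S' : Type} [Finite T] [Finite T'] [Finite S] [Finite S']

section Double

variable {J : T → Type} [∀ t, Finite (J t)] {J' : T' → Type} [∀ t, Finite (J' t)]

/-- The inclusion `M(T) ⊗ ⨂ₜ (N(J t) ⊗ ⨂ⱼ V) ⟶ M(N(V))`. -/
def incDouble {B : ∀ t, List (J t)} (hB : ∀ t, IsEnum (B t)) {l : List T} (hl : IsEnum l) :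
    M.obj T ⊗ tensorList (fun t => N.obj (J t) ⊗ tensorList (fun _ => V) (B t)) l ⟶
      M.schur.obj (N.schur.obj V) :=
  (M.obj T ◁ tensorListMap (fun t => N.incSchur V (hB t)) l) ≫ M.incSchur _ hl

lemma map_incDouble (b : T ≃ T') (β : ∀ t, J t ≃ J' (b t)) {B : ∀ t, List (J t)}
    (hB : ∀ t, IsEnum (B t)) {B' : ∀ t, List (J' t)} (hB' : ∀ t, IsEnum (B' t))
    {l : List T} (hl : IsEnum l) {l' : List T'} (hl' : IsEnum l') :
    (M.map b ⊗ₘ tensorEquiv (X := fun t => N.obj (J' t) ⊗ tensorList (fun _ => V) (B' t)) b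
        (fun t => N.map (β t) ⊗ₘ tensorEquiv (X := fun _ => V) (β t) (fun _ => 𝟙 V) (hB t)
          (hB' (b t))) hl hl') ≫ M.incDouble N V hB' hl' = M.incDouble N V hB hl := by
  unfold incDouble
  rw [← id_tensorHom, tensorHom_comp_tensorHom_assoc, Category.comp_id,
    tensorEquiv_comp_listMap]
  refine (M.map_incSchur (N.schur.obj V) b _ hl hl').trans ?_
  congr 3
  funext t
  refine (N.map_incSchur V (β t) (fun _ => 𝟙 V) (hB t) (hB' (b t))).trans ?_
  rw [tensorListMap_id, MonoidalCategory.whiskerLeft_id, Category.id_comp]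

end Double

variable {V} in
/-- The comparison of `(M ∘ N)(V)` with `M(N(V))`, on the summand of a map `f : S → T`. -/
def psiAux (V : E) (f : S → T) {l : List T} (hl : IsEnum l) {m : List S} (hm : IsEnum m) :
    (M.obj T ⊗ tensorList (fun t => N.obj {s // f s = t}) l) ⊗ tensorList (fun _ => V) m ⟶
      M.schur.obj (N.schur.obj V) :=
  inv (collect (M.obj T) (fun t => N.obj {s // f s = t}) (fun _ => V) (fun _ => V)
    (Equiv.sigmaFiberEquiv f) (fun _ => 𝟙 V) (fun t => isEnum_enum {s // f s = t}) hl hm) ≫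
    M.incDouble N V (fun t => isEnum_enum {s // f s = t}) hl

lemma collect_psiAux {J : T → Type} [∀ t, Finite (J t)] (f : S → T') (b : T ≃ T')
    (β : ∀ t, J t ≃ {s // f s = b t}) {B : ∀ t, List (J t)} (hB : ∀ t, IsEnum (B t))
    {l : List T} (hl : IsEnum l) {l' : List T'} (hl' : IsEnum l') {m : List S} (hm : IsEnum m)
    (w : (Σ t, J t) ≃ S) (hw : ∀ x, w x = (β x.1 x.2).1) :
    collect (M.obj T) (fun t => N.obj (J t)) (fun _ => V) (fun _ => V) w (fun _ => 𝟙 V) hB hl hm ≫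
        ((M.map b ⊗ₘ tensorEquiv (X := fun t => N.obj {s // f s = t}) b (fun t => N.map (β t)) hl
          hl') ▷ _) ≫ M.psiAux N V f hl' hm = M.incDouble N V hB hl := by
  obtain rfl : w = (Equiv.sigmaCongr b β).trans (Equiv.sigmaFiberEquiv f) := Equiv.ext hw
  have h := tensor_collect (M.map b) b (fun t => N.map (β t)) (A' := fun t => N.obj {s // f s = t})
    (Y := fun _ => V) (Y' := fun _ => V) β (fun _ _ => 𝟙 V) (W := fun _ => V)
    (Equiv.sigmaFiberEquiv f) (fun _ => 𝟙 V) hB (fun t => isEnum_enum {s // f s = t}) hl hl' hm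
  simp only [Category.comp_id] at h
  have h' := M.map_incDouble N V b β hB (fun t => isEnum_enum {s // f s = t}) hl hl'
  rw [psiAux, ← reassoc_of% h, IsIso.hom_inv_id_assoc]
  exact h'

lemma map_psiAux (b : T ≃ T') (a : S ≃ S') {f : S → T} {f' : S' → T'}
    (β : ∀ t, {s // f s = t} ≃ {s // f' s = b t}) (h : ∀ t s, (β t s).1 = a s.1)
    {l : List T} (hl : IsEnum l) {l' : List T'} (hl' : IsEnum l') {m : List S} (hm : IsEnum m)
    {m' : List S'} (hm' : IsEnum m') :
    ((M.map b ⊗ₘ tensorEquiv (X := fun t => N.obj {s // f' s = t}) b (fun t => N.map (β t)) hl hl')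
        ⊗ₘ tensorEquiv (X := fun _ => V) a (fun _ => 𝟙 V) hm hm') ≫ M.psiAux N V f' hl' hm' =
      M.psiAux N V f hl hm := by
  have h1 := M.collect_psiAux N V f' b β (fun t => isEnum_enum {s // f s = t}) hl hl' hm'
    ((Equiv.sigmaFiberEquiv f).trans a) (fun x => (h x.1 x.2).symm)
  have h2 := collect_comp (M.obj T) (fun t => N.obj {s // f s = t}) (fun _ => V)
    (Equiv.sigmaFiberEquiv f) (fun _ => 𝟙 V) a (fun _ => 𝟙 V)
    (fun t => isEnum_enum {s // f s = t}) hl hm hm' (W := fun _ => V) (W' := fun _ => V)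
  simp only [Category.comp_id] at h2
  rw [← h2, Category.assoc, ← MonoidalCategory.tensorHom_def'_assoc] at h1
  exact (IsIso.inv_hom_id_assoc _ _).symm.trans (congrArg (inv _ ≫ ·) h1)

end SymMod

namespace SymMod

variable {E : Type u} [Category.{v} E] [MonoidalCategory E] [SymmetricCategory E]
  [HasColimitsOfSize.{0, 0} E] (M N : SymMod E) (V : E)
  {T T' S S' : Type} [Finite T] [Finite T'] [Finite S] [Finite S']

section Psi

variable [∀ X : E, PreservesColimitsOfSize.{0, 0} (tensorRight X)]

lemma exists_psi : ∃ ψ : (M.comp N).schur.obj V ⟶ M.schur.obj (N.schur.obj V),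
    ∀ (n k : ℕ) (f : Fin n → Fin k), (M.incComp N f (.finRange k) ▷ _) ≫
      (M.comp N).incSchur V (.finRange n) ≫ ψ = M.psiAux N V f (.finRange k) (.finRange n) := by
  have h1 : ∀ n : ℕ, ∃ d : (M.comp N).obj (Fin n) ⊗ tensorList (fun _ => V) (List.finRange n) ⟶
      M.schur.obj (N.schur.obj V), ∀ (k : ℕ) (f : Fin n → Fin k),
        (M.incComp N f (.finRange k) ▷ _) ≫ d = M.psiAux N V f (.finRange k) (.finRange n) := by
    intro n
    obtain ⟨d, hd⟩ := exists_map_coinv_desc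
      (tensorRight (tensorList (fun _ : Fin n => V) (List.finRange n))) (M := M)
      (F := .fibres N (Fin n)) (fun k f => M.psiAux N V f (.finRange k) (.finRange n)) (by
        intro k f σ r
        have h := M.map_psiAux N V σ (Equiv.refl (Fin n)) (f := f) (f' := fun s => σ (f s))
          (fun t => fibreEquiv (Equiv.refl _) (fun s => by simp)) (fun _ _ => rfl)
          (.finRange k) (.finRange k) (.finRange n) (.finRange n)
        refine Eq.trans (congrArg (· ≫ _) ?_) h
        refine (tensorHom_id _ _).symm.trans (congrArg₂ (· ⊗ₘ ·) ?_ (tensorEquiv_refl _ _).symm)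
        exact congrArg (_ ⊗ₘ ·) 
          (reindex_reordering_eq_tensorEquiv σ _ (.finRange k) (.finRange k) r))
    refine ⟨d, fun k f => ?_⟩
    rw [incComp_fin]
    exact hd k f
  choose d hd using h1
  refine ⟨(M.comp N).coinvDesc (.const V) (fun n _ => d n) ?_, fun n k f => ?_⟩
  · rintro n ⟨⟩ σ r
    refine map_coinv_hom_ext (tensorRight (tensorList (fun _ : Fin n => V) (List.finRange n))) ?_
    intro k f
    have h := M.map_psiAux N V (Equiv.refl _) σ (f := f) (f' := fun s => f (σ.symm s))
      (fun t => fibreEquiv σ (fun s => by simp)) (fun _ _ => rfl)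
      (.finRange k) (.finRange k) (.finRange n) (.finRange n)
    have h' := M.map_incComp N (Equiv.refl _) σ (f := f) (f' := fun s => f (σ.symm s))
      (fun t => fibreEquiv σ (fun s => by simp)) (fun _ _ => rfl) (.finRange k) (.finRange k)
    have step : ∀ {A B C D D' Z : E} (x : A ⟶ B) (y : B ⟶ C) (t t' : D ⟶ D') (d : C ⊗ D' ⟶ Z)
        (_ : t = t'), x ▷ D ≫ (y ⊗ₘ t) ≫ d = ((x ≫ y) ⊗ₘ t') ≫ d := by
      rintro A B C D D' Z x y t _ d rfl
      rw [← tensorHom_id, tensorHom_comp_tensorHom_assoc, Category.id_comp]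
    have h2 := hd n k f
    rw [← h, ← hd n k, ← tensorHom_id (M.incComp N (fun s => f (σ.symm s)) (.finRange k)),
      tensorHom_comp_tensorHom_assoc, Category.comp_id, h'] at h2
    rw [incComp_fin] at h2
    exact (step (M.inc (.fibres N (Fin n)) f) ((M.comp N).map σ) _ _ (d n)
      (reindex_reordering_eq_tensorEquiv σ _ (.finRange n) (.finRange n) r)).trans h2.symm
  · rw [incSchur_fin]
    refine Eq.trans (congrArg (_ ≫ ·) ?_) (hd n k f)
    exact (M.comp N).inc_coinvDesc (.const V) _ _ ()

/-- The canonical map `(M ∘ N)(V) ⟶ M(N(V))`. -/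
def psi : (M.comp N).schur.obj V ⟶ M.schur.obj (N.schur.obj V) := (M.exists_psi N V).choose

lemma incSchur_psi (f : S → T) {l : List T} (hl : IsEnum l) {m : List S} (hm : IsEnum m) :
    (M.incComp N f hl ▷ _) ≫ (M.comp N).incSchur V hm ≫ M.psi N V = M.psiAux N V f hl hm := by
  let b := Finite.equivFin T
  let a := Finite.equivFin S
  let β (t : T) : {s // f s = t} ≃ {s // b (f (a.symm s)) = b t} :=
    fibreEquiv a (fun s => by simp)
  have h1 := M.map_psiAux N V b a β (fun _ _ => rfl) hl (.finRange _) hm (.finRange _)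
  have h2 := (M.exists_psi N V).choose_spec _ _ (fun s => b (f (a.symm s)))
  have h3 := M.map_incComp N b a β (fun _ _ => rfl) hl (.finRange _)
  have h4 := (M.comp N).map_incSchur V a (fun _ => 𝟙 V) hm (.finRange _)
  rw [tensorListMap_id, MonoidalCategory.whiskerLeft_id, Category.id_comp] at h4
  rw [← h1, ← h2, ← tensorHom_id, ← tensorHom_id, tensorHom_comp_tensorHom_assoc, h3,
    Category.comp_id, ← h4, Category.assoc, tensorHom_comp_tensorHom_assoc, Category.id_comp]
  rfl

/-- The inclusion of the summand `M(T) ⊗ ⨂ₜ (N(J t) ⊗ ⨂ⱼ V)` into `(M ∘ N)(V)`, and the comparison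
map. -/
lemma collect_incSchur_psi {J : T → Type} [∀ t, Finite (J t)] (f : S → T)
    (β : ∀ t, J t ≃ {s // f s = t}) {B : ∀ t, List (J t)} (hB : ∀ t, IsEnum (B t))
    {l : List T} (hl : IsEnum l) {m : List S} (hm : IsEnum m)
    (w : (Σ t, J t) ≃ S) (hw : ∀ x, w x = (β x.1 x.2).1) :
    collect (M.obj T) (fun t => N.obj (J t)) (fun _ => V) (fun _ => V) w (fun _ => 𝟙 V) hB hl hm ≫
      (((M.obj T ◁ tensorListMap (fun t => N.map (β t)) l) ≫ M.incComp N f hl) ▷ _) ≫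
        (M.comp N).incSchur V hm ≫ M.psi N V = M.incDouble N V hB hl := by
  have h := M.collect_psiAux N V f (Equiv.refl T) β hB hl hl hm w hw
  rw [← M.incSchur_psi, M.map_refl, id_tensorHom] at h
  rw [comp_whiskerRight, Category.assoc, tensorListMap_eq_tensorEquiv _ hl]
  exact h

end Psi

end SymMod

namespace SymMod

variable {E : Type u} [Category.{v} E] [MonoidalCategory E] [SymmetricCategory E]
  [HasColimitsOfSize.{0, 0} E]

lemma schurHom_id (M : SymMod E) (V : E) : schurHom (𝟙 M) V = 𝟙 _ := by
  refine coinv_hom_ext (F := .const V) ?_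
  rintro k ⟨⟩
  refine (M.inc_coinvDesc (.const V) _ (schurHom_compat (𝟙 M) V) ()).trans ?_
  rw [tensorListMap_id]
  refine (congrArg (· ≫ _) (id_tensorHom_id _ _)).trans ?_
  exact (Category.id_comp _).trans (Category.comp_id _).symm

lemma compMap_id (M N : SymMod E) : compMap (𝟙 M) (𝟙 N) = 𝟙 (M.comp N) := by
  apply Hom.ext
  funext S _
  refine coinv_hom_ext (F := .fibres N S) ?_
  intro k f
  refine (M.inc_coinvDesc (.fibres N S) _ (compMap_compat (𝟙 M) (𝟙 N) S) f).trans ?_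
  refine (congrArg (fun t => (_ ⊗ₘ t) ≫ _) (tensorListMap_id _ _)).trans ?_
  refine (congrArg (· ≫ _) (id_tensorHom_id _ _)).trans ?_
  exact (Category.id_comp _).trans (Category.comp_id _).symm

lemma schurHom_naturality {M M' : SymMod E} (φ : M ⟶ M') {V W : E} (g : V ⟶ W) :
    schurHom φ V ≫ M'.schur.map g = M.schur.map g ≫ schurHom φ W := by
  refine coinv_hom_ext (F := .const V) ?_
  rintro k ⟨⟩
  have h1 := M.incSchur_schurHom V φ (.finRange k)
  have h2 := M.incSchur_schurHom W φ (.finRange k)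
  have h3 := M.incSchur_map g (.finRange k)
  have h4 := M'.incSchur_map g (.finRange k)
  simp only [← incSchur_fin]
  refine ((reassoc_of% h1) _).trans (Eq.trans ?_ ((reassoc_of% h3) _).symm)
  rw [h4, h2, whisker_exchange_assoc]

/-! ### Naturality of the comparison map -/

section Flat

variable (M N : SymMod E) (V : E) {T S : Type} [Finite T] [Finite S] {J : T → Type}
  [∀ t, Finite (J t)]

/-- The inclusion `M(T) ⊗ ⨂ₜ (N(J t) ⊗ ⨂ⱼ V) ⟶ (M ∘ N)(V)`, for a map `f : S → T` with fibres
`J t`. -/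
def incFlat (f : S → T) (β : ∀ t, J t ≃ {s // f s = t}) {B : ∀ t, List (J t)}
    (hB : ∀ t, IsEnum (B t)) {l : List T} (hl : IsEnum l) {m : List S} (hm : IsEnum m)
    (w : (Σ t, J t) ≃ S) :
    M.obj T ⊗ tensorList (fun t => N.obj (J t) ⊗ tensorList (fun _ => V) (B t)) l ⟶
      (M.comp N).schur.obj V :=
  collect (M.obj T) (fun t => N.obj (J t)) (fun _ => V) (fun _ => V) w (fun _ => 𝟙 V) hB hl hm ≫
    (((M.obj T ◁ tensorListMap (fun t => N.map (β t)) l) ≫ M.incComp N f hl) ▷ _) ≫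
      (M.comp N).incSchur V hm

lemma incFlat_map {M M' N N' : SymMod E} (φ : M ⟶ M') (φ' : N ⟶ N') {V V' : E} (g : V ⟶ V')
    (f : S → T) (β : ∀ t, J t ≃ {s // f s = t}) {B : ∀ t, List (J t)}
    (hB : ∀ t, IsEnum (B t)) {l : List T} (hl : IsEnum l) {m : List S} (hm : IsEnum m)
    (w : (Σ t, J t) ≃ S) :
    M.incFlat N V f β hB hl hm w ≫ schurHom (compMap φ φ') V ≫ (M'.comp N').schur.map g =
      (φ.app T ⊗ₘ tensorListMap (fun t => φ'.app (J t) ⊗ₘ tensorListMap (fun _ => g) (B t)) l) ≫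
        M'.incFlat N' V' f β hB hl hm w := by
  have h := tensor_collect_of_map (φ.app T) (fun t => φ'.app (J t)) (Y := fun _ => V)
    (Y' := fun _ => V') (fun _ => g) (W := fun _ => V') w (fun _ => 𝟙 V') hB hl hm
  have h' := collect_comp (M.obj T) (fun t => N.obj (J t)) (fun _ => V) (W := fun _ => V)
    (W' := fun _ => V') w (fun _ => 𝟙 V) (Equiv.refl S) (fun _ => g) hB hl hm hm
  have h2 := tensorListMap_eq_tensorEquiv (X := fun _ => V') (Z := fun _ => V) (fun _ => g) hm
  simp only [Category.comp_id, Category.id_comp] at h h'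
  have h5 : collect (M.obj T) (fun t => N.obj (J t)) (fun _ => V) (fun _ => V) w (fun _ => 𝟙 V)
      hB hl hm ≫ (_ ◁ tensorListMap (fun _ => g) m) =
      collect (M.obj T) (fun t => N.obj (J t)) (fun _ => V) (fun _ => V') w (fun _ => g) hB hl hm :=
    (congrArg (fun t => _ ≫ (_ ◁ t)) h2).trans h'
  have key : ((M.obj T ◁ tensorListMap (fun t => N.map (β t)) l) ≫ M.incComp N f hl) ≫
      (compMap φ φ').app S = (φ.app T ⊗ₘ tensorListMap (fun t => φ'.app (J t)) l) ≫
        ((M'.obj T ◁ tensorListMap (fun t => N'.map (β t)) l) ≫ M'.incComp N' f hl) := by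
    rw [Category.assoc, incComp_compMap, ← id_tensorHom, ← id_tensorHom,
      tensorHom_comp_tensorHom_assoc, tensorHom_comp_tensorHom_assoc, tensorListMap_comp,
      tensorListMap_comp, Category.comp_id, Category.id_comp]
    simp only [φ'.naturality]
  have h3 := (M.comp N).incSchur_schurHom V (compMap φ φ') hm
  have h4 := (M'.comp N').incSchur_map g hm
  have step : ∀ {A B C D D' F G H : E} (x : A ⟶ B ⊗ D) (y : B ⟶ C) (y' : C ⟶ F) (z : B ⟶ G)
      (z' : G ⟶ F) (d : D ⟶ D') (i : F ⊗ D' ⟶ H) (_ : y ≫ y' = z ≫ z'),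
      x ≫ (y ▷ D) ≫ (y' ▷ D) ≫ (F ◁ d) ≫ i =
        (x ≫ (B ◁ d)) ≫ (z ▷ D') ≫ (z' ▷ D') ≫ i := by
    intro A B C D D' F G H x y y' z z' d i e
    rw [← comp_whiskerRight_assoc, e, Category.assoc, ← comp_whiskerRight_assoc,
      whisker_exchange_assoc]
  unfold incFlat
  rw [reassoc_of% h, Category.assoc, Category.assoc, reassoc_of% h3, h4]
  exact (step _ _ _ _ _ _ _ key).trans (congrArg (· ≫ _) h5)

lemma incDouble_map {M M' N N' : SymMod E} (φ : M ⟶ M') (φ' : N ⟶ N') {V V' : E} (g : V ⟶ V')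
    {B : ∀ t, List (J t)} (hB : ∀ t, IsEnum (B t)) {l : List T} (hl : IsEnum l) :
    M.incDouble N V hB hl ≫ schurHom φ _ ≫ M'.schur.map (schurHom φ' V ≫ N'.schur.map g) =
      (φ.app T ⊗ₘ tensorListMap (fun t => φ'.app (J t) ⊗ₘ tensorListMap (fun _ => g) (B t)) l) ≫
        M'.incDouble N' V' hB hl := by
  have h1 := M.incSchur_schurHom (N.schur.obj V) φ hl
  have h2 := M'.incSchur_map (schurHom φ' V ≫ N'.schur.map g) hl
  unfold incDouble
  rw [Category.assoc, reassoc_of% h1, h2, ← id_tensorHom, ← id_tensorHom, ← tensorHom_id,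
    ← id_tensorHom, tensorHom_comp_tensorHom_assoc, tensorHom_comp_tensorHom_assoc,
    tensorHom_comp_tensorHom_assoc]
  simp only [Category.comp_id, Category.id_comp]
  rw [tensorListMap_comp, tensorListMap_comp]
  congr 3
  funext t
  have h3 := N.incSchur_schurHom V φ' (hB t)
  have h4 := N'.incSchur_map g (hB t)
  rw [reassoc_of% h3, h4, tensorHom_def_assoc]

variable [∀ X : E, PreservesColimitsOfSize.{0, 0} (tensorRight X)]

/-- The comparison map is determined by the inclusions of the common summands. -/
lemma incFlat_psi (f : S → T) (β : ∀ t, J t ≃ {s // f s = t}) {B : ∀ t, List (J t)}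
    (hB : ∀ t, IsEnum (B t)) {l : List T} (hl : IsEnum l) {m : List S} (hm : IsEnum m)
    (w : (Σ t, J t) ≃ S) (hw : ∀ x, w x = (β x.1 x.2).1) :
    M.incFlat N V f β hB hl hm w ≫ M.psi N V = M.incDouble N V hB hl := by
  unfold incFlat
  rw [Category.assoc, Category.assoc]
  exact M.collect_incSchur_psi N V f β hB hl hm w hw

variable {M N V} in
lemma comp_schur_hom_ext {Z : E} {a b : (M.comp N).schur.obj V ⟶ Z}
    (h : ∀ (n k : ℕ) (f : Fin n → Fin k),
      M.incFlat N V f (fun _ => Equiv.refl _) (fun t => isEnum_enum {s // f s = t})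
        (.finRange k) (.finRange n) (Equiv.sigmaFiberEquiv f) ≫ a =
      M.incFlat N V f (fun _ => Equiv.refl _) (fun t => isEnum_enum {s // f s = t})
        (.finRange k) (.finRange n) (Equiv.sigmaFiberEquiv f) ≫ b) : a = b := by
  refine coinv_hom_ext (F := .const V) ?_
  rintro n ⟨⟩
  refine map_coinv_hom_ext (tensorRight (tensorList (fun _ : Fin n => V) (List.finRange n))) ?_
  intro k f
  have := h n k f
  unfold incFlat at this
  rw [Category.assoc, Category.assoc, Category.assoc, Category.assoc, cancel_epi] at this
  simp only [N.map_refl, tensorListMap_id, MonoidalCategory.whiskerLeft_id, incComp_fin,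
    incSchur_fin] at this
  exact (congrArg (fun t => (t ▷ _) ≫ _) (Category.id_comp _).symm).trans
    (this.trans (congrArg (fun t => (t ▷ _) ≫ _) (Category.id_comp _)))

/-- The comparison map is natural in all its arguments. -/
lemma psi_naturality {M M' N N' : SymMod E} (φ : M ⟶ M') (φ' : N ⟶ N') {V V' : E} (g : V ⟶ V') :
    (schurHom (compMap φ φ') V ≫ (M'.comp N').schur.map g) ≫ M'.psi N' V' =
      M.psi N V ≫ schurHom φ _ ≫ M'.schur.map (schurHom φ' V ≫ N'.schur.map g) := by
  refine comp_schur_hom_ext fun n k f => ?_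
  rw [← Category.assoc, incFlat_map, Category.assoc, incFlat_psi _ _ _ _ _ _ _ _ _ (fun _ => rfl),
    ← incDouble_map, ← incFlat_psi _ _ _ f (fun _ => Equiv.refl _) _ _ (.finRange n)
      (Equiv.sigmaFiberEquiv f) (fun _ => rfl), Category.assoc]

lemma map_psi (M N : SymMod E) {V W : E} (g : V ⟶ W) :
    (M.comp N).schur.map g ≫ M.psi N W = M.psi N V ≫ M.schur.map (N.schur.map g) := by
  have h := psi_naturality (𝟙 M) (𝟙 N) g
  rwa [compMap_id, schurHom_id, schurHom_id, schurHom_id, Category.id_comp, Category.id_comp,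
    Category.id_comp] at h

lemma schurHom_psi {M M' N N' : SymMod E} (φ : M ⟶ M') (φ' : N ⟶ N') (V : E) :
    schurHom (compMap φ φ') V ≫ M'.psi N' V =
      M.psi N V ≫ schurHom φ _ ≫ M'.schur.map (schurHom φ' V) := by
  have h := psi_naturality φ φ' (𝟙 V)
  rwa [CategoryTheory.Functor.map_id, CategoryTheory.Functor.map_id, Category.comp_id,
    Category.comp_id] at h

end Flat

end SymMod

lemma isIso_tensorListMap {E : Type u} [Category.{v} E] [MonoidalCategory E] {ι : Type}
    {X Y : ι → E} (f : ∀ i, X i ⟶ Y i) [∀ i, IsIso (f i)]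
    (l : List ι) : IsIso (tensorListMap f l) := by
  refine ⟨tensorListMap (fun i => inv (f i)) l, ?_, ?_⟩ <;>
  · rw [tensorListMap_comp]
    simp only [IsIso.hom_inv_id, IsIso.inv_hom_id, tensorListMap_id]

section Collect

variable {E : Type u} [Category.{v} E] [MonoidalCategory E] [SymmetricCategory E]
  {T S : Type} {J : T → Type}

lemma whisker_collect (M₀ : E) {A A' : T → E} (α : ∀ t, A t ⟶ A' t) (Y : (Σ t, J t) → E) {W : S → E}
    (w : (Σ t, J t) ≃ S) (y : ∀ x, Y x ⟶ W (w x)) {B : ∀ t, List (J t)} (hB : ∀ t, IsEnum (B t))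
    {l : List T} (hl : IsEnum l) {m : List S} (hm : IsEnum m) :
    (M₀ ◁ tensorListMap (fun t => α t ▷ tensorList (fun j => Y ⟨t, j⟩) (B t)) l) ≫
        collect M₀ A' Y W w y hB hl hm =
      collect M₀ A Y W w y hB hl hm ≫ ((M₀ ◁ tensorListMap α l) ▷ _) := by
  have h := tensor_collect_of_map (𝟙 M₀) α (fun x => 𝟙 (Y x)) w y hB hl hm
  simpa only [tensorListMap_id, tensorHom_id, id_tensorHom, Category.id_comp] using h

lemma whisker_whisker_collect (M₀ : E) (A : T → E) {Y Y' : (Σ t, J t) → E} {W : S → E}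
    (w : (Σ t, J t) ≃ S) (y : ∀ x, Y x ⟶ Y' x) (y' : ∀ x, Y' x ⟶ W (w x)) {B : ∀ t, List (J t)}
    (hB : ∀ t, IsEnum (B t)) {l : List T} (hl : IsEnum l) {m : List S} (hm : IsEnum m) :
    (M₀ ◁ tensorListMap (fun t => A t ◁ tensorListMap (fun j => y ⟨t, j⟩) (B t)) l) ≫
        collect M₀ A Y' W w y' hB hl hm =
      collect M₀ A Y W w (fun x => y x ≫ y' x) hB hl hm := by
  have h := tensor_collect_of_map (𝟙 M₀) (fun t => 𝟙 (A t)) y w y' hB hl hm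
  simpa only [tensorListMap_id, tensorHom_id, id_tensorHom, MonoidalCategory.whiskerLeft_id,
    id_whiskerRight, Category.comp_id] using h

lemma whiskerRight_collect {M₀ M₀' : E} (m₀ : M₀ ⟶ M₀') (A : T → E) (Y : (Σ t, J t) → E) {W : S → E}
    (w : (Σ t, J t) ≃ S) (y : ∀ x, Y x ⟶ W (w x)) {B : ∀ t, List (J t)}
    (hB : ∀ t, IsEnum (B t)) {l : List T} (hl : IsEnum l) {m : List S} (hm : IsEnum m) :
    (m₀ ▷ _) ≫ collect M₀' A Y W w y hB hl hm =
      collect M₀ A Y W w y hB hl hm ≫ ((m₀ ▷ _) ▷ _) := by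
  have h := tensor_collect_of_map m₀ (fun t => 𝟙 (A t)) (fun x => 𝟙 (Y x)) w y hB hl hm
  simpa only [tensorListMap_id, tensorHom_id, id_tensorHom, MonoidalCategory.whiskerLeft_id,
    id_whiskerRight, Category.id_comp] using h

lemma collect_whiskerLeft (M₀ : E) (A : T → E) (Y : (Σ t, J t) → E) {W W' : S → E}
    (w : (Σ t, J t) ≃ S) (y : ∀ x, Y x ⟶ W (w x)) (z : ∀ s, W s ⟶ W' s)
    {B : ∀ t, List (J t)} (hB : ∀ t, IsEnum (B t)) {l : List T} (hl : IsEnum l)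
    {m : List S} (hm : IsEnum m) :
    collect M₀ A Y W w y hB hl hm ≫ (_ ◁ tensorListMap z m) =
      collect M₀ A Y W' w (fun x => y x ≫ z (w x)) hB hl hm :=
  (congrArg (fun t => _ ≫ (_ ◁ t)) (tensorListMap_eq_tensorEquiv z hm)).trans
    (collect_comp M₀ A Y w y (Equiv.refl S) z hB hl hm hm)

end Collect

namespace SymMod

variable {E : Type u} [Category.{v} E] [MonoidalCategory E] [SymmetricCategory E]
  [HasColimitsOfSize.{0, 0} E]

/-! ### The common summands -/

section Blocks

variable (M N : SymMod E) (V : E)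

lemma regroup_eq (b : Blocks) (Y : (Σ i, Fin (b.m i)) → E) (W : Fin b.l → E)
    (w : ∀ x, Y x ⟶ W (b.e x)) :
    regroup M N b Y W w =
      collect (M.obj (Fin b.k)) (fun i => N.obj (Fin (b.m i))) Y W b.e w
        (fun i => .finRange (b.m i)) (.finRange b.k) (.finRange b.l) ≫
      (((M.obj (Fin b.k) ◁ tensorListMap (fun i => N.map (b.blockEquiv i)) _) ≫
        M.incComp N b.block (.finRange b.k)) ▷ _) := by
  have h := reindex_reordering_eq_tensorEquiv b.e w
    ((IsEnum.finRange b.k).sigma fun i => .finRange (b.m i)) (.finRange b.l) b.r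
  have step : ∀ {A B C D D' F G : E} (x : A ⟶ B) (y : B ⟶ C ⊗ D) (z : C ⟶ F) (d : D ⟶ D')
      (d' d'' : D' ⟶ G) (_ : d' = d''),
      x ≫ y ≫ (z ⊗ₘ (d ≫ d')) = (((x ≫ y ≫ (C ◁ d)) ≫ (C ◁ d'')) ≫ (z ▷ G)) := by
    rintro A B C D D' F G x y z d d' _ rfl
    simp only [Category.assoc]
    rw [tensorHom_def', MonoidalCategory.whiskerLeft_comp_assoc]
  rw [incComp_fin]
  exact step _ _ _ _ _ _ h

lemma schurIncLeft_eq (b : Blocks) :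
    schurIncLeft M N V b = M.incFlat N V b.block b.blockEquiv (fun i => .finRange (b.m i))
      (.finRange b.k) (.finRange b.l) b.e := by
  unfold schurIncLeft incFlat
  rw [regroup_eq, incSchur_fin]
  exact Category.assoc _ _ _

lemma schurIncRight_eq (b : Blocks) :
    schurIncRight M N V b = M.incDouble N V (fun i => .finRange (b.m i)) (.finRange b.k) := by
  unfold schurIncRight incDouble
  simp only [incSchur_fin]

instance isIso_map {S T : Type} [Finite S] [Finite T] (e : S ≃ T) : IsIso (M.map e) :=
  ⟨M.map e.symm, by rw [← M.map_trans, Equiv.self_trans_symm, M.map_refl],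
    by rw [← M.map_trans, Equiv.symm_trans_self, M.map_refl]⟩

/-- The blocks given by the fibres of a map. -/
def Blocks.ofMap {n k : ℕ} (f : Fin n → Fin k) : Blocks where
  k := k
  m := fun i => Nat.card {s // f s = i}
  l := n
  e := (Equiv.sigmaCongrRight fun i => (Finite.equivFin {s // f s = i}).symm).trans
    (Equiv.sigmaFiberEquiv f)
  r := .ofPerm (((IsEnum.finRange k).sigma fun _ => .finRange _).map _ |>.perm (.finRange n))

variable {M N V} in
/-- The common summands jointly cover `(M ∘ N)(V)`. -/
lemma schurIncLeft_hom_ext [∀ X : E, PreservesColimitsOfSize.{0, 0} (tensorRight X)] {Z : E}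
    {x y : (M.comp N).schur.obj V ⟶ Z}
    (h : ∀ b : Blocks, schurIncLeft M N V b ≫ x = schurIncLeft M N V b ≫ y) : x = y := by
  refine coinv_hom_ext (F := .const V) ?_
  rintro n ⟨⟩
  refine map_coinv_hom_ext (tensorRight (tensorList (fun _ : Fin n => V) (List.finRange n))) ?_
  intro k f
  have h' := h (Blocks.ofMap f)
  have := isIso_tensorListMap (fun i => N.map ((Blocks.ofMap f).blockEquiv i))
    (List.finRange (Blocks.ofMap f).k)
  rw [schurIncLeft_eq] at h'
  unfold incFlat at h'
  rw [Category.assoc, Category.assoc, Category.assoc, Category.assoc, cancel_epi, comp_whiskerRight,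
    Category.assoc, Category.assoc, cancel_epi, incComp_fin, incSchur_fin] at h'
  exact h'

variable [∀ X : E, PreservesColimitsOfSize.{0, 0} (tensorRight X)]

lemma schurIncLeft_psi (b : Blocks) :
    schurIncLeft M N V b ≫ M.psi N V = schurIncRight M N V b := by
  rw [schurIncLeft_eq, schurIncRight_eq, incFlat_psi _ _ _ _ _ _ _ _ _ (fun _ => rfl)]

end Blocks

section Pentagon

variable (M N P : SymMod E) (V : E) [∀ X : E, PreservesColimitsOfSize.{0, 0} (tensorRight X)]
  {S : Type} [Finite S] (x : CompIdx S)

/-- The isomorphism between the two ways of collecting the factors `V` of a summand of a triple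
composite. -/
def tripleCollect {m : List S} (hm : IsEnum m) :
    M.obj (Fin x.k) ⊗ tensorList (fun i => N.obj (Fin (x.m i)) ⊗ tensorList (fun j =>
      P.obj {t : {s // x.f s = i} // x.g i t = j} ⊗ tensorList (fun _ => V)
        (enum {t : {s // x.f s = i} // x.g i t = j}))
        (List.finRange (x.m i))) (List.finRange x.k) ⟶
      compSummand M N P x ⊗ tensorList (fun _ => V) m :=
  (M.obj (Fin x.k) ◁ tensorListMap (fun i => collect (N.obj (Fin (x.m i)))
    (fun j => P.obj {t : {s // x.f s = i} // x.g i t = j}) (fun _ => V) (fun _ => V)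
      (Equiv.sigmaFiberEquiv (x.g i)) (fun _ => 𝟙 V)
      (fun j => isEnum_enum {t : {s // x.f s = i} // x.g i t = j})
      (.finRange (x.m i)) (isEnum_enum {s // x.f s = i})) (List.finRange x.k)) ≫
    collect (M.obj (Fin x.k)) (fun i => N.obj (Fin (x.m i)) ⊗ tensorList (fun j =>
      P.obj {t : {s // x.f s = i} // x.g i t = j}) (List.finRange (x.m i))) (fun _ => V)
      (fun _ => V) (Equiv.sigmaFiberEquiv x.f) (fun _ => 𝟙 V) 
      (fun i => isEnum_enum {s // x.f s = i}) (.finRange x.k) hm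

instance {m : List S} (hm : IsEnum m) : IsIso (tripleCollect M N P V x hm) := by
  have := fun i => isIso_collect (N.obj (Fin (x.m i)))
    (fun j => P.obj {t : {s // x.f s = i} // x.g i t = j}) (fun _ => V) (fun _ => V)
      (Equiv.sigmaFiberEquiv (x.g i)) (fun _ => 𝟙 V)
      (fun j => isEnum_enum {t : {s // x.f s = i} // x.g i t = j})
      (.finRange (x.m i)) (isEnum_enum {s // x.f s = i})
  have := isIso_tensorListMap (fun i => collect (N.obj (Fin (x.m i)))
    (fun j => P.obj {t : {s // x.f s = i} // x.g i t = j}) (fun _ => V) (fun _ => V)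
      (Equiv.sigmaFiberEquiv (x.g i)) (fun _ => 𝟙 V)
      (fun j => isEnum_enum {t : {s // x.f s = i} // x.g i t = j})
      (.finRange (x.m i)) (isEnum_enum {s // x.f s = i})) (List.finRange x.k)
  unfold tripleCollect
  infer_instance

lemma tripleCollect_right {m : List S} (hm : IsEnum m) :
    tripleCollect M N P V x hm ≫ (compIncRight M N P x ▷ _) ≫ (M.comp (N.comp P)).incSchur V hm ≫
        M.psi (N.comp P) V ≫ M.schur.map (N.psi P V) =
      (M.obj (Fin x.k) ◁ tensorListMap (fun i => N.incDouble P V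
        (fun j => isEnum_enum {t : {s // x.f s = i} // x.g i t = j}) (.finRange (x.m i)))
          (List.finRange x.k)) ≫ M.incSchur _ (.finRange x.k) := by
  have e : compIncRight M N P x = (M.obj (Fin x.k) ◁ tensorListMap (fun i =>
      N.incComp P (x.g i) (.finRange (x.m i))) (List.finRange x.k)) ≫
        M.incComp (N.comp P) x.f (.finRange x.k) := by
    simp only [incComp_fin]
    rfl
  have h1 := whisker_collect (M.obj (Fin x.k)) (fun i => N.incComp P (x.g i) (.finRange (x.m i)))
    (fun _ => V) (W := fun _ => V) (Equiv.sigmaFiberEquiv x.f) (fun _ => 𝟙 V)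
    (fun i => isEnum_enum {s // x.f s = i}) (.finRange x.k) hm
  have h2 := M.incSchur_psi (N.comp P) V x.f (.finRange x.k) hm
  have h3 := M.incSchur_map (N.psi P V) (.finRange x.k)
  rw [e, comp_whiskerRight, Category.assoc, reassoc_of% h2, tripleCollect, Category.assoc,
    ← reassoc_of% h1, psiAux, Category.assoc, IsIso.hom_inv_id_assoc, incDouble, Category.assoc, h3]
  simp only [← Category.assoc, ← MonoidalCategory.whiskerLeft_comp, tensorListMap_comp]
  congr 3
  funext i
  have h4 := N.incSchur_psi P V (x.g i) (.finRange (x.m i)) (isEnum_enum {s // x.f s = i})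
  rw [Category.assoc, Category.assoc, h4, psiAux, IsIso.hom_inv_id_assoc]

lemma tripleCollect_left {m : List S} (hm : IsEnum m) :
    tripleCollect M N P V x hm ≫ (compIncLeft M N P x ▷ _) ≫ ((M.comp N).comp P).incSchur V hm ≫
        (M.comp N).psi P V ≫ M.psi N (P.schur.obj V) =
      (M.obj (Fin x.k) ◁ tensorListMap (fun i => N.incDouble P V
        (fun j => isEnum_enum {t : {s // x.f s = i} // x.g i t = j}) (.finRange (x.m i)))
          (List.finRange x.k)) ≫ M.incSchur _ (.finRange x.k) := by
  have h1 := collect_collect (M.obj (Fin x.k)) (fun i => N.obj (Fin (x.m i)))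
    (fun y => P.obj {t : {s // x.f s = y.1} // x.g y.1 t = y.2})
    (fun c => P.obj {s // x.total s = c}) V x.e (fun y => P.map (x.entryEquiv y)) x.entryEquiv
    (fun i => Equiv.sigmaFiberEquiv (x.g i)) (Equiv.sigmaFiberEquiv x.f)
    (Equiv.sigmaFiberEquiv x.total) (fun _ _ _ => rfl) (fun i => .finRange (x.m i))
    (fun y => isEnum_enum {t : {s // x.f s = y.1} // x.g y.1 t = y.2})
    (fun i => isEnum_enum {s // x.f s = i}) (fun c => isEnum_enum {s // x.total s = c})
    (.finRange x.k)
    (.finRange x.l) hm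
  have h2 := (M.comp N).incSchur_psi P V x.total (.finRange x.l) hm
  have h3 := whiskerRight_collect
    ((M.obj (Fin x.k) ◁ tensorListMap (fun i => N.map (x.blockEquiv i))
    (List.finRange x.k)) ≫ M.incComp N x.block (.finRange x.k))
    (fun c => P.obj {s // x.total s = c}) (fun _ => V) (W := fun _ => V)
    (Equiv.sigmaFiberEquiv x.total) (fun _ => 𝟙 V) (fun c => isEnum_enum {s // x.total s = c})
    (.finRange x.l) hm
  have e : compIncLeft M N P x = (collect (M.obj (Fin x.k)) (fun i => N.obj (Fin (x.m i)))
      (fun y => P.obj {t : {s // x.f s = y.1} // x.g y.1 t = y.2})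
      (fun c => P.obj {s // x.total s = c}) x.e (fun y => P.map (x.entryEquiv y))
      (fun i => .finRange (x.m i)) (.finRange x.k) (.finRange x.l) ≫
      (((M.obj (Fin x.k) ◁ tensorListMap (fun i => N.map (x.blockEquiv i)) _) ≫
        M.incComp N x.block (.finRange x.k)) ▷ _)) ≫
      (M.comp N).incComp P x.total (.finRange x.l) := by
    rw [(M.comp N).incComp_fin P, ← regroup_eq]
    rfl
  have h4 := collect_whiskerLeft (M.obj (Fin x.k)) (fun i => N.obj (Fin (x.m i)))
    (fun y => P.obj {t : {s // x.f s = y.1} // x.g y.1 t = y.2} ⊗ tensorList (fun _ => V)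
      (enum {t : {s // x.f s = y.1} // x.g y.1 t = y.2}))
    (W := fun c => P.obj {s // x.total s = c} ⊗ tensorList (fun _ => V) (enum {s // x.total s = c}))
    (W' := fun _ => P.schur.obj V) x.e
    (fun y => P.map (x.entryEquiv y) ⊗ₘ tensorEquiv (X := fun _ => V) (x.entryEquiv y)
      (fun _ => 𝟙 V) (isEnum_enum _) (isEnum_enum _))
    (fun c => P.incSchur V (isEnum_enum {s // x.total s = c})) (fun i => .finRange (x.m i))
    (.finRange x.k) (.finRange x.l)
  have h5 : ∀ y, (P.map (x.entryEquiv y) ⊗ₘ tensorEquiv (X := fun _ => V) (x.entryEquiv y)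
      (fun _ => 𝟙 V) (isEnum_enum _) (isEnum_enum _)) ≫
        P.incSchur V (isEnum_enum {s // x.total s = x.e y}) =
      P.incSchur V (isEnum_enum {t : {s // x.f s = y.1} // x.g y.1 t = y.2}) := by
    intro y
    rw [map_incSchur, tensorListMap_id, MonoidalCategory.whiskerLeft_id, Category.id_comp]
  have h6 := whisker_whisker_collect (M.obj (Fin x.k)) (fun i => N.obj (Fin (x.m i)))
    (Y' := fun _ => P.schur.obj V) (W := fun _ => P.schur.obj V) x.e
    (fun y => P.incSchur V (isEnum_enum {t : {s // x.f s = y.1} // x.g y.1 t = y.2}))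
    (fun _ => 𝟙 _) (fun i => .finRange (x.m i)) (.finRange x.k) (.finRange x.l)
  have h7 := M.incFlat_psi N (P.schur.obj V) x.block x.blockEquiv (fun i => .finRange (x.m i))
    (.finRange x.k) (.finRange x.l) x.e (fun _ => rfl)
  simp only [h5] at h4
  simp only [Category.comp_id] at h6
  rw [incFlat, Category.assoc, Category.assoc] at h7
  rw [e, comp_whiskerRight, comp_whiskerRight, Category.assoc, Category.assoc, reassoc_of% h2,
    tripleCollect, Category.assoc, reassoc_of% h1, ← reassoc_of% h3, psiAux, Category.assoc,
    IsIso.hom_inv_id_assoc, incDouble, Category.assoc, ← whisker_exchange_assoc, reassoc_of% h4,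
    ← h6, Category.assoc, h7, incDouble]
  simp only [← Category.assoc, ← MonoidalCategory.whiskerLeft_comp, tensorListMap_comp]
  rfl

/-- The comparison maps are compatible with the associativity of the composition product. -/
lemma psi_assoc {m : List S} (hm : IsEnum m) :
    (compIncRight M N P x ▷ _) ≫ (M.comp (N.comp P)).incSchur V hm ≫
        M.psi (N.comp P) V ≫ M.schur.map (N.psi P V) =
      (compIncLeft M N P x ▷ _) ≫ ((M.comp N).comp P).incSchur V hm ≫
        (M.comp N).psi P V ≫ M.psi N (P.schur.obj V) := by
  rw [← cancel_epi (tripleCollect M N P V x hm), tripleCollect_right, tripleCollect_left]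

end Pentagon

end SymMod

/-! ### Compatibility of the comparison maps with units -/

section Collect

variable {E : Type u} [Category.{v} E] [MonoidalCategory E] [SymmetricCategory E]

lemma Canonical.tensorListUnit {ι T : Type} {X : ι → E} {Z : T → E} {p : ∀ t, Pres X (Z t)}
    {f : ∀ t, 𝟙_ E ⟶ Z t} (h : ∀ t, Canonical (.unit X) (p t) (f t)) (l : List T) :
    Canonical (.unit X) (.list p l) (tensorListUnit f l) := by
  induction l with
  | nil => exact id _
  | cons a l ih => exact (leftUnitor (.unit X)).iso_inv.comp ((h a).tensor ih)

lemma tensorListUnit_comp_listMap {E : Type u} [Category.{v} E] [MonoidalCategory E] {T : Type}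
    {X Y : T → E} (f : ∀ t, 𝟙_ E ⟶ X t) (g : ∀ t, X t ⟶ Y t) (l : List T) :
    tensorListUnit f l ≫ tensorListMap g l = tensorListUnit (fun t => f t ≫ g t) l := by
  induction l with
  | nil => exact Category.comp_id _
  | cons a l ih =>
    refine (Category.assoc _ _ _).trans (congrArg (_ ≫ ·) ?_)
    exact (tensorHom_comp_tensorHom _ _ _ _).trans (congrArg (_ ⊗ₘ ·) ih)

lemma whisker_comp_of_eq {E : Type u} [Category.{v} E] [MonoidalCategory E]
    {A B A' A'' I C Y Z V : E} (a : A ⟶ B) (b : B ⟶ I) (c : I ⟶ C) (z : C ⟶ Y)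
    (y : Y ⊗ V ⟶ Z) {a' : A ⊗ V ⟶ A'} {d : A' ⟶ B ⊗ V} {u : A' ⟶ A''} {e : A'' ⟶ I ⊗ V}
    (h : a' ≫ d = a ▷ V) (h' : u ≫ e = d ≫ (b ▷ V)) :
    ((a ≫ b ≫ c ≫ z) ▷ V) ≫ y = a' ≫ u ≫ e ≫ ((c ≫ z) ▷ V) ≫ y := by
  rw [reassoc_of% h']
  simp only [comp_whiskerRight, Category.assoc]
  rw [← h]
  simp only [Category.assoc]

/-- Inserting units and collecting the factors of `A ⊗ ⨂ₛ V`. -/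
lemma unit_collect_left (A V : E) {S : Type} (w : (Σ _ : Fin 1, S) ≃ S) (hw : ∀ x, w x = x.2)
    {m : List S} (hm : IsEnum m) :
    ((ρ_ (A ⊗ tensorList (fun _ => V) m)).inv ≫ (λ_ _).inv) ≫
      collect (𝟙_ E) (fun _ : Fin 1 => A) (fun _ => V) (fun _ => V) w (fun _ => 𝟙 V) (fun _ => hm)
        (.finRange 1) hm =
      ((ρ_ A).inv ≫ (λ_ _).inv) ▷ tensorList (fun _ => V) m := by
  let X : Option S → E := fun
    | none => A
    | some _ => V
  let pA : Pres X A := .single none (𝟙 A)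
  let pV : S → Pres X V := fun s => .single (some s) (𝟙 V)
  let q : Pres X ((𝟙_ E ⊗ (A ⊗ 𝟙_ E)) ⊗ tensorList (fun _ => V) m) :=
    ((Pres.unit X).tensor (pA.tensor (.unit X))).tensor (.list pV m)
  have hA : IsIso pA.hom := inferInstanceAs (IsIso (𝟙 A ≫ (ρ_ A).inv))
  have hV : ∀ s, IsIso (pV s).hom := fun s => inferInstanceAs (IsIso (𝟙 V ≫ (ρ_ V).inv))
  have hq : IsIso q.hom := inferInstanceAs (IsIso (Pres.tensor _ _).hom)
  have hnd : q.l.Nodup := by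
    have key : q.l = [none] ++ m.map some :=
      congrArg ([none] ++ ·) (Pres.list_single_l _ _ m)
    rw [key]
    refine List.Nodup.append (List.nodup_singleton _) (hm.nodup.map (Option.some_injective _)) ?_
    simp
  refine Canonical.eq (p := pA.tensor (.list pV m)) (q := q) ?_ ?_ hnd
  · have h1 : Canonical (pA.tensor (.list pV m)) ((Pres.unit X).tensor
        (.list (fun _ : Fin 1 => pA.tensor (.list pV m)) (List.finRange 1)))
        ((ρ_ _).inv ≫ (λ_ _).inv) :=
      (Canonical.rightUnitor (pA.tensor (.list pV m))).iso_inv.comp (Canonical.leftUnitor _).iso_inv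
    refine h1.comp ?_
    refine .collect (J := fun _ => S) (Y := fun _ => V) (.unit X) (fun _ => pA) (fun x => pV x.2)
      pV ?_ _ _ _
    intro x
    rw [hw]
    exact .id _
  · exact .whiskerRight _ ((Canonical.rightUnitor _).iso_inv.comp (Canonical.leftUnitor _).iso_inv)

/-- Inserting units and collecting the factors of `M₀ ⊗ ⨂ₜ V`. -/
lemma unit_collect_right (M₀ V : E) {T : Type} (w : (Σ _ : T, Fin 1) ≃ T) (hw : ∀ x, w x = x.1)
    {m : List T} (hm : IsEnum m) :
    (M₀ ◁ tensorListMap (fun _ => (ρ_ V).inv ≫ (λ_ _).inv) m) ≫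
      collect M₀ (fun _ : T => 𝟙_ E) (fun _ => V) (fun _ => V) w (fun _ => 𝟙 V)
        (fun _ => .finRange 1) hm hm =
      ((ρ_ M₀).inv ≫ (M₀ ◁ tensorListUnit (fun _ => 𝟙 (𝟙_ E)) m)) ▷ tensorList (fun _ => V) m := by
  let X : Option T → E := fun
    | none => M₀
    | some _ => V
  let p₀ : Pres X M₀ := .single none (𝟙 M₀)
  let pV : T → Pres X V := fun s => .single (some s) (𝟙 V)
  let q : Pres X ((M₀ ⊗ tensorList (fun _ => 𝟙_ E) m) ⊗ tensorList (fun _ => V) m) :=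
    (p₀.tensor (.list (fun _ => .unit X) m)).tensor (.list pV m)
  have h₀ : IsIso p₀.hom := inferInstanceAs (IsIso (𝟙 M₀ ≫ (ρ_ M₀).inv))
  have hV : ∀ s, IsIso (pV s).hom := fun s => inferInstanceAs (IsIso (𝟙 V ≫ (ρ_ V).inv))
  have hq : IsIso q.hom := inferInstanceAs (IsIso (Pres.tensor _ _).hom)
  have hnd : q.l.Nodup := by
    have key : q.l = [none] ++ m.map some := by
      refine congrArg₂ (· ++ ·) ?_ (Pres.list_single_l _ _ m)
      refine (congrArg ([none] ++ ·) (Pres.list_l _ m)).trans ?_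
      simp
    rw [key]
    refine List.Nodup.append (List.nodup_singleton _) (hm.nodup.map (Option.some_injective _)) ?_
    simp
  refine Canonical.eq (p := p₀.tensor (.list pV m)) (q := q) ?_ ?_ hnd
  · have h1 : ∀ t, Canonical (pV t) ((Pres.unit X).tensor (.list (fun _ => pV t) (List.finRange 1)))
        ((ρ_ V).inv ≫ (λ_ _).inv) := fun t =>
      (Canonical.rightUnitor (pV t)).iso_inv.comp (Canonical.leftUnitor _).iso_inv
    refine (Canonical.whiskerLeft p₀ (.tensorListMap h1 m)).comp ?_
    refine .collect (J := fun _ => Fin 1) (Y := fun _ => V) p₀ (fun _ => .unit X)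
      (fun x => pV x.1) pV ?_ _ _ _
    intro x
    rw [hw]
    exact .id _
  · exact .whiskerRight _ ((Canonical.rightUnitor _).iso_inv.comp
      (.whiskerLeft _ (.tensorListUnit (fun _ => .id _) m)))

end Collect

namespace SymMod

variable {E : Type u} [Category.{v} E] [MonoidalCategory E] [SymmetricCategory E]
  [HasColimitsOfSize.{0, 0} E] (M : SymMod E) (V : E)

lemma unitInc_map {E : Type u} [Category.{v} E] [MonoidalCategory E] [HasColimitsOfSize.{0, 0} E]
    {S T : Type} [Finite S] [Finite T] (e : S ≃ T) (h : Nat.card S = 1)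
    (h' : Nat.card T = 1) :
    unitInc (E := E) S h ≫ (unit E).map e = unitInc T h' := by
  exact Sigma.ι_desc _ _

lemma schurUnit_naturality {V W : E} (f : V ⟶ W) :
    schurUnit V ≫ (unit E).schur.map f = f ≫ schurUnit W := by
  have h := (unit E).incSchur_map f (.finRange 1)
  rw [incSchur_fin, incSchur_fin] at h
  have step : ∀ {A B : E} (u : 𝟙_ E ⟶ A) (x : A ⊗ (V ⊗ 𝟙_ E) ⟶ B) {C : E}
      (y : B ⟶ C) (z : A ⊗ (W ⊗ 𝟙_ E) ⟶ C) (_ : x ≫ y = A ◁ (f ⊗ₘ 𝟙 (𝟙_ E)) ≫ z),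
      ((ρ_ V).inv ≫ (λ_ _).inv ≫ (u ▷ _) ≫ x) ≫ y =
        f ≫ (ρ_ W).inv ≫ (λ_ _).inv ≫ (u ▷ _) ≫ z := by
    intro A B u x C y z e
    simp only [Category.assoc]
    rw [e, ← whisker_exchange_assoc, ← leftUnitor_inv_naturality_assoc, tensorHom_id,
      rightUnitor_inv_naturality_assoc]
  exact step _ _ _ _ h

variable [∀ X : E, PreservesColimitsOfSize.{0, 0} (tensorRight X)]

/-- The comparison map of `I ∘ M` and the unit. -/
lemma leftUnit_psi {S : Type} [Finite S] {m : List S} (hm : IsEnum m) :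
    (leftUnit M S ▷ _) ≫ ((unit E).comp M).incSchur V hm ≫ (unit E).psi M V =
      M.incSchur V hm ≫ schurUnit (M.schur.obj V) := by
  let β : ∀ i : Fin 1, S ≃ {s : S // (fun _ => (0 : Fin 1)) s = i} := fun i =>
    (Equiv.subtypeUnivEquiv (fun _ => Subsingleton.elim _ _)).symm
  let u : 𝟙_ E ⟶ (unit E).obj (Fin 1) := unitInc (Fin 1) (Nat.card_fin 1)
  have h1 := (unit E).incFlat_psi M V (J := fun _ : Fin 1 => S) (fun _ => (0 : Fin 1)) β
    (fun _ => hm) (.finRange 1) hm (Equiv.uniqueSigma (fun _ : Fin 1 => S)) (by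
      rintro ⟨i, x⟩
      obtain rfl := Subsingleton.elim i 0
      rfl)
  have h2 := unit_collect_left (M.obj S) V (Equiv.uniqueSigma (fun _ : Fin 1 => S)) (by
      rintro ⟨i, x⟩
      obtain rfl := Subsingleton.elim i 0
      rfl) hm
  have h3 := whiskerRight_collect u (fun _ : Fin 1 => M.obj S) (fun _ => V) (W := fun _ => V)
    (Equiv.uniqueSigma (fun _ : Fin 1 => S)) (fun _ => 𝟙 V) (fun _ => hm) (.finRange 1) hm
  have step : ∀ {A A' I Z : E} (b : A ⟶ A') (u : 𝟙_ E ⟶ I) (i : I ⊗ (A' ⊗ 𝟙_ E) ⟶ Z),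
      b ≫ (ρ_ _).inv ≫ (λ_ _).inv ≫ (u ▷ _) ≫ i =
        ((ρ_ _).inv ≫ (λ_ _).inv) ≫ (u ▷ _) ≫ (I ◁ (b ⊗ₘ 𝟙 _)) ≫ i := by
    intro A A' I Z b u i
    rw [← whisker_exchange_assoc, Category.assoc, ← leftUnitor_inv_naturality_assoc, tensorHom_id,
      rightUnitor_inv_naturality_assoc]
  have h4 : leftUnit M S = ((ρ_ _).inv ≫ (λ_ _).inv) ≫ (u ▷ _) ≫
      (_ ◁ tensorListMap (fun t => M.map (β t)) (List.finRange 1)) ≫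
        (unit E).incComp M (fun _ => 0) (.finRange 1) := by
    rw [incComp_fin]
    exact step _ _ _
  have h5 : M.incSchur V hm ≫ schurUnit (M.schur.obj V) =
      ((ρ_ _).inv ≫ (λ_ _).inv) ≫ (u ▷ _) ≫ (unit E).incDouble M V (fun _ => hm) (.finRange 1) := by
    unfold incDouble
    rw [incSchur_fin]
    exact step _ _ _
  rw [h5, ← h1]
  unfold incFlat
  rw [h4]
  refine (whisker_comp_of_eq _ _ _ _ (_ ≫ _) h2 h3).trans ?_
  simp only [Category.assoc]
  rfl

/-- The comparison map of `M ∘ I` and the unit. -/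
lemma rightUnit_psi (n : ℕ) :
    (rightUnit M (Fin n) (Equiv.refl (Fin n)) ▷ _) ≫
        (M.comp (unit E)).incSchur V (.finRange n) ≫ M.psi (unit E) V =
      M.incSchur V (.finRange n) ≫ M.schur.map (schurUnit V) := by
  let β : ∀ i : Fin n, Fin 1 ≃ {s : Fin n // Equiv.refl (Fin n) s = i} := fun i =>
    (Equiv.ofUnique (Fin 1) {s : Fin n // s = i})
  let u : 𝟙_ E ⟶ (unit E).obj (Fin 1) := unitInc (Fin 1) (Nat.card_fin 1)
  let w : (Σ _ : Fin n, Fin 1) ≃ Fin n := Equiv.sigmaUnique _ _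
  have h1 := M.incFlat_psi (unit E) V (J := fun _ : Fin n => Fin 1) (Equiv.refl (Fin n)) β
    (fun _ => .finRange 1) (.finRange n) (.finRange n) w (fun x => (β x.1 x.2).2.symm)
  have h2 := unit_collect_right (M.obj (Fin n)) V w (fun _ => rfl) (.finRange n)
  have h3 := whisker_collect (M.obj (Fin n)) (fun _ : Fin n => u) (fun _ => V) (W := fun _ => V)
    w (fun _ => 𝟙 V) (fun _ => .finRange 1) (.finRange n) (.finRange n)
  have h4 : rightUnit M (Fin n) (Equiv.refl (Fin n)) =
      ((ρ_ _).inv ≫ (_ ◁ tensorListUnit (fun _ => 𝟙 (𝟙_ E)) (List.finRange n))) ≫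
      (_ ◁ tensorListMap (fun _ => u) (List.finRange n)) ≫
      (_ ◁ tensorListMap (fun t => (unit E).map (β t)) (List.finRange n)) ≫
        M.incComp (unit E) (Equiv.refl (Fin n)) (.finRange n) := by
    rw [incComp_fin]
    unfold rightUnit
    rw [M.map_refl, Category.id_comp]
    have step : ∀ {A B C D X Y Z : E} (r : X ⟶ Y ⊗ A) (a : A ⟶ B) (b : B ⟶ C) (c : C ⟶ D)
        (i : Y ⊗ D ⟶ Z) (d : A ⟶ D) (_ : a ≫ b ≫ c = d),
        r ≫ (Y ◁ d) ≫ i = (r ≫ (Y ◁ a)) ≫ (Y ◁ b) ≫ (Y ◁ c) ≫ i := by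
      rintro A B C D X Y Z r a b c i _ rfl
      simp
    refine step _ _ _ _ _ _ ?_
    rw [tensorListMap_comp, tensorListUnit_comp_listMap]
    congr 1
    funext i
    exact (Category.id_comp _).trans (unitInc_map _ _ _)
  have h5 : M.incSchur V (.finRange n) ≫ M.schur.map (schurUnit V) =
      (_ ◁ tensorListMap (fun _ => (ρ_ _).inv ≫ (λ_ _).inv) _) ≫
        (_ ◁ tensorListMap (fun _ => u ▷ _) _) ≫
          M.incDouble (unit E) V (fun _ => .finRange 1) (.finRange n) := by
    rw [incSchur_map]
    unfold incDouble
    have step : ∀ {A B C D Y Z : E} (a : A ⟶ B) (b : B ⟶ C) (c : C ⟶ D)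
        (i : Y ⊗ D ⟶ Z) (d : A ⟶ D) (_ : a ≫ b ≫ c = d),
        (Y ◁ d) ≫ i = (Y ◁ a) ≫ (Y ◁ b) ≫ (Y ◁ c) ≫ i := by
      rintro A B C D Y Z a b c i _ rfl
      simp
    refine step _ _ _ _ _ ?_
    refine (congrArg (_ ≫ ·) (tensorListMap_comp _ _ _)).trans ((tensorListMap_comp _ _ _).trans ?_)
    refine congrArg (fun t => tensorListMap (fun _ => t) (List.finRange n)) ?_
    refine (congrArg (fun t => ((ρ_ _).inv ≫ (λ_ _).inv) ≫ (u ▷ _) ≫ t)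
      ((unit E).incSchur_fin V 1)).trans ?_
    exact Category.assoc _ _ _
  rw [h5, ← h1]
  unfold incFlat
  rw [h4]
  refine (whisker_comp_of_eq _ _ _ _ (_ ≫ _) h2 h3).trans ?_
  simp only [Category.assoc]
  rfl

lemma map_unit_obj_hom_ext {E : Type u} [Category.{v} E] [MonoidalCategory E]
    [HasColimitsOfSize.{0, 0} E] [∀ X : E, PreservesColimitsOfSize.{0, 0} (tensorRight X)]
    {V : E} {S : Type} [Finite S] {Z : E} {a b : (unit E).obj S ⊗ V ⟶ Z}
    (h : ∀ h : Nat.card S = 1, (unitInc S h ▷ V) ≫ a = (unitInc S h ▷ V) ≫ b) : a = b := by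
  refine Cofan.IsColimit.hom_ext (isColimitCofanMkObjOfIsColimit (tensorRight V) _ _
    (coproductIsCoproduct fun _ : PLift (Nat.card S = 1) => 𝟙_ E)) _ _ ?_
  rintro ⟨hS⟩
  exact h hS

lemma exists_map_unit_obj_desc {E : Type u} [Category.{v} E] [MonoidalCategory E]
    [HasColimitsOfSize.{0, 0} E] [∀ X : E, PreservesColimitsOfSize.{0, 0} (tensorRight X)]
    {V : E} {S : Type} [Finite S] {Z : E}
    (g : Nat.card S = 1 → (𝟙_ E ⊗ V ⟶ Z)) :
    ∃ a : (unit E).obj S ⊗ V ⟶ Z, ∀ h : Nat.card S = 1, (unitInc S h ▷ V) ≫ a = g h :=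
  ⟨Cofan.IsColimit.desc (isColimitCofanMkObjOfIsColimit (tensorRight V) _ _
    (coproductIsCoproduct fun _ : PLift (Nat.card S = 1) => 𝟙_ E)) fun h => g h.down,
    fun h => Cofan.IsColimit.fac (isColimitCofanMkObjOfIsColimit (tensorRight V) _ _
    (coproductIsCoproduct fun _ : PLift (Nat.card S = 1) => 𝟙_ E)) _ ⟨h⟩⟩

lemma epi_schurUnit (V : E) : Epi (schurUnit V) := by
  refine ⟨fun {Z} a b h => ?_⟩
  refine coinv_hom_ext (F := .const V) ?_
  rintro k ⟨⟩
  refine map_unit_obj_hom_ext fun hk => ?_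
  obtain rfl : k = 1 := by rwa [Nat.card_fin] at hk
  simp only [schurUnit] at h
  have step : ∀ {X A B C : E} (x : X ⟶ A) [IsIso x] (y : A ⟶ B) (z : B ⟶ C) (a b : C ⟶ Z)
      (_ : (x ≫ y ≫ z) ≫ a = (x ≫ y ≫ z) ≫ b), y ≫ z ≫ a = y ≫ z ≫ b := by
    intro X A B C x _ y z a b h
    simpa only [Category.assoc, cancel_epi] using h
  exact step ((ρ_ V).inv ≫ (λ_ (V ⊗ 𝟙_ E)).inv) _ _ _ _
    ((congrArg (· ≫ a) (Category.assoc _ _ _)).trans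
      (h.trans (congrArg (· ≫ b) (Category.assoc _ _ _).symm)))

lemma exists_schurUnit_retraction (V : E) : ∃ r, schurUnit V ≫ r = 𝟙 V := by
  have h0 : ∀ k : ℕ, ∃ g : (unit E).obj (Fin k) ⊗ tensorList (fun _ => V) (List.finRange k) ⟶ V,
      ∀ (hk : Nat.card (Fin k) = 1) (h : k = 1), (unitInc (Fin k) hk ▷ _) ≫ g =
        (λ_ _).hom ≫ eqToHom (by rw [h]; rfl) ≫ (ρ_ V).hom := fun k => by
    obtain ⟨g, hg⟩ := exists_map_unit_obj_desc (S := Fin k)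
      (V := tensorList (fun _ => V) (List.finRange k)) (Z := V) fun hk =>
        (λ_ _).hom ≫ eqToHom (by rw [Nat.card_fin] at hk; subst hk; rfl) ≫ (ρ_ V).hom
    exact ⟨g, fun hk _ => hg hk⟩
  choose g hg using h0
  have hc : Compat (M := unit E) (F := .const V) (fun k _ => g k) := by
    rintro k ⟨⟩ σ r
    refine map_unit_obj_hom_ext fun hk => ?_
    obtain rfl : k = 1 := by rwa [Nat.card_fin] at hk
    obtain rfl : σ = Equiv.refl _ := Subsingleton.elim _ _
    have h := reindex_reordering_eq_tensorEquiv (X := fun _ => V) (Equiv.refl (Fin 1))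
      (fun _ => 𝟙 V) (.finRange 1) (.finRange 1) r
    rw [tensorEquiv_refl] at h
    refine congrArg (_ ≫ ·) ?_
    refine (congrArg (· ≫ g 1) (congrArg₂ (· ⊗ₘ ·) ((unit E).map_refl _) h)).trans ?_
    exact (congrArg (· ≫ g 1) (id_tensorHom_id _ _)).trans (Category.id_comp _)
  refine ⟨(unit E).coinvDesc (.const V) (fun k _ => g k) hc, ?_⟩
  have h1 := (unit E).inc_coinvDesc (.const V) (fun k _ => g k) hc (k := 1) ()
  have h2 := hg 1 (Nat.card_fin 1) rfl
  have step : ∀ {A B C : E} (u : 𝟙_ E ⊗ (V ⊗ 𝟙_ E) ⟶ A) (x : A ⟶ B) (y : B ⟶ V) (z : A ⟶ V)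
      (_ : x ≫ y = z) (_ : u ≫ z = (λ_ _).hom ≫ 𝟙 _ ≫ (ρ_ V).hom),
      ((ρ_ V).inv ≫ (λ_ _).inv ≫ u ≫ x) ≫ y = 𝟙 V := by
    intro A B C u x y z h h'
    simp [h, h']
  exact step (C := V) _ _ _ _ h1 h2

instance isIso_schurUnit (V : E) : IsIso (schurUnit V) := by
  obtain ⟨r, hr⟩ := exists_schurUnit_retraction V
  have := epi_schurUnit V
  have : IsSplitMono (schurUnit V) := ⟨⟨⟨r, hr⟩⟩⟩
  exact isIso_of_epi_of_isSplitMono _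

end SymMod

/-! ### Tensor products of presented objects -/

section Presented

variable {E : Type u} [Category.{v} E]

/-- A family of maps that is jointly epimorphic, and stays so under all functors that preserve
colimits. -/
def JointlyEpic {I : Type} {X : I → E} {A : E} (p : ∀ a, X a ⟶ A) : Prop :=
  ∀ (L : E ⥤ E) [PreservesColimitsOfSize.{0, 0} L] {Z : E} {f g : L.obj A ⟶ Z},
    (∀ a, L.map (p a) ≫ f = L.map (p a) ≫ g) → f = g

lemma JointlyEpic.hom_ext {I : Type} {X : I → E} {A : E} {p : ∀ a, X a ⟶ A} (h : JointlyEpic p)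
    {Z : E} {f g : A ⟶ Z} (w : ∀ a, p a ≫ f = p a ≫ g) : f = g :=
  h (𝟭 E) w

/-- A family of maps `p a : X a ⟶ A` presents `A` by the relations `W` between the objects `X a` if
maps out of `A` are the families of maps out of the `X a` that are compatible with the relations,
and if this remains true after application of a functor that preserves colimits. -/
structure Presents {I : Type} {X : I → E} {A : E} (p : ∀ a, X a ⟶ A)
    (W : ∀ a b, (X a ⟶ X b) → Prop) : Prop where
  epi : JointlyEpic p
  desc : ∀ (L : E ⥤ E) [PreservesColimitsOfSize.{0, 0} L] {Z : E} (g : ∀ a, L.obj (X a) ⟶ Z),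
    (∀ a b ρ, W a b ρ → L.map ρ ≫ g b = g a) → ∃ d, ∀ a, L.map (p a) ≫ d = g a

/-- Transport of a presentation along isomorphisms. -/
lemma Presents.of_iso {I : Type} {X X' : I → E} {A A' : E} {p : ∀ a, X a ⟶ A}
    {W : ∀ a b, (X a ⟶ X b) → Prop} (h : Presents p W) {p' : ∀ a, X' a ⟶ A'} (s : ∀ a, X a ⟶ X' a)
    [∀ a, IsIso (s a)] (t : A ⟶ A') [IsIso t] (w : ∀ a, p a ≫ t = s a ≫ p' a)
    {W' : ∀ a b, (X' a ⟶ X' b) → Prop}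
    (hW : ∀ a b ρ, W a b ρ → ∃ ρ', W' a b ρ' ∧ ρ ≫ s b = s a ≫ ρ') : Presents p' W' where
  epi := fun L _ Z f g hfg => by
    rw [← cancel_epi (L.map t)]
    refine h.epi L fun a => ?_
    rw [← L.map_comp_assoc, w, L.map_comp_assoc, hfg, ← L.map_comp_assoc, ← w, L.map_comp_assoc]
  desc := fun L _ Z g hg => by
    obtain ⟨d, hd⟩ := h.desc L (fun a => L.map (s a) ≫ g a) (by
      intro a b ρ hρ
      obtain ⟨ρ', hρ', e⟩ := hW a b ρ hρ
      rw [← L.map_comp_assoc, e, L.map_comp_assoc, hg _ _ _ hρ'])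
    refine ⟨L.map (inv t) ≫ d, fun a => ?_⟩
    rw [← cancel_epi (L.map (s a)), ← hd, ← L.map_comp_assoc, ← w, L.map_comp_assoc,
      ← L.map_comp_assoc t, IsIso.hom_inv_id, L.map_id, Category.id_comp]

variable [MonoidalCategory E]

/-- The tensor product of a family indexed by `Fin k`. Its definition by recursion on `k` makes it
convenient for induction. -/
def tensorFin : ∀ {k : ℕ}, (Fin k → E) → E
  | 0, _ => 𝟙_ E
  | _ + 1, A => A 0 ⊗ tensorFin fun i => A i.succ

/-- Functoriality of `tensorFin`. -/
def tensorFinMap : ∀ {k : ℕ} {A B : Fin k → E} (_ : ∀ i, A i ⟶ B i), tensorFin A ⟶ tensorFin B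
  | 0, _, _, _ => 𝟙 (𝟙_ E)
  | _ + 1, _, _, f => f 0 ⊗ₘ tensorFinMap fun i => f i.succ

/-- The comparison of the two tensor products of a family indexed by `Fin k`. -/
def tensorFinTo : ∀ {k : ℕ} (A : Fin k → E), tensorFin A ⟶ tensorList A (List.finRange k)
  | 0, _ => 𝟙 (𝟙_ E)
  | k + 1, A => (A 0 ◁ (tensorFinTo (fun i => A i.succ) ≫
      tensorReindex (Y := A) Fin.succ (fun _ => 𝟙 _) (List.finRange k))) ≫
      eqToHom (congrArg (tensorList A) (List.finRange_succ (n := k)).symm)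

lemma tensorFinMap_id : ∀ {k : ℕ} (A : Fin k → E), tensorFinMap (fun i => 𝟙 (A i)) = 𝟙 _
  | 0, _ => rfl
  | _ + 1, A => (congrArg (𝟙 (A 0) ⊗ₘ ·) (tensorFinMap_id fun i => A i.succ)).trans
      (id_tensorHom_id _ _)

instance isIso_tensorFinTo : ∀ {k : ℕ} (A : Fin k → E), IsIso (tensorFinTo A)
  | 0, _ => inferInstanceAs (IsIso (𝟙 (𝟙_ E)))
  | k + 1, A => by
    have := isIso_tensorFinTo (fun i => A i.succ)
    have := isIso_tensorReindex (W := A) Fin.succ (fun _ => 𝟙 _) (List.finRange k)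
    have step : ∀ {P Q R S : E} (X : E) (a : P ⟶ Q) (b : Q ⟶ R) [IsIso a] [IsIso b] (e : X ⊗ R = S),
        IsIso ((X ◁ (a ≫ b)) ≫ eqToHom e) := by
      intros
      infer_instance
    exact step _ _ _ _

lemma tensorFinTo_naturality : ∀ {k : ℕ} {A B : Fin k → E} (f : ∀ i, A i ⟶ B i),
    tensorFinMap f ≫ tensorFinTo B = tensorFinTo A ≫ tensorListMap f (List.finRange k)
  | 0, _, _, _ => rfl
  | k + 1, A, B, f => by
    have ih := tensorFinTo_naturality (fun i => f i.succ)
    have h := tensorListMap_reindex (X := fun i => A (Fin.succ i)) (X' := fun i => B (Fin.succ i))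
      (Y := A) (Y' := B) Fin.succ (fun _ => 𝟙 _) (fun _ => 𝟙 _)
      (fun i => f (Fin.succ i)) f (fun i => by simp) (List.finRange k)
    have h' : ∀ {l l' : List (Fin (k + 1))} (e : l = l'),
        eqToHom (congrArg (tensorList A) e) ≫ tensorListMap f l' =
          tensorListMap f l ≫ eqToHom (congrArg (tensorList B) e) := by
      rintro l _ rfl
      simp
    have step : ∀ {A₀ B₀ P Q P' Q' P'' Q'' Z : E} (x : A₀ ⟶ B₀) (a : P ⟶ Q) (b : Q ⟶ Q')
        (c : Q' ⟶ Q'') (a' : P ⟶ P') (b' : P' ⟶ P'') (c' : P'' ⟶ Q'') (z : B₀ ⊗ Q'' ⟶ Z)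
        (_ : a ≫ b ≫ c = (a' ≫ b') ≫ c'),
        (x ⊗ₘ a) ≫ (B₀ ◁ (b ≫ c)) ≫ z = (A₀ ◁ (a' ≫ b')) ≫ (x ⊗ₘ c') ≫ z := by
      intro A₀ B₀ P Q P' Q' P'' Q'' Z x a b c a' b' c' z e
      rw [← id_tensorHom, ← id_tensorHom, tensorHom_comp_tensorHom_assoc,
        tensorHom_comp_tensorHom_assoc, e, Category.id_comp, Category.comp_id]
    refine (step _ _ _ _ _ _ _ _ ?_).trans ((congrArg (_ ≫ ·)
      (h' (List.finRange_succ (n := k)).symm).symm).trans (Category.assoc _ _ _).symm)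
    rw [reassoc_of% ih, h, Category.assoc]

section

variable [∀ X : E, PreservesColimitsOfSize.{0, 0} (tensorLeft X)]
  [∀ X : E, PreservesColimitsOfSize.{0, 0} (tensorRight X)]

lemma JointlyEpic.tensorFin : ∀ {k : ℕ} {I : Fin k → Type} {X : ∀ i, I i → E} {A : Fin k → E}
    {p : ∀ i (a : I i), X i a ⟶ A i} (_ : ∀ i, JointlyEpic (p i)),
    JointlyEpic (fun a : ∀ i, I i => tensorFinMap fun i => p i (a i))
  | 0, _, _, _, _, _ => fun L _ _ f g h => by
    have e : ∀ {A Z : E} (f : L.obj A ⟶ Z), L.map (𝟙 A) ≫ f = f := fun f => by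
      rw [L.map_id, Category.id_comp]
    exact (e f).symm.trans ((h fun i => i.elim0).trans (e g))
  | k + 1, I, X, A, p, hp => fun L _ Z f g h => by
    have ih := JointlyEpic.tensorFin (fun i : Fin k => hp i.succ)
    refine hp 0 (tensorRight _ ⋙ L) fun a₀ => ih (tensorLeft (X 0 a₀) ⋙ L) fun a' => ?_
    have h' := h (Fin.cons a₀ a')
    have step : ∀ {P Q R : E} (t : P ⟶ R) (x : P ⟶ Q) (y : Q ⟶ R) (_ : t = x ≫ y) (f : L.obj R ⟶ Z),
        L.map x ≫ L.map y ≫ f = L.map t ≫ f := by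
      rintro P Q R _ x y rfl f
      rw [L.map_comp_assoc]
    have e : (tensorFinMap fun i => p i (Fin.cons (α := I) a₀ a' i)) =
        (X 0 a₀ ◁ (tensorFinMap fun i => p i.succ (a' i))) ≫ (p 0 a₀ ▷ _) :=
      tensorHom_def' _ _
    exact (step _ _ _ e f).trans (h'.trans (step _ _ _ e g).symm)

lemma Presents.tensorFin : ∀ {k : ℕ} {I : Fin k → Type} {X : ∀ i, I i → E} {A : Fin k → E}
    {p : ∀ i (a : I i), X i a ⟶ A i} {W : ∀ i (a b : I i), (X i a ⟶ X i b) → Prop}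
    (_ : ∀ i, Presents (p i) (W i)) (_ : ∀ i a, W i a a (𝟙 _)),
    Presents (fun a : ∀ i, I i => tensorFinMap fun i => p i (a i))
      (fun a b ρ => ∃ ρ' : ∀ i, X i (a i) ⟶ X i (b i), (∀ i, W i _ _ (ρ' i)) ∧ ρ = tensorFinMap ρ')
  | 0, I, X, A, p, W, hp, _ =>
    ⟨.tensorFin fun i => (hp i).epi, fun L _ Z g _ => ⟨g fun i => i.elim0, fun a => by
      obtain rfl : a = fun i => i.elim0 := funext fun i => i.elim0
      exact (congrArg (· ≫ _) (L.map_id _)).trans (Category.id_comp _)⟩⟩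
  | k + 1, I, X, A, p, W, hp, hW => by
    have ih := Presents.tensorFin (fun i : Fin k => hp i.succ) (fun i => hW i.succ)
    refine ⟨.tensorFin fun i => (hp i).epi, fun L _ Z g hg => ?_⟩
    have h1 : ∀ a₀ : I 0, ∃ d : L.obj (X 0 a₀ ⊗ OperadTheory.tensorFin fun i : Fin k => A i.succ) ⟶
        Z,
        ∀ a' : ∀ i : Fin k, I i.succ,
          L.map (X 0 a₀ ◁ (tensorFinMap fun i => p i.succ (a' i))) ≫ d =
            g (Fin.cons (α := I) a₀ a') := fun a₀ => by
      refine ih.desc (tensorLeft (X 0 a₀) ⋙ L) (fun a' => g (Fin.cons (α := I) a₀ a')) ?_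
      rintro a b _ ⟨ρ', hρ', rfl⟩
      refine Eq.trans ?_ (hg (Fin.cons (α := I) a₀ a) (Fin.cons (α := I) a₀ b) _
        ⟨Fin.cons (α := fun i => X i (Fin.cons (α := I) a₀ a i) ⟶ X i (Fin.cons (α := I) a₀ b i))
          (𝟙 (X 0 a₀)) ρ', Fin.cases (hW 0 a₀) hρ', rfl⟩)
      exact congrArg (fun t => L.map t ≫ _) (id_tensorHom _ _).symm
    choose d hd using h1
    obtain ⟨D, hD⟩ := (hp 0).desc (tensorRight _ ⋙ L) d (by
      intro a b ρ hρ
      refine ih.epi (tensorLeft (X 0 a) ⋙ L) fun a' => ?_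
      refine Eq.trans ?_ (hd a a').symm
      refine Eq.trans ?_ (hg (Fin.cons (α := I) a a') (Fin.cons (α := I) b a') _
        ⟨Fin.cons (α := fun i => X i (Fin.cons (α := I) a a' i) ⟶ X i (Fin.cons (α := I) b a' i))
          ρ (fun i => 𝟙 _), Fin.cases hρ (fun i => hW _ _), rfl⟩)
      have e : (tensorFinMap (Fin.cons (α := fun i => X i (Fin.cons (α := I) a a' i) ⟶
          X i (Fin.cons (α := I) b a' i)) ρ (fun i => 𝟙 _))) = ρ ▷ _ := by
        refine (congrArg (ρ ⊗ₘ ·) ?_).trans (tensorHom_id _ _)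
        exact tensorFinMap_id _
      have step : ∀ {P Q R S : E} (x : P ⟶ Q) (y : R ⟶ S) (z : L.obj (Q ⊗ S) ⟶ Z),
          L.map (P ◁ y) ≫ L.map (x ▷ S) ≫ z = L.map (x ▷ R) ≫ L.map (Q ◁ y) ≫ z := by
        intro P Q R S x y z
        rw [← Functor.map_comp_assoc, whisker_exchange, Functor.map_comp_assoc]
      exact (step _ _ _).trans ((congrArg (_ ≫ ·) (hd b a')).trans
        (congrArg (fun t => L.map t ≫ _) e.symm)))
    refine ⟨D, fun a => ?_⟩
    obtain ⟨a₀, a', rfl⟩ : ∃ a₀ a', a = Fin.cons (α := I) a₀ a' :=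
      ⟨_, _, (Fin.cons_self_tail a).symm⟩
    have e : (tensorFinMap fun i => p i (Fin.cons (α := I) a₀ a' i)) =
        (X 0 a₀ ◁ (tensorFinMap fun i => p i.succ (a' i))) ≫ (p 0 a₀ ▷ _) :=
      tensorHom_def' _ _
    refine (congrArg (fun t => L.map t ≫ D) e).trans ?_
    refine (congrArg (· ≫ D) (L.map_comp _ _)).trans ((Category.assoc _ _ _).trans ?_)
    exact (congrArg (_ ≫ ·) (hD a₀)).trans (hd _ _)

lemma Presents.tensorList {k : ℕ} {I : Fin k → Type} {X : ∀ i, I i → E} {A : Fin k → E}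
    {p : ∀ i (a : I i), X i a ⟶ A i} {W : ∀ i (a b : I i), (X i a ⟶ X i b) → Prop}
    (h : ∀ i, Presents (p i) (W i)) (hW : ∀ i a, W i a a (𝟙 _)) :
    Presents (fun a : ∀ i, I i => tensorListMap (fun i => p i (a i)) (List.finRange k))
      (fun a b ρ => ∃ ρ' : ∀ i, X i (a i) ⟶ X i (b i), (∀ i, W i _ _ (ρ' i)) ∧
        ρ = tensorListMap ρ' (List.finRange k)) := by
  refine (Presents.tensorFin h hW).of_iso (fun a => tensorFinTo _) (tensorFinTo _)
    (fun a => tensorFinTo_naturality _) ?_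
  rintro a b _ ⟨ρ', hρ', rfl⟩
  exact ⟨_, ⟨ρ', hρ', rfl⟩, tensorFinTo_naturality _⟩

lemma JointlyEpic.tensorList {k : ℕ} {I : Fin k → Type} {X : ∀ i, I i → E} {A : Fin k → E}
    {p : ∀ i (a : I i), X i a ⟶ A i} (h : ∀ i, JointlyEpic (p i)) :
    JointlyEpic (fun a : ∀ i, I i => tensorListMap (fun i => p i (a i)) (List.finRange k)) :=
  fun L _ Z f g hfg => by
    rw [← cancel_epi (L.map (tensorFinTo A))]
    refine JointlyEpic.tensorFin h L fun a => ?_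
    have e := tensorFinTo_naturality fun i => p i (a i)
    rw [← L.map_comp_assoc, e, L.map_comp_assoc, hfg, ← L.map_comp_assoc, ← e, L.map_comp_assoc]

end

end Presented

namespace SymMod

variable {E : Type u} [Category.{v} E] [MonoidalCategory E] [SymmetricCategory E]

/-! ### The comparison map is an isomorphism -/

section Relations

variable (N : SymMod E) (V : E)

/-- The relations between the summands of `N(V)`. -/
inductive SchurRel : ∀ m m' : ℕ,
    (N.obj (Fin m) ⊗ tensorList (fun _ : Fin m => V) (List.finRange m) ⟶
      N.obj (Fin m') ⊗ tensorList (fun _ : Fin m' => V) (List.finRange m')) → Prop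
  | mk (m : ℕ) (σ : Equiv.Perm (Fin m)) : SchurRel m m
      (N.map σ ⊗ₘ tensorEquiv (X := fun _ => V) σ (fun _ => 𝟙 V) (.finRange m) (.finRange m))

lemma schurRel_refl (m : ℕ) : SchurRel N V m m (𝟙 _) := by
  have := SchurRel.mk (N := N) (V := V) m (Equiv.refl _)
  rwa [N.map_refl, tensorEquiv_refl, id_tensorHom_id] at this

variable {N V} in
lemma SchurRel.arity_eq {m m' : ℕ} {ρ} (h : SchurRel N V m m' ρ) : m = m' := by
  cases h
  rfl

variable {N V} in
lemma SchurRel.exists_eq {m : ℕ} {ρ} (h : SchurRel N V m m ρ) : ∃ σ : Equiv.Perm (Fin m),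
    ρ = N.map σ ⊗ₘ tensorEquiv (X := fun _ => V) σ (fun _ => 𝟙 V) (.finRange m) (.finRange m) := by
  cases h
  exact ⟨_, rfl⟩

end Relations

variable [HasColimitsOfSize.{0, 0} E]

section Inverse

variable (M N : SymMod E) (V : E)

lemma map_incFlat {T T' S S' : Type} [Finite T] [Finite T'] [Finite S] [Finite S']
    {J : T → Type} [∀ t, Finite (J t)] {J' : T' → Type} [∀ t, Finite (J' t)]
    (b : T ≃ T') (a : S ≃ S') (γ : ∀ t, J t ≃ J' (b t)) {f : S → T} {f' : S' → T'}
    (β : ∀ t, J t ≃ {s // f s = t}) (β' : ∀ t, J' t ≃ {s // f' s = t})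
    {B : ∀ t, List (J t)} (hB : ∀ t, IsEnum (B t)) {B' : ∀ t, List (J' t)}
    (hB' : ∀ t, IsEnum (B' t)) {l : List T} (hl : IsEnum l) {l' : List T'} (hl' : IsEnum l')
    {m : List S} (hm : IsEnum m) {m' : List S'} (hm' : IsEnum m')
    (w : (Σ t, J t) ≃ S) (hw : ∀ x, w x = (β x.1 x.2).1)
    (w' : (Σ t, J' t) ≃ S') (hw' : ∀ x, w' x = (β' x.1 x.2).1)
    (h : ∀ t j, w' ⟨b t, γ t j⟩ = a (w ⟨t, j⟩)) :
    (M.map b ⊗ₘ tensorEquiv (X := fun t => N.obj (J' t) ⊗ tensorList (fun _ => V) (B' t)) b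
        (fun t => N.map (γ t) ⊗ₘ tensorEquiv (X := fun _ => V) (γ t) (fun _ => 𝟙 V) (hB t)
          (hB' (b t))) hl hl') ≫ M.incFlat N V f' β' hB' hl' hm' w' =
      M.incFlat N V f β hB hl hm w := by
  have h1 := tensor_collect (M.map b) b (fun t => N.map (γ t)) (A' := fun t => N.obj (J' t))
    (Y := fun _ => V) (Y' := fun _ => V) γ (fun _ _ => 𝟙 V) (W := fun _ => V)
    w' (fun _ => 𝟙 V) hB hB' hl hl' hm'
  have h2 := collect_comp (M.obj T) (fun t => N.obj (J t)) (fun _ => V)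
    w (fun _ => 𝟙 V) a (fun _ => 𝟙 V) hB hl hm hm' (W := fun _ => V) (W' := fun _ => V)
  have e : (Equiv.sigmaCongr b γ).trans w' = w.trans a := Equiv.ext fun x => h x.1 x.2
  simp only [Category.comp_id] at h1 h2
  rw [e] at h1
  rw [← h2] at h1
  let δ (t : T) : {s // f s = t} ≃ {s // f' s = b t} :=
    (β t).symm.trans ((γ t).trans (β' (b t)))
  have hδ : ∀ t s, (δ t s).1 = a s.1 := by
    intro t s
    obtain ⟨j, rfl⟩ := (β t).surjective s
    have := h t j
    rw [hw, hw'] at this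
    simpa [δ] using this
  have h3 := M.map_incComp N b a δ hδ hl hl'
  have h4 := (M.comp N).map_incSchur V a (fun _ => 𝟙 V) hm hm'
  rw [tensorListMap_id, MonoidalCategory.whiskerLeft_id, Category.id_comp] at h4
  have h5 : (M.map b ⊗ₘ tensorEquiv (X := fun t => N.obj (J' t)) b (fun t => N.map (γ t)) hl hl') ≫
      (_ ◁ tensorListMap (fun t => N.map (β' t)) l') ≫ M.incComp N f' hl' =
      ((_ ◁ tensorListMap (fun t => N.map (β t)) l) ≫ M.incComp N f hl) ≫ (M.comp N).map a := by
    rw [Category.assoc, ← h3, ← id_tensorHom, ← id_tensorHom, tensorHom_comp_tensorHom_assoc,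
      tensorHom_comp_tensorHom_assoc, tensorEquiv_comp_listMap, tensorListMap_comp_equiv,
      Category.comp_id, Category.id_comp]
    congr 3
    funext t
    rw [← N.map_trans, ← N.map_trans]
    congr 1
    ext j
    simp [δ]
  unfold incFlat
  rw [reassoc_of% h1, ← comp_whiskerRight_assoc, h5, comp_whiskerRight_assoc, ← h4]
  rw [MonoidalCategory.tensorHom_def'_assoc, ← whisker_exchange_assoc]

lemma presents_schur :
    Presents (fun m : ℕ => N.incSchur V (.finRange m)) (SchurRel N V) where
  epi := fun L _ Z f g h => by
    refine map_coinv_hom_ext L (F := .const V) ?_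
    rintro m ⟨⟩
    have e := N.incSchur_fin V m
    exact (congrArg (fun t => L.map t ≫ f) e).symm.trans
      ((h m).trans (congrArg (fun t => L.map t ≫ g) e))
  desc := fun L _ Z g hg => by
    obtain ⟨d, hd⟩ := exists_map_coinv_desc L (M := N) (F := .const V) (fun k _ => g k) (by
      rintro k ⟨⟩ σ r
      refine Eq.trans (congrArg (fun t => L.map (N.map σ ⊗ₘ t) ≫ _) ?_) (hg _ _ _ (.mk k σ))
      exact reindex_reordering_eq_tensorEquiv σ _ (.finRange k) (.finRange k) r)
    refine ⟨d, fun a => ?_⟩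
    refine (congrArg (fun t => L.map t ≫ d) (N.incSchur_fin V a)).trans (hd a ())

section

variable {T : Type} {J : T → Type}

/-- The fibres of the projection of a disjoint union. -/
def sigmaFib (t : T) : J t ≃ {s : Σ t, J t // s.1 = t} := (Equiv.sigmaSubtype t).symm

/-- The inclusion `M(k) ⊗ ⨂ᵢ (N(m i) ⊗ V^{⊗ (m i)}) ⟶ (M ∘ N)(V)`. -/
def incBlocks {k : ℕ} (m : Fin k → ℕ) :
    M.obj (Fin k) ⊗ tensorList (fun i => N.obj (Fin (m i)) ⊗
      tensorList (fun _ => V) (List.finRange (m i))) (List.finRange k) ⟶ (M.comp N).schur.obj V :=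
  M.incFlat N V (S := Σ i, Fin (m i)) Sigma.fst sigmaFib (fun i => .finRange (m i)) (.finRange k)
    (isEnum_enum _) (Equiv.refl _)

end

lemma map_incBlocks {k : ℕ} (m m' : Fin k → ℕ) (σ : Equiv.Perm (Fin k))
    (γ : ∀ i, Fin (m i) ≃ Fin (m' (σ i))) :
    (M.map σ ⊗ₘ tensorEquiv (X := fun i => N.obj (Fin (m' i)) ⊗
      tensorList (fun _ => V) (List.finRange (m' i))) σ
        (fun i => N.map (γ i) ⊗ₘ tensorEquiv (X := fun _ => V) (γ i) (fun _ => 𝟙 V) (.finRange _)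
          (.finRange _)) (.finRange k) (.finRange k)) ≫ M.incBlocks N V m' = M.incBlocks N V m :=
  M.map_incFlat N V σ (Equiv.sigmaCongr σ γ) γ (sigmaFib (J := fun i => Fin (m i)))
    (sigmaFib (J := fun i => Fin (m' i))) (fun i => .finRange (m i)) (fun i => .finRange (m' i))
    (.finRange k) (.finRange k) (isEnum_enum _) (isEnum_enum _) (Equiv.refl _) (fun _ => rfl)
    (Equiv.refl _) (fun _ => rfl) (fun _ _ => rfl)

variable [∀ X : E, PreservesColimitsOfSize.{0, 0} (tensorLeft X)]
  [∀ X : E, PreservesColimitsOfSize.{0, 0} (tensorRight X)]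

lemma exists_theta : ∃ θ : M.schur.obj (N.schur.obj V) ⟶ (M.comp N).schur.obj V,
    ∀ (k : ℕ) (m : Fin k → ℕ), M.incDouble N V (fun i => .finRange (m i)) (.finRange k) ≫ θ =
      M.incBlocks N V m := by
  have hP : ∀ k : ℕ, _ := fun k => Presents.tensorList (k := k)
    (fun _ => N.presents_schur V) (fun _ m => N.schurRel_refl V m)
  have h1 : ∀ k : ℕ, ∃ d : M.obj (Fin k) ⊗ tensorList (fun _ => N.schur.obj V) (List.finRange k) ⟶
      (M.comp N).schur.obj V, ∀ m : Fin k → ℕ, (M.obj (Fin k) ◁ tensorListMap (fun i =>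
        N.incSchur V (.finRange (m i))) (List.finRange k)) ≫ d = M.incBlocks N V m := by
    intro k
    refine (hP k).desc (tensorLeft (M.obj (Fin k))) (fun m => M.incBlocks N V m) ?_
    rintro a b _ ⟨ρ, hρ, rfl⟩
    obtain rfl : a = b := funext fun i => (hρ i).arity_eq
    choose σ hσ using fun i => (hρ i).exists_eq
    obtain rfl : ρ = _ := funext hσ
    have h := M.map_incBlocks N V a a (Equiv.refl (Fin k)) σ
    rw [M.map_refl, id_tensorHom] at h
    refine Eq.trans (congrArg (fun t => (_ ◁ t) ≫ _) ?_) h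
    exact tensorListMap_eq_tensorEquiv _ _
  choose d hd using h1
  have hc : Compat (M := M) (F := .const (N.schur.obj V)) (fun k _ => d k) := by
    rintro k ⟨⟩ σ r
    refine (hP k).epi (tensorLeft (M.obj (Fin k))) fun m => ?_
    refine Eq.trans ?_ (hd k m).symm
    let γ (i : Fin k) : Fin (m i) ≃ Fin (m (σ.symm (σ i))) :=
      finCongr (by rw [Equiv.symm_apply_apply])
    have h := M.map_incBlocks N V m (fun i => m (σ.symm i)) σ γ
    rw [← h, ← hd k, ← id_tensorHom, tensorHom_comp_tensorHom_assoc, tensorEquiv_comp_listMap,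
      Category.comp_id]
    have h2 := reindex_reordering_eq_tensorEquiv (X := fun _ => N.schur.obj V) σ
      (fun _ => 𝟙 _) (.finRange k) (.finRange k) r
    have step : ∀ {A B C D Z : E} (x : A ⟶ B) (y : B ⟶ C) (x' : A ⟶ C) (m : M.obj (Fin k) ⟶ D)
        (_ : x ≫ y = x') (d : D ⊗ C ⟶ Z), (_ ◁ x) ≫ (m ⊗ₘ y) ≫ d = (m ⊗ₘ x') ≫ d := by
      rintro A B C D Z x y _ m rfl d
      rw [← id_tensorHom, tensorHom_comp_tensorHom_assoc, Category.id_comp]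
    refine step _ _ _ _ ?_ _
    refine (congrArg (_ ≫ ·) h2).trans ((tensorListMap_comp_equiv _ _ _ _ _).trans ?_)
    congr 1
    funext i
    have h3 := N.map_incSchur V (γ i) (fun _ => 𝟙 V) (.finRange _) (.finRange _)
    rw [tensorListMap_id, MonoidalCategory.whiskerLeft_id, Category.id_comp] at h3
    exact (Category.comp_id _).trans h3.symm
  refine ⟨M.coinvDesc (.const _) (fun k _ => d k) hc, fun k m => ?_⟩
  unfold incDouble
  rw [incSchur_fin, ← hd]
  exact (Category.assoc _ _ _).trans (congrArg (_ ≫ ·) (M.inc_coinvDesc (.const _) _ hc ()))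

lemma incDouble_hom_ext {Z : E} {f g : M.schur.obj (N.schur.obj V) ⟶ Z}
    (h : ∀ (k : ℕ) (m : Fin k → ℕ),
      M.incDouble N V (fun i => .finRange (m i)) (.finRange k) ≫ f =
        M.incDouble N V (fun i => .finRange (m i)) (.finRange k) ≫ g) : f = g := by
  refine (M.presents_schur (N.schur.obj V)).epi.hom_ext fun k => ?_
  refine (JointlyEpic.tensorList (k := k) (fun _ => (N.presents_schur V).epi))
    (tensorLeft (M.obj (Fin k))) fun m => ?_
  exact (Category.assoc _ _ _).symm.trans ((h k m).trans (Category.assoc _ _ _))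

/-- The comparison map `(M ∘ N)(V) ⟶ M(N(V))` is an isomorphism. -/
instance isIso_psi : IsIso (M.psi N V) := by
  obtain ⟨θ, hθ⟩ := M.exists_theta N V
  refine ⟨θ, schurIncLeft_hom_ext fun b => ?_, incDouble_hom_ext _ _ _ fun k m => ?_⟩
  · rw [← Category.assoc, schurIncLeft_psi, schurIncRight_eq, hθ, Category.comp_id,
      schurIncLeft_eq]
    have h := M.map_incFlat N V (Equiv.refl (Fin b.k)) b.e (fun _ => Equiv.refl _)
      (sigmaFib (J := fun i => Fin (b.m i))) b.blockEquiv (fun i => .finRange (b.m i))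
      (fun i => .finRange (b.m i)) (.finRange b.k) (.finRange b.k) (isEnum_enum _) (.finRange b.l)
      (Equiv.refl _) (fun _ => rfl) b.e (fun _ => rfl) (fun _ _ => rfl)
    refine h.symm.trans (Eq.trans (congrArg (· ≫ _) ?_) (Category.id_comp _))
    rw [M.map_refl]
    refine (congrArg (_ ⊗ₘ ·) ?_).trans (id_tensorHom_id _ _)
    refine Eq.trans ?_ (tensorEquiv_refl _ (.finRange b.k))
    congr 1
    funext i
    refine (congrArg₂ (· ⊗ₘ ·) (N.map_refl _) (tensorEquiv_refl _ _)).trans (id_tensorHom_id _ _)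
  · rw [← Category.assoc, hθ, Category.comp_id]
    exact M.incFlat_psi N V _ _ _ _ _ _ (fun _ => rfl)

end Inverse

end SymMod

end

end OperadTheory

namespace OperadTheory

open CategoryTheory Limits MonoidalCategory SymMod

noncomputable section

variable {E : Type u} [Category.{v} E] [MonoidalCategory E] [SymmetricCategory E]
  [HasColimitsOfSize.{0, 0} E]

namespace SymMod

lemma incSchur_schurHom_schurHom {M M' M'' : SymMod E} (φ : M ⟶ M') (φ' : M' ⟶ M'') (V : E)
    {S : Type} [Finite S] {m : List S} (hm : IsEnum m) :
    M.incSchur V hm ≫ schurHom φ V ≫ schurHom φ' V =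
      ((φ.app S ≫ φ'.app S) ▷ _) ≫ M''.incSchur V hm := by
  have h1 := M.incSchur_schurHom V φ hm
  have h2 := M'.incSchur_schurHom V φ' hm
  rw [reassoc_of% h1, h2, comp_whiskerRight_assoc]

lemma schur_hom_ext {M : SymMod E} {V Z : E} {f g : M.schur.obj V ⟶ Z}
    (h : ∀ n : ℕ, M.incSchur V (.finRange n) ≫ f = M.incSchur V (.finRange n) ≫ g) : f = g :=
  (M.presents_schur V).epi.hom_ext h

/-- A partition of a finite set into blocks, each of which is partitioned further. -/
def CompIdx.ofMap {S : Type} {k : ℕ} (f : S → Fin k)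
    (g : ∀ i, Σ m : ℕ, ({s // f s = i} → Fin m)) : CompIdx S where
  k := k
  m i := (g i).1
  l := Nat.card (Σ i, Fin (g i).1)
  e := Finite.equivFin _
  r := .ofPerm (((IsEnum.finRange k).sigma fun _ => .finRange _).map _ |>.perm (.finRange _))
  f := f
  g i := (g i).2

lemma jointlyEpic_fibres (M N : SymMod E) (S : Type) [Finite S] :
    JointlyEpic (fun j : Σ k : ℕ, (S → Fin k) => M.inc (.fibres N S) j.2) :=
  fun L _ _ _ _ h => map_coinv_hom_ext L fun k j => h ⟨k, j⟩

variable [∀ X : E, PreservesColimitsOfSize.{0, 0} (tensorLeft X)]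
  [∀ X : E, PreservesColimitsOfSize.{0, 0} (tensorRight X)]

/-- The summands of a triple composition product are jointly epimorphic. -/
lemma jointlyEpic_compIncRight (M N P : SymMod E) (S : Type) [Finite S] :
    JointlyEpic (compIncRight (S := S) M N P) := fun L _ Z x y h => by
  refine M.jointlyEpic_fibres (N.comp P) S L fun ⟨k, f⟩ => ?_
  refine (JointlyEpic.tensorList (k := k) fun i => N.jointlyEpic_fibres P {s // f s = i})
    (tensorLeft (M.obj (Fin k)) ⋙ L) fun g => ?_
  have := h (CompIdx.ofMap f g)
  have step : ∀ {A B C : E} (p : A ⟶ B) (q : B ⟶ C) (x : L.obj C ⟶ Z),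
      L.map p ≫ L.map q ≫ x = L.map (p ≫ q) ≫ x := fun p q x => by
    rw [L.map_comp_assoc]
  exact (step _ _ _).trans (this.trans (step _ _ _).symm)

end SymMod

/-! ### The monad of an operad -/

section Monad

variable [∀ X : E, PreservesColimitsOfSize.{0, 0} (tensorLeft X)]
  [∀ X : E, PreservesColimitsOfSize.{0, 0} (tensorRight X)]

namespace Operad

variable (P : Operad E)

lemma unit_mul (V : E) :
    schurUnit (P.toSymMod.schur.obj V) ≫ schurHom P.one _ ≫
      inv (P.toSymMod.psi P.toSymMod V) ≫ schurHom P.mul V = 𝟙 _ := by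
  refine schur_hom_ext fun n => ?_
  have h1 := leftUnit_psi P.toSymMod V (.finRange n)
  have h2 := schurHom_psi P.one (𝟙 P.toSymMod) V
  rw [schurHom_id, CategoryTheory.Functor.map_id, Category.comp_id] at h2
  rw [← reassoc_of% h1, ← reassoc_of% h2, IsIso.hom_inv_id_assoc, Category.comp_id,
    incSchur_schurHom_schurHom, ← comp_whiskerRight_assoc, P.one_mul, id_whiskerRight,
    Category.id_comp]

lemma map_unit_mul (V : E) :
    P.toSymMod.schur.map (schurUnit V ≫ schurHom P.one V) ≫
      inv (P.toSymMod.psi P.toSymMod V) ≫ schurHom P.mul V = 𝟙 _ := by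
  refine schur_hom_ext fun n => ?_
  have h1 := rightUnit_psi P.toSymMod V n
  have h2 := schurHom_psi (𝟙 P.toSymMod) P.one V
  rw [schurHom_id, Category.id_comp] at h2
  rw [Functor.map_comp, Category.assoc, ← reassoc_of% h1, ← reassoc_of% h2,
    IsIso.hom_inv_id_assoc, Category.comp_id, incSchur_schurHom_schurHom,
    ← comp_whiskerRight_assoc, P.mul_one, id_whiskerRight, Category.id_comp]

lemma map_mul_mul (V : E) :
    P.toSymMod.schur.map (inv (P.toSymMod.psi P.toSymMod V) ≫ schurHom P.mul V) ≫
      inv (P.toSymMod.psi P.toSymMod V) ≫ schurHom P.mul V =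
    (inv (P.toSymMod.psi P.toSymMod (P.toSymMod.schur.obj V)) ≫ schurHom P.mul _) ≫
      inv (P.toSymMod.psi P.toSymMod V) ≫ schurHom P.mul V := by
  rw [← cancel_epi (P.toSymMod.schur.map (P.toSymMod.psi P.toSymMod V)),
    ← cancel_epi (P.toSymMod.psi (P.toSymMod.comp P.toSymMod) V), ← Functor.map_comp_assoc,
    IsIso.hom_inv_id_assoc]
  have h1 := schurHom_psi (𝟙 P.toSymMod) P.mul V
  have h2 := schurHom_psi P.mul (𝟙 P.toSymMod) V
  rw [schurHom_id, Category.id_comp] at h1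
  rw [schurHom_id, CategoryTheory.Functor.map_id, Category.comp_id] at h2
  rw [← reassoc_of% h1, IsIso.hom_inv_id_assoc]
  refine schur_hom_ext fun n => ?_
  refine (jointlyEpic_compIncRight P.toSymMod P.toSymMod P.toSymMod (Fin n))
    (tensorRight (tensorList (fun _ : Fin n => V) (List.finRange n))) fun x => ?_
  have h3 := psi_assoc P.toSymMod P.toSymMod P.toSymMod V x (.finRange n)
  change (compIncRight _ _ _ x ▷ _) ≫ _ = (compIncRight _ _ _ x ▷ _) ≫ _
  simp only [Category.assoc]
  rw [reassoc_of% h3, IsIso.hom_inv_id_assoc, ← reassoc_of% h2, IsIso.hom_inv_id_assoc,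
    incSchur_schurHom_schurHom, incSchur_schurHom_schurHom, ← comp_whiskerRight_assoc,
    ← comp_whiskerRight_assoc, P.mul_assoc]

/-- The monad of an operad. Its underlying functor is the Schur functor. -/
def monad : Monad E where
  toFunctor := P.toSymMod.schur
  η :=
    { app := fun V => schurUnit V ≫ schurHom P.one V
      naturality := fun V W f => by
        have h1 := schurUnit_naturality f
        have h2 := schurHom_naturality P.one f
        change f ≫ schurUnit W ≫ _ = (schurUnit V ≫ schurHom P.one V) ≫ _
        rw [Category.assoc, h2, reassoc_of% h1] }
  μ :=
    { app := fun V => inv (P.toSymMod.psi P.toSymMod V) ≫ schurHom P.mul V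
      naturality := fun V W f => by
        have h1 := map_psi P.toSymMod P.toSymMod f
        have h2 := schurHom_naturality P.mul f
        change P.toSymMod.schur.map (P.toSymMod.schur.map f) ≫ _ = _
        rw [← cancel_epi (P.toSymMod.psi P.toSymMod V), ← reassoc_of% h1, IsIso.hom_inv_id_assoc,
          Category.assoc, IsIso.hom_inv_id_assoc]
        exact h2.symm }
  left_unit V := (Category.assoc _ _ _).trans (P.unit_mul V)
  right_unit V := P.map_unit_mul V
  assoc V := P.map_mul_mul V

variable {P}

lemma Alg.assoc (A : P.Alg) : P.monad.μ.app A.carrier ≫ A.act =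
    P.toSymMod.schur.map A.act ≫ A.act := by
  suffices h : (inv (P.toSymMod.psi P.toSymMod A.carrier) ≫ schurHom P.mul A.carrier) ≫ A.act =
      P.toSymMod.schur.map A.act ≫ A.act from h
  rw [← cancel_epi (P.toSymMod.psi P.toSymMod A.carrier), Category.assoc, IsIso.hom_inv_id_assoc]
  refine schurIncLeft_hom_ext fun b => ?_
  have h := schurIncLeft_psi P.toSymMod P.toSymMod A.carrier b
  rw [reassoc_of% h]
  exact (A.act_act b).symm

/-- An algebra over the monad of an operad is an algebra over the operad. -/
def ofAlgebra (A : E) (a : P.toSymMod.schur.obj A ⟶ A) (h : P.monad.η.app A ≫ a = 𝟙 A)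
    (h' : P.monad.μ.app A ≫ a = P.toSymMod.schur.map a ≫ a) : P.Alg where
  carrier := A
  act := a
  one_act := (Category.assoc _ _ _).symm.trans h
  act_act b := by
    have e : schurHom P.mul A ≫ a = P.toSymMod.psi P.toSymMod A ≫ P.toSymMod.schur.map a ≫ a := by
      rw [← h']
      exact ((Category.assoc _ _ _).symm.trans
        (congrArg (· ≫ a) (IsIso.hom_inv_id_assoc _ _))).symm
    have h := schurIncLeft_psi P.toSymMod P.toSymMod A b
    rw [e, reassoc_of% h]

variable (P)

/-- The free algebra functor. -/
def free : E ⥤ P.Alg where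
  obj V := ofAlgebra (P.toSymMod.schur.obj V) (P.monad.μ.app V) (P.monad.left_unit V)
    (P.monad.assoc V).symm
  map f :=
    { hom := P.toSymMod.schur.map f
      act_hom := (P.monad.μ.naturality f).symm }
  map_id V := Alg.Hom.ext (P.toSymMod.schur.map_id V)
  map_comp f g := Alg.Hom.ext (P.toSymMod.schur.map_comp f g)

/-- The free algebra functor is left adjoint to the forgetful functor. -/
def adj : P.free ⊣ P.forget where
  unit := { app := fun V => P.monad.η.app V, naturality := fun _ _ f => P.monad.η.naturality f }
  counit :=
    { app := fun A => { hom := A.act, act_hom := A.assoc }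
      naturality := fun _ _ f => Alg.Hom.ext f.act_hom.symm }
  left_triangle_components V := Alg.Hom.ext (P.monad.right_unit V)
  right_triangle_components A := (Category.assoc _ _ _).trans A.one_act

instance : (Monad.comparison P.adj).IsEquivalence where
  faithful := ⟨fun h => Alg.Hom.ext (congrArg Monad.Algebra.Hom.f h)⟩
  full := ⟨fun f => ⟨⟨f.f, f.h.symm⟩, rfl⟩⟩
  essSurj := ⟨fun X => ⟨ofAlgebra X.A X.a X.unit X.assoc,
    ⟨Monad.Algebra.isoMk (Iso.refl _) 
      ((congrArg (· ≫ X.a) (P.toSymMod.schur.map_id _)).trans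
        ((Category.id_comp _).trans (Category.comp_id _).symm))⟩⟩⟩

/-- The forgetful functor from algebras over an operad is monadic. -/
instance : MonadicRightAdjoint P.forget where
  L := P.free
  adj := P.adj
  eqv := inferInstance

end Operad

end Monad

section Comonad

variable [∀ X : E, PreservesColimitsOfSize.{0, 0} (tensorRight X)]

/-! ### The comonad of a cooperad -/

namespace SymMod

/-- The two ways of comparing a triple composite with `M(N(P(V)))` agree on the object in which the
two bracketings of the composite are compared. -/
lemma exists_tripleComp_desc (M N P : SymMod E) (V : E) (S : Type) [Finite S] {m : List S}
    (hm : IsEnum m) :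
    ∃ d : tripleComp M N P S ⊗ tensorList (fun _ => V) m ⟶
        M.schur.obj (N.schur.obj (P.schur.obj V)),
      (tripleRight M N P S ▷ _) ≫ d = (M.comp (N.comp P)).incSchur V hm ≫
        M.psi (N.comp P) V ≫ M.schur.map (N.psi P V) ∧
      (tripleLeft M N P S ▷ _) ≫ d = ((M.comp N).comp P).incSchur V hm ≫
        (M.comp N).psi P V ≫ M.psi N (P.schur.obj V) := by
  have hc := isColimitPushoutCoconeMapOfIsColimit (tensorRight (tensorList (fun _ => V) m)) _
    (pushoutIsPushout (Sigma.desc fun x : CompIdx S => compIncRight M N P x)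
      (Sigma.desc fun x : CompIdx S => compIncLeft M N P x))
  obtain ⟨d, h1, h2⟩ := PushoutCocone.IsColimit.desc' hc
    ((M.comp (N.comp P)).incSchur V hm ≫ M.psi (N.comp P) V ≫ M.schur.map (N.psi P V))
    (((M.comp N).comp P).incSchur V hm ≫ (M.comp N).psi P V ≫ M.psi N (P.schur.obj V)) (by
      refine Cofan.IsColimit.hom_ext (isColimitCofanMkObjOfIsColimit
        (tensorRight (tensorList (fun _ => V) m)) _ _
        (coproductIsCoproduct fun x : CompIdx S => compSummand M N P x)) _ _ fun x => ?_
      change (Sigma.ι _ x ▷ _) ≫ (Limits.Sigma.desc _ ▷ _) ≫ _ =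
        (Sigma.ι _ x ▷ _) ≫ (Limits.Sigma.desc _ ▷ _) ≫ _
      rw [← comp_whiskerRight_assoc, ← comp_whiskerRight_assoc, Sigma.ι_desc, Sigma.ι_desc]
      exact psi_assoc M N P V x hm)
  exact ⟨d, h1, h2⟩

end SymMod

namespace Cooperad

variable (C : Cooperad E)

lemma comul_counit_schur (V : E) :
    (schurHom C.comul V ≫ C.toSymMod.psi C.toSymMod V) ≫
      schurHom C.counit _ ≫ inv (schurUnit (C.toSymMod.schur.obj V)) = 𝟙 _ := by
  rw [← cancel_mono (schurUnit (C.toSymMod.schur.obj V))]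
  simp only [Category.assoc, IsIso.inv_hom_id, Category.comp_id, Category.id_comp]
  refine schur_hom_ext fun n => ?_
  have h1 := leftUnit_psi C.toSymMod V (.finRange n)
  have h2 := schurHom_psi C.counit (𝟙 C.toSymMod) V
  rw [schurHom_id, CategoryTheory.Functor.map_id, Category.comp_id] at h2
  have h3 := incSchur_schurHom_schurHom C.comul (compMap C.counit (𝟙 C.toSymMod)) V (.finRange n)
  rw [← h2, reassoc_of% h3, C.counit_comul, h1]

lemma comul_map_counit_schur (V : E) :
    (schurHom C.comul V ≫ C.toSymMod.psi C.toSymMod V) ≫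
      C.toSymMod.schur.map (schurHom C.counit V ≫ inv (schurUnit V)) = 𝟙 _ := by
  rw [← cancel_mono (C.toSymMod.schur.map (schurUnit V)), Functor.map_comp]
  simp only [Category.assoc, ← Functor.map_comp, IsIso.inv_hom_id, Category.comp_id,
    Category.id_comp]
  refine schur_hom_ext fun n => ?_
  have h1 := rightUnit_psi C.toSymMod V n
  have h2 := schurHom_psi (𝟙 C.toSymMod) C.counit V
  rw [schurHom_id, Category.id_comp] at h2
  have h3 := incSchur_schurHom_schurHom C.comul (compMap (𝟙 C.toSymMod) C.counit) V (.finRange n)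
  rw [← h2, reassoc_of% h3, C.comul_counit, h1]

lemma comul_map_comul_schur (V : E) :
    (schurHom C.comul V ≫ C.toSymMod.psi C.toSymMod V) ≫
      C.toSymMod.schur.map (schurHom C.comul V ≫ C.toSymMod.psi C.toSymMod V) =
    (schurHom C.comul V ≫ C.toSymMod.psi C.toSymMod V) ≫
      schurHom C.comul _ ≫ C.toSymMod.psi C.toSymMod _ := by
  have h1 := schurHom_psi (𝟙 C.toSymMod) C.comul V
  have h2 := schurHom_psi C.comul (𝟙 C.toSymMod) V
  rw [schurHom_id, Category.id_comp] at h1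
  rw [schurHom_id, CategoryTheory.Functor.map_id, Category.comp_id] at h2
  rw [Functor.map_comp, Category.assoc, Category.assoc, ← reassoc_of% h1, ← reassoc_of% h2]
  refine schur_hom_ext fun n => ?_
  have h3 := incSchur_schurHom_schurHom C.comul (compMap (𝟙 C.toSymMod) C.comul) V (.finRange n)
  have h4 := incSchur_schurHom_schurHom C.comul (compMap C.comul (𝟙 C.toSymMod)) V (.finRange n)
  rw [reassoc_of% h3, reassoc_of% h4]
  obtain ⟨d, hd1, hd2⟩ := exists_tripleComp_desc C.toSymMod C.toSymMod C.toSymMod V (Fin n)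
    (.finRange n)
  rw [← hd1, ← hd2, ← comp_whiskerRight_assoc, ← comp_whiskerRight_assoc, Category.assoc,
    Category.assoc, C.comul_assoc]

/-- The counit of the comonad of a cooperad. -/
def counitApp (V : E) : C.toSymMod.schur.obj V ⟶ V := schurHom C.counit V ≫ inv (schurUnit V)

lemma counitApp_naturality {V W : E} (f : V ⟶ W) :
    C.toSymMod.schur.map f ≫ C.counitApp W = C.counitApp V ≫ f := by
  have h1 := schurUnit_naturality f
  have h2 := schurHom_naturality C.counit f
  unfold counitApp
  rw [← cancel_mono (schurUnit W), Category.assoc, Category.assoc, Category.assoc,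
    IsIso.inv_hom_id, Category.comp_id, Category.assoc, ← h1, IsIso.inv_hom_id_assoc, h2]

/-- The comonad of a cooperad. Its underlying functor is the Schur functor. -/
def comonad : Comonad E where
  toFunctor := C.toSymMod.schur
  ε :=
    { app := fun V => C.counitApp V
      naturality := fun _ _ f => C.counitApp_naturality f }
  δ :=
    { app := fun V => schurHom C.comul V ≫ C.toSymMod.psi C.toSymMod V
      naturality := fun V W f => by
        have h1 := map_psi C.toSymMod C.toSymMod f
        have h2 := schurHom_naturality C.comul f
        change C.toSymMod.schur.map f ≫ _ = _ ≫ C.toSymMod.schur.map (C.toSymMod.schur.map f)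
        rw [Category.assoc, ← h1, reassoc_of% h2] }
  left_counit V := C.comul_counit_schur V
  right_counit V := C.comul_map_counit_schur V
  coassoc V := C.comul_map_comul_schur V

end Cooperad

namespace SymMod

variable (M N : SymMod E) (V : E)

lemma psi_doubleRight : M.psi N V ≫ doubleRight M N V = doubleLeft M N V := by
  refine schurIncLeft_hom_ext fun b => ?_
  have h := schurIncLeft_psi M N V b
  rw [reassoc_of% h]
  have h' := pushout.condition (f := Sigma.desc fun b : Blocks => schurIncRight M N V b)
    (g := Sigma.desc fun b : Blocks => schurIncLeft M N V b)
  have h'' := congrArg (fun t => Sigma.ι (fun b : Blocks => schurSummand M N V b) b ≫ t) h'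
  simp only [Sigma.ι_desc_assoc] at h''
  exact h''

lemma mono_doubleRight : Mono (doubleRight M N V) := by
  have : doubleRight M N V ≫ pushout.desc (𝟙 _) (M.psi N V) (by
      refine Sigma.hom_ext _ _ fun b => ?_
      rw [Sigma.ι_desc_assoc, Sigma.ι_desc_assoc, Category.comp_id, schurIncLeft_psi]) = 𝟙 _ :=
    pushout.inl_desc _ _ _
  have : IsSplitMono (doubleRight M N V) := ⟨⟨⟨_, this⟩⟩⟩
  infer_instance

end SymMod

namespace Cooperad

variable {C : Cooperad E}

lemma Coalg.counit (A : C.Coalg) : A.coact ≫ C.comonad.ε.app A.carrier = 𝟙 _ := by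
  suffices h : A.coact ≫ schurHom C.counit A.carrier ≫ inv (schurUnit A.carrier) = 𝟙 _ from h
  have h := A.coact_counit
  rw [reassoc_of% h, IsIso.hom_inv_id]

lemma Coalg.coassoc (A : C.Coalg) : A.coact ≫ C.comonad.δ.app A.carrier =
    A.coact ≫ C.toSymMod.schur.map A.coact := by
  suffices h : A.coact ≫ schurHom C.comul A.carrier ≫ C.toSymMod.psi C.toSymMod A.carrier =
    A.coact ≫ C.toSymMod.schur.map A.coact from h
  have := mono_doubleRight C.toSymMod C.toSymMod A.carrier
  rw [← cancel_mono (doubleRight C.toSymMod C.toSymMod A.carrier)]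
  simp only [Category.assoc]
  rw [psi_doubleRight, A.coact_coact]

/-- A coalgebra over the comonad of a cooperad is a coalgebra over the cooperad. -/
def ofCoalgebra (A : E) (a : A ⟶ C.toSymMod.schur.obj A) (h : a ≫ C.comonad.ε.app A = 𝟙 A)
    (h' : a ≫ C.comonad.δ.app A = a ≫ C.toSymMod.schur.map a) : C.Coalg where
  carrier := A
  coact := a
  coact_counit := by
    have e : a ≫ schurHom C.counit A ≫ inv (schurUnit A) = 𝟙 A := h
    rw [← cancel_mono (inv (schurUnit A)), Category.assoc, e, IsIso.hom_inv_id]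
  coact_coact := by
    have e : a ≫ schurHom C.comul A ≫ C.toSymMod.psi C.toSymMod A =
      a ≫ C.toSymMod.schur.map a := h'
    rw [← reassoc_of% e, psi_doubleRight]

variable (C)

/-- The cofree coalgebra functor. -/
def cofree : E ⥤ C.Coalg where
  obj V := ofCoalgebra (C.toSymMod.schur.obj V) (C.comonad.δ.app V) (C.comonad.left_counit V)
    (C.comonad.coassoc V).symm
  map f :=
    { hom := C.toSymMod.schur.map f
      coact_hom := (C.comonad.δ.naturality f).symm }
  map_id V := Coalg.Hom.ext (C.toSymMod.schur.map_id V)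
  map_comp f g := Coalg.Hom.ext (C.toSymMod.schur.map_comp f g)

/-- The cofree coalgebra functor is right adjoint to the forgetful functor. -/
def adj : C.forget ⊣ C.cofree where
  unit :=
    { app := fun A => { hom := A.coact, coact_hom := A.coassoc.symm }
      naturality := fun _ _ f => Coalg.Hom.ext f.coact_hom.symm }
  counit :=
    { app := fun V => C.comonad.ε.app V
      naturality := fun _ _ f => C.comonad.ε.naturality f }
  left_triangle_components A := A.counit
  right_triangle_components V := Coalg.Hom.ext (C.comonad.right_counit V)

instance : (Comonad.comparison C.adj).IsEquivalence where
  faithful := ⟨fun h => Coalg.Hom.ext (congrArg Comonad.Coalgebra.Hom.f h)⟩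
  full := ⟨fun f => ⟨⟨f.f, f.h⟩, rfl⟩⟩
  essSurj := ⟨fun X => ⟨ofCoalgebra X.A X.a X.counit X.coassoc,
    ⟨Comonad.Coalgebra.isoMk (Iso.refl _)
      ((congrArg (X.a ≫ ·) (C.toSymMod.schur.map_id _)).trans
        ((Category.comp_id _).trans (Category.id_comp _).symm))⟩⟩⟩

/-- The forgetful functor from conilpotent coalgebras over a cooperad is comonadic. -/
instance : ComonadicLeftAdjoint C.forget where
  R := C.cofree
  adj := C.adj
  eqv := inferInstance

end Cooperad

end Comonad

end

end OperadTheory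

namespace OperadTheory

open CategoryTheory Limits MonoidalCategory SymMod

noncomputable section

/-! ### Sifted colimits and Schur functors -/

section Reflexive

open WalkingReflexivePair WalkingReflexivePair.Hom

/-- The morphism to the object `one` that is a section of `left` and of `right`, or an identity. -/
def toOne : ∀ a : WalkingReflexivePair, a ⟶ WalkingReflexivePair.one
  | .zero => reflexion
  | .one => 𝟙 _

lemma eq_toOne_comp : ∀ {a : WalkingReflexivePair} (f : a ⟶ WalkingReflexivePair.zero),
    f = toOne a ≫ left ∨ f = toOne a ≫ right
  | .zero, .id _ => Or.inl rfl
  | .one, left => Or.inl rfl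
  | .one, right => Or.inr rfl

/-- Reflexive coequalizers are sifted colimits. -/
instance : IsSifted WalkingReflexivePair where
  out := by
    rintro ⟨a, b⟩
    let D := Functor.diag WalkingReflexivePair
    let S := StructuredArrow (a, b) D
    let o {c : WalkingReflexivePair} (f : a ⟶ c) (g : b ⟶ c) : S :=
      StructuredArrow.mk (Y := c) (T := D) (f, g)
    have push : ∀ {c d : WalkingReflexivePair} (f : a ⟶ c) (g : b ⟶ c) (h : c ⟶ d)
        (f' : a ⟶ d) (g' : b ⟶ d), f ≫ h = f' → g ≫ h = g' → Zag (o f g) (o f' g') := by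
      intro c d f g h f' g' e e'
      exact Zag.of_hom (StructuredArrow.homMk h (Prod.ext e e'))
    have : Nonempty S := ⟨o (toOne a) (toOne b)⟩
    let base : S := o (toOne a ≫ left) (toOne b ≫ left)
    have e : ∀ c, (toOne c ≫ left ≫ reflexion) ≫ left = toOne c ≫ left ∧
        (toOne c ≫ left ≫ reflexion) ≫ right = toOne c ≫ left := by
      rintro (_ | _) <;> exact ⟨rfl, rfl⟩
    have key : ∀ f : a ⟶ zero, ∀ g : b ⟶ zero, Zigzag (o f g) base := by
      intro f g
      rcases eq_toOne_comp f with rfl | rfl <;> rcases eq_toOne_comp g with rfl | rfl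
      · exact .refl _
      · exact .trans (.of_zag (push (toOne a ≫ left ≫ reflexion) (toOne b) right _ _
          (e _).2 rfl).symm) (.of_zag (push _ _ left _ _ (e _).1 rfl))
      · exact .trans (.of_zag (push (toOne a) (toOne b ≫ left ≫ reflexion) right _ _
          rfl (e _).2).symm) (.of_zag (push _ _ left _ _ rfl (e _).1))
      · exact .trans (.of_zag (push (toOne a) (toOne b) right _ _ rfl rfl).symm)
          (.of_zag (push _ _ left _ _ rfl rfl))
    have all : ∀ x : S, Zigzag x base := by
      rintro ⟨⟨⟨⟩⟩, c, f⟩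
      cases c with
      | zero => exact key f.1 f.2
      | one => exact .trans (.of_zag (push f.1 f.2 left _ _ rfl rfl)) (key _ _)
    exact zigzag_isConnected fun x y => (all x).trans (all y).symm
  nonempty := ⟨WalkingReflexivePair.zero⟩

end Reflexive

section Schur

variable {E : Type u} [Category.{v} E] [MonoidalCategory E]

section TensorPower

/-- The tensor power `V ↦ V ⊗ ⋯ ⊗ V` along a list of indices. -/
def tensorPower (E : Type u) [Category.{v} E] [MonoidalCategory E] {ι : Type} (l : List ι) :
    E ⥤ E where
  obj V := tensorList (fun _ => V) l
  map f := tensorListMap (fun _ => f) l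
  map_id _ := tensorListMap_id _ l
  map_comp _ _ := (tensorListMap_comp _ _ l).symm

variable {J : Type*} [Category* J] [IsSifted J]
  [∀ X : E, PreservesColimitsOfShape J (tensorLeft X)]
  [∀ X : E, PreservesColimitsOfShape J (tensorRight X)]

instance preservesColimitsOfShape_tensorPower {ι : Type} (l : List ι) :
    PreservesColimitsOfShape J (tensorPower E l) := by
  induction l with
  | nil =>
    exact ⟨fun {F} => ⟨fun {c} _ => ⟨isColimitConstCocone J (𝟙_ E)⟩⟩⟩
  | cons a l ih =>
    refine ⟨fun {F} => ⟨fun {c} hc => ?_⟩⟩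
    have : ∀ X : E, PreservesColimit (F ⋙ tensorPower E l) ((curriedTensor E).obj X) := fun X =>
      inferInstanceAs (PreservesColimit _ (tensorLeft X))
    have : ∀ X : E, PreservesColimit F ((curriedTensor E).flip.obj X) := fun X =>
      inferInstanceAs (PreservesColimit _ (tensorRight X))
    exact ⟨IsColimit.tensor hc (isColimitOfPreserves (tensorPower E l) hc)⟩

end TensorPower

/-- A functor that is naturally a quotient of a coproduct of functors by symmetries preserves the
colimits that these functors preserve. -/
lemma preservesColimitsOfShape_of_presentation {D D' : Type*} [Category* D] [Category* D']
    {J : Type*} [Category* J] {S : D ⥤ D'} {I : Type*} {G : I → D ⥤ D'} (inc : ∀ m, G m ⟶ S)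
    {R : I → Type*}
    (act : ∀ m, R m → (G m ⟶ G m)) (act_inc : ∀ m σ, act m σ ≫ inc m = inc m)
    (ext : ∀ {V : D} {Z : D'} {f g : S.obj V ⟶ Z},
      (∀ m, (inc m).app V ≫ f = (inc m).app V ≫ g) → f = g)
    (desc : ∀ {V : D} {Z : D'} (g : ∀ m, (G m).obj V ⟶ Z), (∀ m σ, (act m σ).app V ≫ g m = g m) →
      ∃ d, ∀ m, (inc m).app V ≫ d = g m) [∀ m, PreservesColimitsOfShape J (G m)] :
    PreservesColimitsOfShape J S := by
  refine ⟨fun {F} => ⟨fun {c} hc => ?_⟩⟩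
  have hG (m : I) : IsColimit ((G m).mapCocone c) := isColimitOfPreserves (G m) hc
  have hdesc (s : Cocone (F ⋙ S)) : ∃ d : S.obj c.pt ⟶ s.pt,
      ∀ j, S.map (c.ι.app j) ≫ d = s.ι.app j := by
    let g (m : I) : (G m).obj c.pt ⟶ s.pt := (hG m).desc
      { pt := s.pt, ι := Functor.whiskerLeft F (inc m) ≫ s.ι }
    have hg (m : I) (j : J) : (G m).map (c.ι.app j) ≫ g m = (inc m).app (F.obj j) ≫ s.ι.app j :=
      (hG m).fac _ j
    obtain ⟨d, hd⟩ := desc g (by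
      refine fun m σ => (hG m).hom_ext fun j => ?_
      change (G m).map (c.ι.app j) ≫ (act m σ).app _ ≫ g m = (G m).map (c.ι.app j) ≫ g m
      have h1 := (act m σ).naturality (c.ι.app j)
      have h2 := congrArg (fun t => NatTrans.app t (F.obj j)) (act_inc m σ)
      refine (Category.assoc _ _ _).symm.trans ((congrArg (· ≫ g m) h1).trans ?_)
      refine (Category.assoc _ _ _).trans ((congrArg (_ ≫ ·) (hg m j)).trans ?_)
      refine (Category.assoc _ _ _).symm.trans ((congrArg (· ≫ s.ι.app j) h2).trans ?_)
      exact (hg m j).symm)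
    refine ⟨d, fun j => ext fun m => ?_⟩
    have h := (inc m).naturality (c.ι.app j)
    refine (Category.assoc _ _ _).symm.trans ((congrArg (· ≫ d) h.symm).trans ?_)
    refine (Category.assoc _ _ _).trans ((congrArg (_ ≫ ·) (hd m)).trans ?_)
    exact hg m j
  refine ⟨{ desc := fun s => (hdesc s).choose, fac := fun s => (hdesc s).choose_spec,
            uniq := fun s f hf => ext fun m => (hG m).hom_ext fun j => ?_ }⟩
  have h := (inc m).naturality (c.ι.app j)
  have h' : S.map (c.ι.app j) ≫ f = S.map (c.ι.app j) ≫ (hdesc s).choose :=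
    (hf j).trans ((hdesc s).choose_spec j).symm
  have key : ∀ t : S.obj c.pt ⟶ s.pt, (G m).map (c.ι.app j) ≫ (inc m).app c.pt ≫ t =
      (inc m).app _ ≫ S.map (c.ι.app j) ≫ t := fun t =>
    (Category.assoc _ _ _).symm.trans ((congrArg (· ≫ t) h).trans (Category.assoc _ _ _))
  exact (key _).trans ((congrArg (_ ≫ ·) h').trans (key _).symm)

variable [SymmetricCategory E] [HasColimitsOfSize.{0, 0} E]

/-- Schur functors preserve sifted colimits if the tensor product does so in each variable. -/
instance SymMod.preservesColimitsOfShape_schur (M : SymMod E) {J : Type*} [Category* J]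
    [IsSifted J] [∀ X : E, PreservesColimitsOfShape J (tensorLeft X)]
    [∀ X : E, PreservesColimitsOfShape J (tensorRight X)] :
    PreservesColimitsOfShape J M.schur :=
  preservesColimitsOfShape_of_presentation
    (G := fun m : ℕ => tensorPower E (List.finRange m) ⋙ tensorLeft (M.obj (Fin m)))
    (R := fun m => Equiv.Perm (Fin m))
    (inc := fun m =>
      { app := fun V => M.incSchur V (.finRange m)
        naturality := fun V W f => (M.incSchur_map f (.finRange m)).symm })
    (act := fun m σ =>
      { app := fun V => M.map σ ⊗ₘ
          tensorEquiv (X := fun _ => V) σ (fun _ => 𝟙 V) (.finRange m) (.finRange m)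
        naturality := fun V W f => by
          suffices h : (M.obj (Fin m) ◁ tensorListMap (fun _ => f) _) ≫ (M.map σ ⊗ₘ
              tensorEquiv (X := fun _ => W) σ (fun _ => 𝟙 W) (.finRange m) (.finRange m)) =
              (M.map σ ⊗ₘ
              tensorEquiv (X := fun _ => V) σ (fun _ => 𝟙 V) (.finRange m) (.finRange m)) ≫
                (M.obj (Fin m) ◁ tensorListMap (fun _ => f) _) from h
          rw [← id_tensorHom, tensorHom_comp_tensorHom, tensorHom_comp_tensorHom,
            Category.id_comp, Category.comp_id, tensorListMap_comp_equiv,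
            tensorEquiv_comp_listMap, Category.comp_id, Category.id_comp] })
    (act_inc := fun m σ => by
      ext V
      have h := M.map_incSchur V σ (fun _ => 𝟙 _) (.finRange m) (.finRange m)
      rw [tensorListMap_id, MonoidalCategory.whiskerLeft_id, Category.id_comp] at h
      exact h)
    (ext := fun h => schur_hom_ext h)
    (desc := fun {V _} g hg => (M.presents_schur V).desc (𝟭 E) g fun m m' ρ h => by
      cases h with | mk σ
      exact hg m σ)

end Schur

/-! ### Local presentability of categories of algebras -/

section Algebras

variable {C : Type u} [Category.{v} C] (T : Monad C)

lemma whiskerRight_counit_app {J : Type*} [Category* J] (X : J ⥤ T.Algebra) (j : J) :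
    ((T.adj.whiskerRight J).counit.app X).app j = T.adj.counit.app (X.obj j) :=
  (Category.id_comp _).trans (Category.comp_id _)

lemma adj_counit_app (A : T.Algebra) : T.adj.counit.app A = Monad.FreeCoequalizer.π A := by
  ext
  simp
  rfl

/-- Every algebra is a coequalizer of free algebras. -/
def isColimitCoforkCounit (A : T.Algebra) {l r : T.free.obj (T.obj A.A) ⟶ T.free.obj A.A}
    {p : T.free.obj A.A ⟶ A} (hl : l = Monad.FreeCoequalizer.topMap A)
    (hr : r = Monad.FreeCoequalizer.bottomMap A) (hp : p = Monad.FreeCoequalizer.π A)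
    (w : l ≫ p = r ≫ p) : IsColimit (Cofork.ofπ p w) := by
  subst hl hr hp
  exact Monad.beckAlgebraCoequalizer A

/-- The counit of the free-forgetful adjunction of a category of algebras, applied to a diagram, is
a regular epimorphism of diagrams: it is a coequalizer of diagrams of free algebras. -/
def regularEpiWhiskerRightCounit {J : Type*} [Category* J] (X : J ⥤ T.Algebra) :
    RegularEpi ((T.adj.whiskerRight J).counit.app X) where
  W := X ⋙ T.forget ⋙ T.free ⋙ T.forget ⋙ T.free
  left :=
    { app := fun j => T.free.map (T.forget.map (T.adj.counit.app (X.obj j)))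
      naturality := fun i j f =>
        (congrArg (fun t => T.free.map (T.forget.map t)) (T.adj.counit.naturality (X.map f)) ▸
          (T.forget ⋙ T.free).map_comp _ _).symm.trans ((T.forget ⋙ T.free).map_comp _ _) }
  right :=
    { app := fun j => T.adj.counit.app (T.free.obj (T.forget.obj (X.obj j)))
      naturality := fun i j f =>
        T.adj.counit.naturality (T.free.map (T.forget.map (X.map f))) }
  w := by
    ext j : 2
    change _ ≫ ((T.adj.whiskerRight J).counit.app X).app j =
      _ ≫ ((T.adj.whiskerRight J).counit.app X).app j
    rw [whiskerRight_counit_app]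
    exact T.adj.counit.naturality (T.adj.counit.app (X.obj j))
  isColimit := evaluationJointlyReflectsColimits _ fun j =>
    (isColimitMapCoconeCoforkEquiv ((evaluation J T.Algebra).obj j) _).symm
      (isColimitCoforkCounit T (X.obj j)
        (congrArg (fun t => T.free.map (T.forget.map t)) (adj_counit_app T _))
        ((adj_counit_app T _).trans (Monad.Algebra.Hom.ext rfl))
        ((whiskerRight_counit_app T X j).trans (adj_counit_app T _)) _)

/-- The constant diagram functor for algebras has a left adjoint by the adjoint triangle theorem:
its composite with the forgetful functor is the forgetful functor followed by the constant diagram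
functor of the base, which has a left adjoint. -/
lemma hasColimitsOfShape_algebra [HasReflexiveCoequalizers T.Algebra] (J : Type*) [Category* J]
    [HasColimitsOfShape J C] : HasColimitsOfShape J T.Algebra := by
  rw [hasColimitsOfShape_iff_isRightAdjoint_const]
  have : T.forget.IsRightAdjoint := T.adj.isRightAdjoint
  have : (Functor.const J : C ⥤ J ⥤ C).IsRightAdjoint :=
    hasColimitsOfShape_iff_isRightAdjoint_const.1 inferInstance
  have : ((Functor.const J : T.Algebra ⥤ J ⥤ T.Algebra) ⋙
      (Functor.whiskeringRight J T.Algebra C).obj T.forget).IsRightAdjoint :=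
    inferInstanceAs (T.forget ⋙ (Functor.const J : C ⥤ J ⥤ C)).IsRightAdjoint
  exact isRightAdjoint_triangle_lift _ (T.adj.whiskerRight J) (regularEpiWhiskerRightCounit T)

lemma hasReflexiveCoequalizers_algebra [HasColimitsOfShape WalkingReflexivePair C]
    [PreservesColimitsOfShape WalkingReflexivePair T.toFunctor] :
    HasReflexiveCoequalizers T.Algebra := by
  rw [← hasReflexiveCoequalizers_iff]
  exact ⟨fun K => hasColimit_of_created K T.forget⟩

/-- The category of algebras over an accessible monad that preserves reflexive coequalizers, on a
locally presentable category, is locally presentable. It is generated by the free algebras on a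
generator. -/
lemma isCardinalLocallyPresentable_algebra (κ : Cardinal.{w}) [Fact κ.IsRegular]
    [IsCardinalLocallyPresentable C κ] [HasColimitsOfShape WalkingReflexivePair C]
    [PreservesColimitsOfShape WalkingReflexivePair T.toFunctor]
    [T.toFunctor.IsCardinalAccessible κ] : IsCardinalLocallyPresentable T.Algebra κ := by
  have := hasReflexiveCoequalizers_algebra T
  have : HasColimitsOfSize.{w, w} T.Algebra := ⟨fun J _ => hasColimitsOfShape_algebra T J⟩
  have : LocallySmall.{w} T.Algebra := locallySmall_of_faithful T.forget
  have : T.forget.IsCardinalAccessible κ := ⟨fun J _ _ => by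
    have := T.toFunctor.preservesColimitsOfShape_of_isCardinalAccessible κ J
    exact ⟨fun {K} => preservesColimit_of_createsColimit_and_hasColimit _ _⟩⟩
  rw [IsCardinalLocallyPresentable.iff_exists_isStrongGenerator]
  obtain ⟨P, _, hP, hP'⟩ :=
    (IsCardinalLocallyPresentable.iff_exists_isStrongGenerator C κ).1 inferInstance
  refine ⟨.ofObj fun X : Subtype P => T.free.obj X.1, inferInstance, ?_, ?_⟩
  · rw [ObjectProperty.isStrongGenerator_iff]
    constructor
    · intro A B f g h
      refine T.forget.map_injective (hP.isSeparating _ _ fun G hG x => ?_)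
      have := h _ (.mk (⟨G, hG⟩ : Subtype P)) ((T.adj.homEquiv _ _).symm x)
      rw [← T.adj.homEquiv_naturality_right_symm, ← T.adj.homEquiv_naturality_right_symm] at this
      exact (T.adj.homEquiv _ _).symm.injective this
    · intro A B i _ h
      have : T.forget.IsRightAdjoint := T.adj.isRightAdjoint
      have : IsIso (T.forget.map i) := hP.isIso_of_mono _ fun G hG x => by
        obtain ⟨y, hy⟩ := h _ (.mk (⟨G, hG⟩ : Subtype P)) ((T.adj.homEquiv _ _).symm x)
        refine ⟨T.adj.homEquiv _ _ y, ?_⟩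
        have hy' : y ≫ i = (T.adj.homEquiv _ _).symm x := hy
        change T.adj.homEquiv _ _ y ≫ T.forget.map i = x
        rw [← T.adj.homEquiv_naturality_right, hy', Equiv.apply_symm_apply]
      exact isIso_of_reflects_iso i T.forget
  · rintro _ ⟨X, hX⟩
    have : IsCardinalPresentable X κ := hP' _ hX
    exact T.adj.isCardinalPresentable_leftAdjoint_obj κ X

end Algebras

/-! ### Local presentability of categories of coalgebras -/

section Coalgebras

variable {C : Type u} [Category.{w} C]

/-- A sequence of objects with maps `a n : X n ⟶ G (X (n + 1))` that satisfy the axioms of a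
coalgebra over the comonad `G` up to the transition maps of the sequence. Its colimit is a
coalgebra. -/
structure Ladder (G : Comonad C) where
  X : ℕ → C
  d (n : ℕ) : X n ⟶ X (n + 1)
  a (n : ℕ) : X n ⟶ G.obj (X (n + 1))
  d_a (n : ℕ) : d n ≫ a (n + 1) = a n ≫ G.map (d (n + 1))
  a_counit (n : ℕ) : a n ≫ G.ε.app _ = d n
  a_a (n : ℕ) : a n ≫ G.map (a (n + 1)) = a n ≫ G.δ.app _ ≫ G.map (G.map (d (n + 1)))

namespace Ladder

variable {G : Comonad C} (l : Ladder G) [HasColimitsOfShape ℕ C]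

/-- The colimit of a ladder. -/
def colim : C := colimit (Functor.ofSequence l.d)

/-- The maps into the colimit of a ladder. -/
def inc (n : ℕ) : l.X n ⟶ l.colim := colimit.ι (Functor.ofSequence l.d) n

lemma d_inc (n : ℕ) : l.d n ≫ l.inc (n + 1) = l.inc n := by
  have h := colimit.w (Functor.ofSequence l.d) (homOfLE (Nat.le_add_right n 1))
  rwa [Functor.ofSequence_map_homOfLE_succ] at h

variable {l} in
lemma hom_ext {Z : C} {f g : l.colim ⟶ Z} (h : ∀ n, l.inc n ≫ f = l.inc n ≫ g) : f = g :=
  colimit.hom_ext h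

lemma exists_desc {Z : C} (f : ∀ n, l.X n ⟶ Z) (h : ∀ n, l.d n ≫ f (n + 1) = f n) :
    ∃ g : l.colim ⟶ Z, ∀ n, l.inc n ≫ g = f n := by
  let c : Cocone (Functor.ofSequence l.d) :=
    { pt := Z
      ι := NatTrans.ofSequence f fun n => by
        rw [Functor.ofSequence_map_homOfLE_succ]
        exact (h n).trans (Category.comp_id _).symm }
  exact ⟨colimit.desc _ c, fun n => colimit.ι_desc c n⟩

lemma exists_str : ∃ s : l.colim ⟶ G.obj l.colim,
    ∀ n, l.inc n ≫ s = l.a n ≫ G.map (l.inc (n + 1)) :=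
  l.exists_desc _ fun n => by
    have h := l.d_a n
    rw [reassoc_of% h, ← G.map_comp, d_inc]

/-- The structure map of the colimit of a ladder. -/
def str : l.colim ⟶ G.obj l.colim := l.exists_str.choose

lemma inc_str (n : ℕ) : l.inc n ≫ l.str = l.a n ≫ G.map (l.inc (n + 1)) :=
  l.exists_str.choose_spec n

/-- The colimit of a ladder is a coalgebra, in such a way that the maps `a n` are restrictions of
the structure map. -/
def coalgebra : G.Coalgebra where
  A := l.colim
  a := l.str
  counit := hom_ext fun n => by
    have h : G.map (l.inc (n + 1)) ≫ G.ε.app l.colim = G.ε.app _ ≫ l.inc (n + 1) :=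
      G.ε.naturality (l.inc (n + 1))
    have h' := l.inc_str n
    have h'' := l.a_counit n
    rw [reassoc_of% h', h, reassoc_of% h'', d_inc, Category.comp_id]
  coassoc := hom_ext fun n => by
    have h : G.map (l.inc (n + 1)) ≫ G.δ.app l.colim =
      G.δ.app _ ≫ G.map (G.map (l.inc (n + 1))) := G.δ.naturality (l.inc (n + 1))
    have h' := l.inc_str n
    have h'' := l.a_a n
    rw [reassoc_of% h', reassoc_of% h', h, ← G.map_comp, l.inc_str, G.map_comp, reassoc_of% h'',
      ← G.map_comp, ← G.map_comp, d_inc]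

lemma map_inc_zero {B : G.Coalgebra} (r : B.A ⟶ l.X 0)
    (h : r ≫ l.a 0 = B.a ≫ G.map r ≫ G.map (l.d 0)) :
    B.a ≫ G.map (r ≫ l.inc 0) = (r ≫ l.inc 0) ≫ l.str := by
  rw [Category.assoc, l.inc_str, reassoc_of% h, ← G.map_comp, ← G.map_comp, l.d_inc]

end Ladder

section Presentation

variable {G : Comonad C} {κ : Cardinal.{w}} [Fact κ.IsRegular]
  {J : Type w} [SmallCategory J] [IsCardinalFiltered J κ] {D : J ⥤ C} {c : Cocone D}

/-- An approximation of the structure map of a coalgebra `A`, presented as a filtered colimit of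
objects `D j`, by a map into one of the `G (D j)`. -/
structure Stage (c : Cocone D) (a : c.pt ⟶ G.obj c.pt) where
  Y : C
  j : J
  y : Y ⟶ D.obj j
  p : Y ⟶ G.obj (D.obj j)
  w : p ≫ G.map (c.ι.app j) = y ≫ c.ι.app j ≫ a

variable (κ) [∀ j, IsCardinalPresentable (D.obj j) κ]

/-- The inductive step in the construction of a ladder over a coalgebra: the restriction of the
structure map to `D s.j` lifts to a map `b` into some `G (D k)`, which extends the lift `s.p` and
satisfies the axioms of a coalgebra after passage to `D k`. Each condition holds in the colimit,
hence at some later stage. -/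
lemma Stage.exists_next [G.toFunctor.IsCardinalAccessible κ] (hc : IsColimit c)
    (a : c.pt ⟶ G.obj c.pt) (ha : a ≫ G.ε.app _ = 𝟙 _) (ha' : a ≫ G.δ.app _ = a ≫ G.map a)
    (s : Stage c a) [IsCardinalPresentable s.Y κ] :
    ∃ (k : J) (u : s.j ⟶ k) (b : D.obj s.j ⟶ G.obj (D.obj k)),
      b ≫ G.map (c.ι.app k) = c.ι.app s.j ≫ a ∧ b ≫ G.ε.app _ = D.map u ∧
      s.y ≫ b = s.p ≫ G.map (D.map u) ∧
      s.p ≫ G.map b = s.p ≫ G.δ.app _ ≫ G.map (G.map (D.map u)) := by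
  have := G.toFunctor.preservesColimitsOfShape_of_isCardinalAccessible κ J
  have := isFiltered_of_isCardinalFiltered J κ
  have hG := isColimitOfPreserves G.toFunctor hc
  have hGG := isColimitOfPreserves G.toFunctor hG
  have mapw : ∀ {i j : J} (f : i ⟶ j), G.map (D.map f) ≫ G.map (c.ι.app j) = G.map (c.ι.app i) :=
    fun f => by rw [← G.map_comp, c.w]
  obtain ⟨k, u, b, h1⟩ : ∃ (k : J) (_ : s.j ⟶ k) (b : D.obj s.j ⟶ G.obj (D.obj k)),
      b ≫ G.map (c.ι.app k) = c.ι.app s.j ≫ a := by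
    obtain ⟨k, b, h⟩ := IsCardinalPresentable.exists_hom_of_isColimit κ hG (c.ι.app s.j ≫ a)
    refine ⟨IsFiltered.max s.j k, IsFiltered.leftToMax _ _,
      b ≫ G.map (D.map (IsFiltered.rightToMax _ _)), ?_⟩
    rw [Category.assoc, mapw]
    exact h
  obtain ⟨k, u, b, h1, h2⟩ : ∃ (k : J) (u : s.j ⟶ k) (b : D.obj s.j ⟶ G.obj (D.obj k)),
      b ≫ G.map (c.ι.app k) = c.ι.app s.j ≫ a ∧ b ≫ G.ε.app _ = D.map u := by
    have e : G.ε.app (D.obj k) ≫ c.ι.app k = G.map (c.ι.app k) ≫ G.ε.app c.pt :=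
      (G.ε.naturality (c.ι.app k)).symm
    obtain ⟨l, v, h⟩ := IsCardinalPresentable.exists_eq_of_isColimit' κ hc
      (b ≫ G.ε.app _) (D.map u) (by
        rw [Category.assoc, e, reassoc_of% h1, ha, c.w]
        exact Category.comp_id _)
    refine ⟨l, u ≫ v, b ≫ G.map (D.map v), by rw [Category.assoc, mapw, h1], ?_⟩
    have e' : G.map (D.map v) ≫ G.ε.app _ = G.ε.app _ ≫ D.map v := G.ε.naturality (D.map v)
    rw [Category.assoc, e', ← Category.assoc, h, D.map_comp]
  obtain ⟨k, u, b, h1, h2, h3⟩ : ∃ (k : J) (u : s.j ⟶ k) (b : D.obj s.j ⟶ G.obj (D.obj k)),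
      b ≫ G.map (c.ι.app k) = c.ι.app s.j ≫ a ∧ b ≫ G.ε.app _ = D.map u ∧
      s.y ≫ b = s.p ≫ G.map (D.map u) := by
    obtain ⟨l, v, h⟩ := IsCardinalPresentable.exists_eq_of_isColimit' κ hG
      (s.y ≫ b) (s.p ≫ G.map (D.map u)) (by
        change (s.y ≫ b) ≫ G.map (c.ι.app k) = (s.p ≫ G.map (D.map u)) ≫ G.map (c.ι.app k)
        rw [Category.assoc, Category.assoc, mapw, h1, s.w])
    have h' : (s.y ≫ b) ≫ G.map (D.map v) = (s.p ≫ G.map (D.map u)) ≫ G.map (D.map v) := h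
    refine ⟨l, u ≫ v, b ≫ G.map (D.map v), by rw [Category.assoc, mapw, h1], ?_, ?_⟩
    · have e' : G.map (D.map v) ≫ G.ε.app _ = G.ε.app _ ≫ D.map v := G.ε.naturality (D.map v)
      rw [Category.assoc, e', ← Category.assoc, h2, D.map_comp]
    · rw [← Category.assoc, h', Category.assoc, ← G.map_comp, D.map_comp]
  have e : G.δ.app (D.obj s.j) ≫ G.map (G.map (c.ι.app s.j)) = G.map (c.ι.app s.j) ≫ G.δ.app c.pt :=
    (G.δ.naturality (c.ι.app s.j)).symm
  have e2 : G.map (G.map (D.map u)) ≫ G.map (G.map (c.ι.app k)) = G.map (G.map (c.ι.app s.j)) := by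
    rw [← G.map_comp, mapw]
  obtain ⟨l, v, h⟩ := IsCardinalPresentable.exists_eq_of_isColimit' κ hGG
    (s.p ≫ G.map b) (s.p ≫ G.δ.app _ ≫ G.map (G.map (D.map u))) (by
      change (s.p ≫ G.map b) ≫ G.map (G.map (c.ι.app k)) =
        (s.p ≫ G.δ.app _ ≫ G.map (G.map (D.map u))) ≫ G.map (G.map (c.ι.app k))
      have h0 := s.w
      rw [Category.assoc, Category.assoc, Category.assoc, e2, e, ← G.map_comp, h1, G.map_comp,
        reassoc_of% h0, reassoc_of% h0, ha'])
  have h' : (s.p ≫ G.map b) ≫ G.map (G.map (D.map v)) =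
    (s.p ≫ G.δ.app _ ≫ G.map (G.map (D.map u))) ≫ G.map (G.map (D.map v)) := h
  refine ⟨l, u ≫ v, b ≫ G.map (D.map v), by rw [Category.assoc, mapw, h1], ?_, ?_, ?_⟩
  · have e' : G.map (D.map v) ≫ G.ε.app _ = G.ε.app _ ≫ D.map v := G.ε.naturality (D.map v)
    rw [Category.assoc, e', ← Category.assoc, h2, D.map_comp]
  · rw [← Category.assoc, h3, Category.assoc, ← G.map_comp, D.map_comp]
  · rw [G.map_comp, ← Category.assoc, h', Category.assoc, Category.assoc, ← G.map_comp,
      ← G.map_comp, D.map_comp]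

end Presentation

section LocallyPresentable

variable {G : Comonad C} {κ : Cardinal.{w}} [Fact κ.IsRegular]

lemma Ladder.isCardinalPresentable (hκ : Cardinal.aleph0 < κ) [HasColimitsOfShape ℕ C]
    (l : Ladder G) [∀ n, IsCardinalPresentable (l.X n) κ] : IsCardinalPresentable l.colim κ := by
  have (n : ℕ) : IsCardinalPresentable ((Functor.ofSequence l.d).obj n) κ :=
    inferInstanceAs (IsCardinalPresentable (l.X n) κ)
  refine isCardinalPresentable_of_isColimit _ (colimit.isColimit (Functor.ofSequence l.d)) κ ?_
  have : Countable (Arrow ℕ) := by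
    refine Function.Injective.countable (f := fun f : Arrow ℕ => (f.left, f.right)) ?_
    rintro ⟨a, b, f⟩ ⟨a', b', f'⟩ h
    obtain ⟨rfl, rfl⟩ := Prod.mk.inj h
    obtain rfl := Subsingleton.elim f f'
    rfl
  rw [HasCardinalLT, ← Cardinal.lift_id.{w} κ]
  refine lt_of_le_of_lt (b := Cardinal.aleph0) ?_ ?_
  · simp
  · simpa using hκ

/-- Finite colimits of presentable objects are presentable. -/
lemma isCardinalPresentable_of_finCategory {K : Type} [SmallCategory K] [FinCategory K] {Y : K ⥤ C}
    (c : Cocone Y) (hc : IsColimit c) (h : ∀ k, IsCardinalPresentable (Y.obj k) κ) :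
    IsCardinalPresentable c.pt κ :=
  isCardinalPresentable_of_isColimit c hc κ
    (.of_le ((hasCardinalLT_aleph0_iff _).2 inferInstance) (Cardinal.IsRegular.aleph0_le Fact.out))

variable [IsCardinalLocallyPresentable C κ] [G.toFunctor.IsCardinalAccessible κ]

/-- A factorization `B ⟶ X ⟶ A` of a map of coalgebras through a presentable object `X` extends to
a factorization `B ⟶ X ⟶ B' ⟶ A` in which `B'` is a coalgebra with presentable underlying object
and `B ⟶ B'`, `B' ⟶ A` are maps of coalgebras. -/
lemma exists_factorization (hκ : Cardinal.aleph0 < κ) {A B : G.Coalgebra}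
    [IsCardinalPresentable B.A κ] (f : B ⟶ A) {X : C} [IsCardinalPresentable X κ] (q : B.A ⟶ X)
    (α : X ⟶ A.A) (hα : q ≫ α = f.f) :
    ∃ (B' : G.Coalgebra) (_ : IsCardinalPresentable B'.A κ) (g : B ⟶ B') (h : B' ⟶ A)
      (m : X ⟶ B'.A), g.f = q ≫ m ∧ m ≫ h.f = α := by
  have : HasColimitsOfSize.{0, 0} C := hasColimitsOfSizeShrink.{0, 0, w, w} C
  obtain ⟨P, _, hP⟩ := HasCardinalFilteredGenerator.exists_generator C κ
  obtain ⟨J, _, _, ⟨pr⟩⟩ := hP.exists_colimitsOfShape A.A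
  let D := pr.diag
  let c : Cocone D := Cocone.mk A.A pr.ι
  have hc : IsColimit c := pr.isColimit
  have (j : J) : IsCardinalPresentable (D.obj j) κ :=
    hP.le_isCardinalPresentable _ (pr.prop_diag_obj j)
  obtain ⟨j₀, m₀, hm₀⟩ := IsCardinalPresentable.exists_hom_of_isColimit κ hc α
  let T := { s : Stage c A.a // IsCardinalPresentable s.Y κ }
  have H (s : T) := have := s.2; s.1.exists_next κ hc A.a A.counit A.coassoc
  choose k u b h1 h2 h3 h4 using H
  let s₀ : T := ⟨{
    Y := B.A
    j := j₀
    y := q ≫ m₀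
    p := B.a ≫ G.map (q ≫ m₀)
    w := by
      have h := f.h
      rw [Category.assoc, Category.assoc, ← G.map_comp, Category.assoc, reassoc_of% hm₀,
        reassoc_of% hα, hm₀, hα, h] }, inferInstance⟩
  let next (s : T) : T := ⟨{
    Y := D.obj s.1.j
    j := k s
    y := D.map (u s)
    p := b s
    w := by rw [h1, reassoc_of% (c.w (u s))] }, inferInstance⟩
  let σ (n : ℕ) : T := Nat.rec s₀ (fun _ => next) n
  let l : Ladder G :=
    { X := fun n => D.obj (σ n).1.j
      d := fun n => D.map (u (σ n))
      a := fun n => b (σ n)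
      d_a := fun n => h3 (σ (n + 1))
      a_counit := fun n => h2 (σ n)
      a_a := fun n => h4 (σ (n + 1)) }
  have (n : ℕ) : IsCardinalPresentable (l.X n) κ := this _
  obtain ⟨h, hh⟩ := l.exists_desc (fun n => c.ι.app (σ n).1.j) fun n => c.w (u (σ n))
  refine ⟨l.coalgebra, l.isCardinalPresentable hκ, ⟨(q ≫ m₀) ≫ l.inc 0, ?_⟩, ⟨h, ?_⟩,
    m₀ ≫ l.inc 0, Category.assoc _ _ _, ?_⟩
  · exact l.map_inc_zero (q ≫ m₀) ((h3 s₀).trans (Category.assoc _ _ _))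
  · refine Ladder.hom_ext fun n => ?_
    change l.inc n ≫ l.str ≫ G.map h = l.inc n ≫ h ≫ A.a
    have e := l.inc_str n
    have e' := hh n
    rw [reassoc_of% e, ← G.map_comp, hh, reassoc_of% e']
    exact h1 (σ n)
  · refine (Category.assoc _ _ _).trans ((congrArg (m₀ ≫ ·) (hh 0)).trans hm₀)

variable (G κ) in
/-- A coalgebra whose underlying object is presentable is presentable. -/
lemma isCardinalPresentable_coalgebra (B : G.Coalgebra) [IsCardinalPresentable B.A κ] :
    IsCardinalPresentable B κ := by
  refine ⟨fun J _ _ => ⟨fun {K} => ⟨fun {c} hc => ⟨?_⟩⟩⟩⟩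
  have := isFiltered_of_isCardinalFiltered J κ
  have := G.toFunctor.preservesColimitsOfShape_of_isCardinalAccessible κ J
  have hU := isColimitOfPreserves G.forget hc
  have hGU := isColimitOfPreserves G.toFunctor hU
  refine Types.FilteredColimit.isColimitOf' _ _ ?_ ?_
  · intro (f : B ⟶ c.pt)
    obtain ⟨j, f', hf'⟩ : ∃ (j : J) (f' : B.A ⟶ (K.obj j).A), f' ≫ (c.ι.app j).f = f.f :=
      IsCardinalPresentable.exists_hom_of_isColimit κ hU f.f
    obtain ⟨k, v, hv⟩ := IsCardinalPresentable.exists_eq_of_isColimit' κ hGU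
      (B.a ≫ G.map f') (f' ≫ (K.obj j).a) (by
        change (B.a ≫ G.map f') ≫ G.map (c.ι.app j).f = (f' ≫ (K.obj j).a) ≫ G.map (c.ι.app j).f
        have e := f.h
        have e' : (K.obj j).a ≫ G.map (c.ι.app j).f = (c.ι.app j).f ≫ c.pt.a := (c.ι.app j).h
        rw [Category.assoc, Category.assoc, ← G.map_comp, e', hf', e, ← hf', Category.assoc])
    have hv : (B.a ≫ G.map f') ≫ G.map (K.map v).f =
      (f' ≫ (K.obj j).a) ≫ G.map (K.map v).f := hv
    refine ⟨k, (⟨f' ≫ (K.map v).f, ?_⟩ : B ⟶ K.obj k), ?_⟩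
    · rw [G.map_comp, ← Category.assoc, hv, Category.assoc, Category.assoc, (K.map v).h]
    · refine Comonad.Coalgebra.Hom.ext ?_
      change f.f = (f' ≫ (K.map v).f) ≫ (c.ι.app k).f
      have e := congrArg Comonad.Coalgebra.Hom.f (c.w v)
      rw [Category.assoc, ← hf']
      exact congrArg (f' ≫ ·) e.symm
  · intro j (x : B ⟶ K.obj j) (y : B ⟶ K.obj j) h
    obtain ⟨k, v, hv⟩ := IsCardinalPresentable.exists_eq_of_isColimit' κ hU x.f y.f
      (congrArg Comonad.Coalgebra.Hom.f h)
    exact ⟨k, v, Comonad.Coalgebra.Hom.ext hv⟩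

variable (G κ) in
/-- The category of coalgebras over an accessible comonad on a locally presentable category is
locally presentable, for every uncountable cardinal for which this makes sense. It is generated by
the coalgebras with presentable underlying objects. -/
lemma isCardinalLocallyPresentable_coalgebra (hκ : Cardinal.aleph0 < κ) :
    IsCardinalLocallyPresentable G.Coalgebra κ := by
  have : HasColimitsOfSize.{w, w} G.Coalgebra :=
    ⟨fun J _ => ⟨fun K => hasColimit_of_created K G.forget⟩⟩
  rw [IsCardinalLocallyPresentable.iff_exists_isStrongGenerator]
  obtain ⟨Q, _, hQ, hQ'⟩ :=
    ObjectProperty.EssentiallySmall.exists_small_le (isCardinalPresentable C κ)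
  let I := Σ X : Subtype Q, { a : X.1 ⟶ G.obj X.1 //
    a ≫ G.ε.app X.1 = 𝟙 _ ∧ a ≫ G.δ.app X.1 = a ≫ G.map a }
  have : Small.{w} I := inferInstance
  let P : ObjectProperty G.Coalgebra :=
    .ofObj fun i : I => { A := i.1.1, a := i.2.1, counit := i.2.2.1, coassoc := i.2.2.2 }
  -- every coalgebra with presentable underlying object is isomorphic to one in `P`
  have hPiso (B : G.Coalgebra) [IsCardinalPresentable B.A κ] :
      ∃ B' : G.Coalgebra, P B' ∧ Nonempty (B ≅ B') := by
    obtain ⟨X, hX, ⟨e⟩⟩ := hQ' B.A ‹_›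
    have h1 : G.map e.hom ≫ G.ε.app X = G.ε.app B.A ≫ e.hom := G.ε.naturality e.hom
    have h2 : G.map e.hom ≫ G.δ.app X = G.δ.app B.A ≫ G.map (G.map e.hom) := G.δ.naturality e.hom
    have h3 := B.counit
    have h4 := B.coassoc
    let B' : G.Coalgebra :=
      { A := X
        a := e.inv ≫ B.a ≫ G.map e.hom
        counit := by
          rw [Category.assoc, Category.assoc, h1, reassoc_of% h3, e.inv_hom_id]
        coassoc := by
          simp only [Category.assoc, G.map_comp]
          rw [h2, reassoc_of% h4, ← G.map_comp_assoc e.hom, e.hom_inv_id, G.map_id,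
            Category.id_comp] }
    refine ⟨B', .mk (⟨⟨X, hX⟩, ⟨B'.a, B'.counit, B'.coassoc⟩⟩ : I),
      ⟨Comonad.Coalgebra.isoMk e ?_⟩⟩
    exact (e.hom_inv_id_assoc _).symm
  obtain ⟨R, _, hR, hR'⟩ :=
    (IsCardinalLocallyPresentable.iff_exists_isStrongGenerator C κ).1 inferInstance
  have hinit : IsCardinalPresentable (⊥_ G.Coalgebra).A κ := by
    have h : IsInitial (⊥_ G.Coalgebra).A := initialIsInitial.isInitialObj G.forget
    exact isCardinalPresentable_of_finCategory _ h fun k => k.as.elim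
  -- maps from presentable objects to a coalgebra factor through small coalgebras
  have hfac {A : G.Coalgebra} {X : C} [IsCardinalPresentable X κ] (x : X ⟶ A.A) :
      ∃ (B : G.Coalgebra) (_ : IsCardinalPresentable B.A κ) (f : B ⟶ A) (y : X ⟶ B.A),
        y ≫ f.f = x := by
    have h : IsInitial (⊥_ G.Coalgebra).A := initialIsInitial.isInitialObj G.forget
    obtain ⟨B, hB, -, f, y, -, hy⟩ := exists_factorization hκ (initial.to A) (h.to X) x
      (h.hom_ext _ _)
    exact ⟨B, hB, f, y, hy⟩
  refine ⟨P, inferInstance, ?_, ?_⟩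
  · rw [ObjectProperty.isStrongGenerator_iff]
    constructor
    · intro A A' f g h
      refine Comonad.Coalgebra.Hom.ext (hR.isSeparating _ _ fun X hX x => ?_)
      have : IsCardinalPresentable X κ := hR' _ hX
      obtain ⟨B, _, t, y, rfl⟩ := hfac x
      obtain ⟨B', hB', ⟨e⟩⟩ := hPiso B
      have := h B' hB' (e.inv ≫ t)
      rw [Category.assoc, Category.assoc, cancel_epi] at this
      have := congrArg Comonad.Coalgebra.Hom.f this
      change t.f ≫ f.f = t.f ≫ g.f at this
      rw [Category.assoc, Category.assoc, this]
    · intro A A' i _ h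
      -- coalgebra maps to `A'` with presentable source factor through `i`
      have hlift (B : G.Coalgebra) [IsCardinalPresentable B.A κ] (t : B ⟶ A') :
          ∃ t' : B ⟶ A, t' ≫ i = t := by
        obtain ⟨B', hB', ⟨e⟩⟩ := hPiso B
        obtain ⟨s, hs⟩ := h B' hB' (e.inv ≫ t)
        have hs : s ≫ i = e.inv ≫ t := hs
        exact ⟨e.hom ≫ s, by rw [Category.assoc, hs, e.hom_inv_id_assoc]⟩
      -- Two maps `x`, `y` with `x ≫ i.f = y ≫ i.f` factor through a small coalgebra `B`. The map
      -- from `B` to `A'` identifies them, so it extends to a small coalgebra `B'` under `B` in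
      -- which they are identified, and the map `B' ⟶ A'` lifts to `A`.
      have : Mono i.f := by
        rw [hR.isSeparating.mono_iff]
        intro X hX x y hxy
        have : IsCardinalPresentable X κ := hR' _ hX
        have : IsCardinalPresentable (X ⨿ X) κ :=
          isCardinalPresentable_of_finCategory _ (colimit.isColimit (pair X X)) (by
            rintro ⟨_ | _⟩ <;> assumption)
        obtain ⟨B, _, t, z, hz⟩ := hfac (coprod.desc x y)
        have hx : (coprod.inl ≫ z) ≫ t.f = x := by rw [Category.assoc, hz, coprod.inl_desc]
        have hy : (coprod.inr ≫ z) ≫ t.f = y := by rw [Category.assoc, hz, coprod.inr_desc]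
        have : IsCardinalPresentable (coequalizer (coprod.inl ≫ z) (coprod.inr ≫ z)) κ :=
          isCardinalPresentable_of_finCategory _ (colimit.isColimit (parallelPair _ _)) (by
            rintro (_ | _) <;> assumption)
        obtain ⟨B', _, g, s, m, hg, hs⟩ := exists_factorization hκ (t ≫ i)
          (coequalizer.π (coprod.inl ≫ z) (coprod.inr ≫ z)) (coequalizer.desc (t ≫ i).f (by
            change _ ≫ t.f ≫ i.f = _ ≫ t.f ≫ i.f
            rw [← Category.assoc, hx, ← Category.assoc, hy, hxy])) (coequalizer.π_desc _ _)
        obtain ⟨s', rfl⟩ := hlift B' s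
        have hgt : g ≫ s' = t := by
          rw [← cancel_mono i, Category.assoc]
          refine Comonad.Coalgebra.Hom.ext ?_
          change g.f ≫ (s' ≫ i).f = (t ≫ i).f
          rw [hg, Category.assoc, hs, coequalizer.π_desc]
        have hgt' : g.f ≫ s'.f = t.f := congrArg Comonad.Coalgebra.Hom.f hgt
        rw [← hx, ← hy, ← hgt', hg, Category.assoc _ m, coequalizer.condition_assoc]
      have : IsIso (G.forget.map i) := by
        refine hR.isIso_of_mono i.f fun X hX x => ?_
        have : IsCardinalPresentable X κ := hR' _ hX
        obtain ⟨B, _, t, y, rfl⟩ := hfac x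
        obtain ⟨t', rfl⟩ := hlift B t
        exact ⟨y ≫ t'.f, Category.assoc _ _ _⟩
      exact isIso_of_reflects_iso i G.forget
  · rintro _ ⟨i⟩
    have : IsCardinalPresentable i.1.1 κ := hQ _ i.1.2
    exact isCardinalPresentable_coalgebra G κ _

end LocallyPresentable

end Coalgebras

/-! ### Algebras over operads and coalgebras over cooperads -/

section SchurFunctors

variable {E : Type u} [Category.{w} E] [MonoidalCategory E] [SymmetricCategory E]
  [HasColimitsOfSize.{0, 0} E] [∀ X : E, PreservesColimitsOfSize.{w, w} (tensorLeft X)]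
  [∀ X : E, PreservesColimitsOfSize.{w, w} (tensorRight X)]

lemma SymMod.preservesFilteredColimits_schur (M : SymMod E) :
    PreservesFilteredColimitsOfSize.{w, w} M.schur :=
  ⟨fun J _ _ => by
    have := IsFiltered.isSifted (C := J)
    infer_instance⟩

lemma SymMod.isCardinalAccessible_schur (M : SymMod E) (κ : Cardinal.{w}) [Fact κ.IsRegular] :
    M.schur.IsCardinalAccessible κ :=
  ⟨fun J _ _ => by
    have := isFiltered_of_isCardinalFiltered J κ
    have := M.preservesFilteredColimits_schur
    exact PreservesFilteredColimitsOfSize.preserves_filtered_colimits J⟩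

lemma SymMod.isAccessible_schur (M : SymMod E) : M.schur.IsAccessible.{w} :=
  ⟨_, Cardinal.fact_isRegular_aleph0.{w}, have := Cardinal.fact_isRegular_aleph0.{w}
    M.isCardinalAccessible_schur _⟩

end SchurFunctors

section OperadicAlgebras

variable {E : Type u} [Category.{w} E] [MonoidalCategory E] [SymmetricCategory E]
  [HasColimitsOfSize.{0, 0} E]
  [∀ X : E, PreservesColimitsOfSize.{0, 0} (tensorRight X)]

/-- The underlying functor of the comonad of coalgebras over a cooperad is the Schur functor. -/
def Cooperad.comonadicAdjunctionIso (C : Cooperad E) :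
    (comonadicAdjunction C.forget).toComonad.toFunctor ≅ C.toSymMod.schur :=
  NatIso.ofComponents (fun _ => Iso.refl _)
    fun _ => (Category.comp_id _).trans (Category.id_comp _).symm

variable [∀ X : E, PreservesColimitsOfSize.{w, w} (tensorLeft X)]
  [∀ X : E, PreservesColimitsOfSize.{w, w} (tensorRight X)]

lemma Cooperad.isLocallyPresentable_coalg (C : Cooperad E)
    (h : ∀ (κ : Cardinal.{w}) [Fact κ.IsRegular], IsCardinalLocallyPresentable E κ) :
    IsLocallyPresentable.{w} C.Coalg := by
  have : Fact (Cardinal.aleph.{w} 1).IsRegular := ⟨Cardinal.isRegular_aleph_one⟩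
  have := h (Cardinal.aleph 1)
  have : C.adj.toComonad.toFunctor.IsCardinalAccessible (Cardinal.aleph.{w} 1) :=
    C.toSymMod.isCardinalAccessible_schur _
  have : IsLocallyPresentable.{w} C.adj.toComonad.Coalgebra :=
    ⟨_, _, isCardinalLocallyPresentable_coalgebra _ (Cardinal.aleph 1)
      Cardinal.aleph0_lt_aleph_one⟩
  exact (Comonad.comparison C.adj).asEquivalence.symm.isLocallyPresentable

variable [∀ X : E, PreservesColimitsOfSize.{0, 0} (tensorLeft X)]

/-- The underlying functor of the monad of algebras over an operad is the Schur functor. -/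
def Operad.monadicAdjunctionIso (P : Operad E) :
    (monadicAdjunction P.forget).toMonad.toFunctor ≅ P.toSymMod.schur :=
  NatIso.ofComponents (fun _ => Iso.refl _)
    fun _ => (Category.comp_id _).trans (Category.id_comp _).symm

lemma Operad.isLocallyPresentable_alg (P : Operad E)
    (h : ∀ (κ : Cardinal.{w}) [Fact κ.IsRegular], IsCardinalLocallyPresentable E κ) :
    IsLocallyPresentable.{w} P.Alg := by
  have := Cardinal.fact_isRegular_aleph0.{w}
  have := h Cardinal.aleph0
  have : P.adj.toMonad.toFunctor.IsCardinalAccessible Cardinal.aleph0.{w} :=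
    P.toSymMod.isCardinalAccessible_schur _
  have : PreservesColimitsOfShape WalkingReflexivePair P.adj.toMonad.toFunctor :=
    inferInstanceAs (PreservesColimitsOfShape WalkingReflexivePair P.toSymMod.schur)
  have : IsLocallyPresentable.{w} P.adj.toMonad.Algebra :=
    ⟨_, _, isCardinalLocallyPresentable_algebra _ Cardinal.aleph0⟩
  exact (Monad.comparison P.adj).asEquivalence.symm.isLocallyPresentable

end OperadicAlgebras

/-! ### Chain complexes of vector spaces -/

section Complexes

open HomologicalComplex

variable {K : Type u} [Field K]

section Tensor

variable {J : Type*} [Category* J]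
  [∀ i : ℤ, PreservesColimitsOfShape J (eval (ModuleCat.{u} K) (ComplexShape.down ℤ) i)]

lemma preservesColimitsOfShape_tensorLeft_complex
    [∀ X : ModuleCat.{u} K, PreservesColimitsOfShape J (tensorLeft X)] (X : Ch K) :
    PreservesColimitsOfShape J (tensorLeft X) := by
  refine preservesColimitsOfShape_of_eval _ fun n => ?_
  refine preservesColimitsOfShape_of_presentation
    (I := { p : ℤ × ℤ // p.1 + p.2 = n }) (R := fun _ => Empty)
    (G := fun p => eval _ _ p.1.2 ⋙ tensorLeft (X.X p.1.1))
    (inc := fun p =>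
      { app := fun Y => ιTensorObj X Y p.1.1 p.1.2 n p.2
        naturality := fun Y Y' f => ?_ })
    (act := fun _ => Empty.elim) (act_inc := fun _ σ => σ.elim) (ext := ?_) (desc := ?_)
  · have h := ι_mapBifunctorMap (𝟙 X) f (curriedTensor (ModuleCat.{u} K)) (ComplexShape.down ℤ)
      p.1.1 p.1.2 n p.2
    refine Eq.symm (Eq.trans h ?_)
    exact (congrArg (· ≫ _) (id_whiskerRight _ _)).trans (Category.id_comp _)
  · intro Y Z f g h
    exact mapBifunctor.hom_ext (F := curriedTensor _) fun i j hij => h ⟨(i, j), hij⟩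
  · intro Y Z g _
    exact ⟨mapBifunctorDesc fun i j hij => g ⟨(i, j), hij⟩, fun p => ι_mapBifunctorDesc _ _ _ p.2⟩

lemma preservesColimitsOfShape_tensorRight_complex
    [∀ X : ModuleCat.{u} K, PreservesColimitsOfShape J (tensorRight X)] (X : Ch K) :
    PreservesColimitsOfShape J (tensorRight X) := by
  refine preservesColimitsOfShape_of_eval _ fun n => ?_
  refine preservesColimitsOfShape_of_presentation
    (I := { p : ℤ × ℤ // p.1 + p.2 = n }) (R := fun _ => Empty)
    (G := fun p => eval _ _ p.1.1 ⋙ tensorRight (X.X p.1.2))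
    (inc := fun p =>
      { app := fun Y => ιTensorObj Y X p.1.1 p.1.2 n p.2
        naturality := fun Y Y' f => ?_ })
    (act := fun _ => Empty.elim) (act_inc := fun _ σ => σ.elim) (ext := ?_) (desc := ?_)
  · have h := ι_mapBifunctorMap f (𝟙 X) (curriedTensor (ModuleCat.{u} K)) (ComplexShape.down ℤ)
      p.1.1 p.1.2 n p.2
    refine Eq.symm (Eq.trans h (congrArg (_ ≫ ·) ?_))
    exact (congrArg (· ≫ _) (MonoidalCategory.whiskerLeft_id _ _)).trans (Category.id_comp _)
  · intro Y Z f g h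
    exact mapBifunctor.hom_ext (F := curriedTensor _) fun i j hij => h ⟨(i, j), hij⟩
  · intro Y Z g _
    exact ⟨mapBifunctorDesc fun i j hij => g ⟨(i, j), hij⟩, fun p => ι_mapBifunctorDesc _ _ _ p.2⟩

end Tensor

/-- The tensor product of complexes preserves colimits in the second variable. -/
instance preservesColimitsOfSize_tensorLeft_complex (X : Ch K) :
    PreservesColimitsOfSize.{u, u} (tensorLeft X) where
  preservesColimitsOfShape := preservesColimitsOfShape_tensorLeft_complex X

instance preservesColimitsOfSize_tensorRight_complex (X : Ch K) :
    PreservesColimitsOfSize.{u, u} (tensorRight X) where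
  preservesColimitsOfShape := preservesColimitsOfShape_tensorRight_complex X

instance preservesSmallColimits_tensorLeft_complex (X : Ch K) :
    PreservesColimitsOfSize.{0, 0} (tensorLeft X) :=
  preservesColimitsOfSize_shrink.{0, u, 0, u} _

instance preservesSmallColimits_tensorRight_complex (X : Ch K) :
    PreservesColimitsOfSize.{0, 0} (tensorRight X) :=
  preservesColimitsOfSize_shrink.{0, u, 0, u} _

/-- The category of complexes of vector spaces is locally presentable. It is generated by the
complexes that corepresent the functors `X ↦ X i`. -/
instance isCardinalLocallyPresentable_complex (κ : Cardinal.{u}) [Fact κ.IsRegular] :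
    IsCardinalLocallyPresentable (Ch K) κ := by
  have : LocallySmall.{u} (Ch K) := inferInstance
  rw [IsCardinalLocallyPresentable.iff_exists_isStrongGenerator]
  let F : Unit → ModuleCat.{u} K := fun _ => (ModuleCat.free K).obj PUnit
  have hF : ObjectProperty.IsSeparating (.ofObj F) := by
    intro M N f g h
    ext x
    let p : (ModuleCat.free K).obj PUnit ⟶ M := ModuleCat.freeDesc (↾fun _ => x)
    have hp : p (ModuleCat.freeMk PUnit.unit) = x := ModuleCat.freeDesc_apply _ _
    have := ConcreteCategory.congr_hom (h _ (.mk ()) p) (ModuleCat.freeMk PUnit.unit)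
    exact (congrArg f hp).symm.trans (this.trans (congrArg g hp))
  have hF' : IsCardinalPresentable ((ModuleCat.free K).obj PUnit) κ := by
    have : IsCardinalPresentable (PUnit : Type u) κ := by
      rw [Types.isCardinalPresentable_iff]
      exact hasCardinalLT_of_finite _ _ (Cardinal.IsRegular.aleph0_le Fact.out)
    have : (CategoryTheory.forget (ModuleCat.{u} K)).IsCardinalAccessible κ := ⟨fun J _ _ => by
      have := isFiltered_of_isCardinalFiltered J κ
      infer_instance⟩
    exact (ModuleCat.adj K).isCardinalPresentable_leftAdjoint_obj κ _
  have hsep := isSeparating_separatingFamily (ComplexShape.down ℤ) hF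
  refine ⟨.ofObj (separatingFamily (ComplexShape.down ℤ) F), inferInstance, ?_, ?_⟩
  · rw [ObjectProperty.isStrongGenerator_iff]
    refine ⟨hsep, fun X Y i _ h => ?_⟩
    have : Epi i := ⟨fun f g hfg => hsep _ _ fun Z hZ z => by
      obtain ⟨z', rfl⟩ := h Z hZ z
      exact (Category.assoc _ _ _).trans
        ((congrArg (z' ≫ ·) hfg).trans (Category.assoc _ _ _).symm)⟩
    exact isIso_of_mono_of_epi i
  · rintro _ ⟨⟨_, i⟩⟩
    have : (coyoneda.obj (Opposite.op ((ModuleCat.free K).obj PUnit))).IsCardinalAccessible κ := hF'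
    have : (eval (ModuleCat.{u} K) (ComplexShape.down ℤ) i).IsCardinalAccessible κ :=
      ⟨fun J _ _ => inferInstance⟩
    exact Functor.isCardinalAccessible_of_natIso
      (evalCompCoyonedaCorepresentable (ComplexShape.down ℤ) (F ()) i).toIso.symm κ

end Complexes

end
end OperadTheory

theorem mainTheorem6 {k : Type u} [Field k]
    (P : OperadTheory.Operad (OperadTheory.Ch k))
    (C : OperadTheory.Cooperad (OperadTheory.Ch k)) :
    -- both categories are locally presentable
    CategoryTheory.IsLocallyPresentable.{u} P.Alg ∧
    CategoryTheory.IsLocallyPresentable.{u} C.Coalg ∧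
    -- they are monadic, respectively comonadic, for the Schur functors
    (∃ _ : CategoryTheory.MonadicRightAdjoint P.forget,
      Nonempty ((CategoryTheory.monadicAdjunction P.forget).toMonad.toFunctor ≅
        P.toSymMod.schur)) ∧
    (∃ _ : CategoryTheory.ComonadicLeftAdjoint C.forget,
      Nonempty ((CategoryTheory.comonadicAdjunction C.forget).toComonad.toFunctor ≅
        C.toSymMod.schur)) ∧
    -- Schur functors preserve filtered colimits and are accessible
    (∀ M : OperadTheory.SymMod (OperadTheory.Ch k),
      CategoryTheory.Limits.PreservesFilteredColimitsOfSize.{u, u} M.schur ∧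
      CategoryTheory.Functor.IsAccessible.{u} M.schur) := by
  exact ⟨P.isLocallyPresentable_alg fun _ => inferInstance,
    C.isLocallyPresentable_coalg fun _ => inferInstance,
    ⟨inferInstance, ⟨P.monadicAdjunctionIso⟩⟩, ⟨inferInstance, ⟨C.comonadicAdjunctionIso⟩⟩,
    fun M => ⟨M.preservesFilteredColimits_schur, M.isAccessible_schur⟩⟩
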